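/- **Setting.** Let $P$ be a Euclidean regular pentagon of side length $1$ with symmetry group $D_5$. Fix a finite set $X$ of decorations on which $D_5$ acts. A *complex of decorated pentagons* is a collection of copies of $P$ (tiles), each carrying a decoration, pasted together isometrically along edges; a *combinatorial tiling* is such a complex $L$ in which every edge is pasted to exactly one other edge and which is homeomorphic to the plane (in its CW-topology). $L_{\mathrm{aff}}$ denotes its underlying space with the metric $d_L$, the infimum of the lengths of broken lines each of whose segments lies in one tile. *Substitution of complexes.* $\omega(L)$ is obtained by replacing each tile $t$ by six unit regular pentagons $\omega(t)$, combinatorially a half-dodecahedron: each edge of $t$ is divided at its midpoint, a central pentagon is placed inside $t$, and each midpoint is joined to one vertex of the central pentagon; so there is a central tile and one outer tile at each of the five vertices of $t$. The decoration of $t$ determines those of the six new tiles, by a rule that commutes with the symmetries of the pentagon. Let $K_0$ be a decorated pentagon such that the central tile of $\omega(K_0)$ is isomorphic to $K_0$, let $K_n=\omega^n(K_0)$, and let $K=\lim K_n$ be the direct limit under the embeddings that send the central pentagon to the central pentagon. *Substitution of points.* $\omega:L_{\mathrm{aff}}\to\omega(L)_{\mathrm{aff}}$ is defined tile by tile. Let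 $t$ have vertices $v_k$ and edge midpoints $m_k$ of $v_kv_{k+1}$ ($k\in\mathbb Z/5$), and let $c_k$ be the vertices of the concentric regular pentagon of side length $s=\tfrac12\big(\sqrt5-\sqrt{4-\sqrt5}\big)$, where $c_k$ lies on the segment from the centre of $t$ to $m_k$. The pentagon $c_0\cdots c_4$ is mapped onto the central tile by a similarity of ratio $1/s$, and the triangles $v_kc_kc_{k-1}$, $v_km_kc_k$, $v_kc_{k-1}m_{k-1}$ are mapped affinely onto the three triangles into which the outer tile at $v_k$ is divided by its two diagonals from the vertex $v_k$, with $v_k,m_k,c_k,c_{k-1},m_{k-1}$ going to the five vertices of that tile that bear these names. *The continuous hull.* A combinatorial tiling $L$ is *locally isomorphic to $K$* if each finite set of tiles of $L$ has a union isomorphic to that of a set of tiles of $K$, by a map that preserves cells and decorations. $\Omega$ is the set of classes $[L,x]$ with $L$ a combinatorial tiling locally isomorphic to $K$ and $x\in L_{\mathrm{aff}}$, where $(L,x)\sim(L',x')$ if some isomorphism $L_{\mathrm{aff}}\to L'_{\mathrm{aff}}$ that preserves cells and decorations and is isometric on each cell maps $x$ to $x'$. Its metric is $d([L,x],[L',x'])=\min\big(\tfrac1{\sqrt2},\inf\Lambda\big)$,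 where $\Lambda$ is the set of all $\varepsilon>0$ for which there are maps $\phi:B(x,1/\varepsilon,L)\to L'$ and $\phi':B(x',1/\varepsilon,L')\to L$ on the closed metric balls that are isometries for $d_L,d_{L'}$, preserve cells, decorations and degrees of vertices, and satisfy $d_{L'}(\phi(x),x')\le\varepsilon$ and $d_L(\phi'(x'),x)\le\varepsilon$. **Theorem.** For every such decorated substitution rule: if $L$ is a combinatorial tiling locally isomorphic to $K$, then so is $\omega(L)$, and $\omega:L_{\mathrm{aff}}\to\omega(L)_{\mathrm{aff}}$ is a well-defined map; the substitution map $$\omega:\Omega\to\Omega,\qquad \omega([L,x])=[\omega(L),\omega(x)],$$ is well defined, and it is a homeomorphism of $\Omega$ (with the topology of $d$) onto itself. -/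

import Mathlib

open scoped ComplexConjugate

noncomputable section

namespace PentHull

/-! ### The unit regular pentagon and its symmetries -/

/-- `unitRoot k = exp (2 * π * I * k / 5)`. -/
def unitRoot (k : ZMod 5) : ℂ := ZMod.stdAddChar k

/-- The circumradius of a regular pentagon of side length one. -/
def circumradius : ℝ := 1 / (2 * Real.sin (Real.pi / 5))

/-- The vertices of the regular pentagon of side length one centred at `0`, numbered
counterclockwise by `ZMod 5`. Edge `k` joins the vertices `k` and `k + 1`. -/
def vert (k : ZMod 5) : ℂ := circumradius * unitRoot k

/-- The closed regular pentagon of side length one. -/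
def pentagon : Set ℂ := convexHull ℝ (Set.range vert)

/-- The pentagon as a metric subspace of the Euclidean plane `ℂ`. -/
abbrev Pent : Type := pentagon

/-- The ten symmetries of the pentagon, acting on the plane. -/
def sym : DihedralGroup 5 → ℂ → ℂ
  | .r i, z => unitRoot i * z
  | .sr i, z => unitRoot (-i) * conj z

/-- The ten symmetries of the pentagon, acting on the numbers of its vertices. -/
def symIdx : DihedralGroup 5 → ZMod 5 → ZMod 5
  | .r i, k => i + k
  | .sr i, k => -i - k

theorem conj_unitRoot (k : ZMod 5) : conj (unitRoot k) = unitRoot (-k) := by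
  unfold unitRoot
  rw [AddChar.map_neg_eq_conj]

theorem unitRoot_add (j k : ZMod 5) : unitRoot (j + k) = unitRoot j * unitRoot k := by
  unfold unitRoot
  rw [AddChar.map_add_eq_mul]

theorem sym_one (z : ℂ) : sym 1 z = z := by
  change unitRoot 0 * z = z
  simp [unitRoot]

theorem sym_mul (g h : DihedralGroup 5) (z : ℂ) : sym (g * h) z = sym g (sym h z) := by
  rcases g with i | i <;> rcases h with j | j <;>
    simp only [DihedralGroup.r_mul_r, DihedralGroup.r_mul_sr, DihedralGroup.sr_mul_r,
      DihedralGroup.sr_mul_sr, sym, map_mul, conj_unitRoot, neg_neg, Complex.conj_conj,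
      ← mul_assoc, ← unitRoot_add] <;> congr 2 <;> ring

theorem sym_vert (g : DihedralGroup 5) (k : ZMod 5) : sym g (vert k) = vert (symIdx g k) := by
  rcases g with i | i
  · simp only [sym, symIdx, vert, unitRoot_add]; ring
  · simp only [sym, symIdx, vert, map_mul, conj_unitRoot, Complex.conj_ofReal, sub_eq_add_neg,
      unitRoot_add]; ring

theorem sym_isLinear (g : DihedralGroup 5) : IsLinearMap ℝ (sym g) := by
  rcases g with i | i <;> constructor <;> intros <;> simp [sym, mul_add] <;> ring

theorem sym_mem (g : DihedralGroup 5) (p : Pent) : sym g p ∈ pentagon := by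
  have h : sym g p ∈ sym g '' pentagon := ⟨p, p.2, rfl⟩
  unfold pentagon at h
  rw [(sym_isLinear g).image_convexHull] at h
  refine convexHull_mono ?_ h
  rintro _ ⟨_, ⟨k, rfl⟩, rfl⟩
  exact ⟨symIdx g k, (sym_vert g k).symm⟩

/-- The action of the symmetries on the points of the pentagon. -/
def symP (g : DihedralGroup 5) (p : Pent) : Pent := ⟨sym g p, sym_mem g p⟩

/-- The vertex number `k` as a point of the pentagon. -/
def vertP (k : ZMod 5) : Pent := ⟨vert k, subset_convexHull ℝ _ ⟨k, rfl⟩⟩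

/-! ### Complexes of decorated pentagons -/

/-- A complex of unit regular pentagons pasted together along edges. The vertices of each tile are
numbered counterclockwise (for one orientation of the whole complex); `glue t i u j` says that
edge `i` of the tile `t` is pasted, with the opposite direction, to edge `j` of the tile `u`.
Each tile carries a decoration in `X`, as it is seen in the numbering of its vertices. -/
structure PentComplex (X : Type) where
  /-- the set of tiles -/
  tile : Type
  /-- the pasted pairs of edges -/
  glue : tile → ZMod 5 → tile → ZMod 5 → Prop
  /-- the decorations -/
  deco : tile → X

namespace PentComplex

variable {X : Type}

/-- The pasting of the points of the edges. -/
inductive PointGlue (L : PentComplex X) : (Σ _ : L.tile, Pent) → (Σ _ : L.tile, Pent) → Prop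
  | mk (t u : L.tile) (i j : ZMod 5) (s : ℝ) (p q : Pent) (h : L.glue t i u j)
      (hs : s ∈ Set.Icc (0 : ℝ) 1)
      (hp : (p : ℂ) = AffineMap.lineMap (vert i) (vert (i + 1)) s)
      (hq : (q : ℂ) = AffineMap.lineMap (vert j) (vert (j + 1)) (1 - s)) :
      PointGlue L ⟨t, p⟩ ⟨u, q⟩

/-- The space underlying the complex: the disjoint union of the tiles modulo the pasting
(`Quot` takes the generated equivalence relation). It carries the quotient topology, which is the
CW topology. -/
def Point (L : PentComplex X) : Type := Quot L.PointGlue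

instance (L : PentComplex X) : TopologicalSpace L.Point :=
  inferInstanceAs (TopologicalSpace (Quot L.PointGlue))

/-- The point of the complex that is given by the point `p` of the tile `t`. -/
def pt (L : PentComplex X) (t : L.tile) (p : Pent) : L.Point := Quot.mk _ ⟨t, p⟩

/-- `L.PathLength x y l`: there is a path from `x` to `y` of length `l` that consists of finitely
many line segments, each of them in a single tile. -/
inductive PathLength (L : PentComplex X) : L.Point → L.Point → ℝ → Prop
  | nil (x : L.Point) : PathLength L x x 0
  | cons (t : L.tile) (p q : Pent) (y : L.Point) (l : ℝ) (h : PathLength L (L.pt t q) y l) :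
      PathLength L (L.pt t p) y (dist p q + l)

/-- The path metric: the infimum of the lengths of the paths between two points. -/
def pathDist (L : PentComplex X) (x y : L.Point) : ℝ := sInf {l | L.PathLength x y l}

/-- The closed ball of the path metric. -/
def ball (L : PentComplex X) (x : L.Point) (r : ℝ) : Set L.Point := {y | L.pathDist x y ≤ r}

/-- The degree of a vertex (in a complex without boundary): the number of corners of tiles
that meet in it. -/
def degree (L : PentComplex X) (v : L.Point) : ℕ :=
  Nat.card {c : L.tile × ZMod 5 // L.pt c.1 (vertP c.2) = v}

/-- A combinatorial tiling by pentagons: a complex of pentagons in which every edge is pasted to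
exactly one other edge, homeomorphic to the plane. -/
structure IsTiling (L : PentComplex X) : Prop where
  symm : ∀ t i u j, L.glue t i u j → L.glue u j t i
  irrefl : ∀ t i, ¬ L.glue t i t i
  closed : ∀ t i, ∃! e : L.tile × ZMod 5, L.glue t i e.1 e.2
  plane : Nonempty (L.Point ≃ₜ ℂ)

variable [MulAction (DihedralGroup 5) X]

/-- On the part of the tile `t` that lies in `B`, the map `φ` is the restriction of an isometry of
`t` onto a tile of `L'` that carries vertices to vertices, edges to edges and the decoration to
the decoration. -/
def TileMapOn (L L' : PentComplex X) (φ : L.Point → L'.Point) (B : Set L.Point) (t : L.tile) :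
    Prop :=
  ∃ (t' : L'.tile) (g : DihedralGroup 5), L'.deco t' = g • L.deco t ∧
    ∀ p : Pent, L.pt t p ∈ B → φ (L.pt t p) = L'.pt t' (symP g p)

/-- A cell-preserving, decoration-preserving isomorphism that is isometric on each cell. -/
def IsIso (L L' : PentComplex X) (φ : L.Point ≃ L'.Point) : Prop :=
  (∀ t, L.TileMapOn L' φ Set.univ t) ∧ ∀ t', L'.TileMapOn L φ.symm Set.univ t'

/-- The union of a set of tiles. -/
def support (L : PentComplex X) (P : Set L.tile) : Set L.Point :=
  {x | ∃ t ∈ P, ∃ p : Pent, x = L.pt t p}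

/-- `L` is locally isomorphic to `K`: every patch (finite set of tiles) of `L` is isomorphic to a
patch of `K`, by an isomorphism that preserves cells and decorations. -/
def LocallyIsoTo (L K : PentComplex X) : Prop :=
  ∀ P : Set L.tile, P.Finite → ∃ φ : L.Point → K.Point,
    Set.InjOn φ (L.support P) ∧ ∀ t ∈ P, L.TileMapOn K φ (L.support P) t

/-- `φ` is, on `B`, an isometry for the path metrics that preserves the cells, the decorations and
the degrees of the vertices. -/
structure IsPatchIsometry (L L' : PentComplex X) (φ : L.Point → L'.Point) (B : Set L.Point) :
    Prop where
  isometry : ∀ y ∈ B, ∀ z ∈ B, L'.pathDist (φ y) (φ z) = L.pathDist y z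
  cells : ∀ t, (∃ p, L.pt t p ∈ B) → L.TileMapOn L' φ B t
  degrees : ∀ t k, L.pt t (vertP k) ∈ B →
    L'.degree (φ (L.pt t (vertP k))) = L.degree (L.pt t (vertP k))

theorem IsIso.refl (L : PentComplex X) : L.IsIso L (Equiv.refl _) := by
  have h : ∀ p, symP 1 p = p := fun p => Subtype.ext (sym_one p)
  constructor <;> intro t <;> exact ⟨t, 1, by simp, fun p _ => by simp [h]⟩

theorem IsIso.symm {L L' : PentComplex X} {φ : L.Point ≃ L'.Point} (h : L.IsIso L' φ) :
    L'.IsIso L φ.symm := ⟨h.2, by simpa using h.1⟩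

theorem TileMapOn.comp {L L' L'' : PentComplex X} {φ : L.Point → L'.Point}
    {ψ : L'.Point → L''.Point} (hφ : ∀ t, L.TileMapOn L' φ Set.univ t)
    (hψ : ∀ t, L'.TileMapOn L'' ψ Set.univ t) (t : L.tile) :
    L.TileMapOn L'' (ψ ∘ φ) Set.univ t := by
  obtain ⟨t', g, h1, h2⟩ := hφ t
  obtain ⟨t'', g', h3, h4⟩ := hψ t'
  refine ⟨t'', g' * g, by rw [h3, h1, mul_smul], fun p _ => ?_⟩
  have h : symP (g' * g) p = symP g' (symP g p) := Subtype.ext (sym_mul g' g p)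
  rw [h, Function.comp_apply, h2 p trivial, h4 _ trivial]

theorem IsIso.trans {L L' L'' : PentComplex X} {φ : L.Point ≃ L'.Point}
    {ψ : L'.Point ≃ L''.Point} (hφ : L.IsIso L' φ) (hψ : L'.IsIso L'' ψ) :
    L.IsIso L'' (φ.trans ψ) :=
  ⟨TileMapOn.comp (φ := φ) (ψ := ψ) hφ.1 hψ.1,
    TileMapOn.comp (φ := ψ.symm) (ψ := φ.symm) hψ.2 hφ.2⟩

/-- The complex that consists of a single pentagon. -/
def single (x : X) : PentComplex X where
  tile := Unit
  glue _ _ _ _ := False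
  deco _ := x

end PentComplex

/-! ### The substitution -/

/-- The pasting in the subdivided complex. The tile `t` is replaced by a central tile `(t, none)`
and five outer tiles `(t, some k)`, one at each vertex `k` of `t`. The edge `k` of `t` is divided
by its midpoint, which is joined to a new inner vertex `c k`; the vertex `j` of the central tile is
`c (j + 2)` (opposite to the vertex `j` of `t`), and the vertices `0, 1, 2, 3, 4` of the tile
`(t, some k)` are: vertex `k` of `t`, midpoint of edge `k`, `c k`, `c (k - 1)`, midpoint of edge
`k - 1`. -/
inductive SubGlue {T : Type} (G : T → ZMod 5 → T → ZMod 5 → Prop) :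
    T × Option (ZMod 5) → ZMod 5 → T × Option (ZMod 5) → ZMod 5 → Prop
  | centre_outer (t : T) (k : ZMod 5) : SubGlue G (t, none) (k + 2) (t, some k) 2
  | outer_centre (t : T) (k : ZMod 5) : SubGlue G (t, some k) 2 (t, none) (k + 2)
  | outer_next (t : T) (k : ZMod 5) : SubGlue G (t, some k) 1 (t, some (k + 1)) 3
  | outer_prev (t : T) (k : ZMod 5) : SubGlue G (t, some (k + 1)) 3 (t, some k) 1
  | first_half (t u : T) (k l : ZMod 5) (h : G t k u l) :
      SubGlue G (t, some k) 0 (u, some (l + 1)) 4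
  | second_half (t u : T) (k l : ZMod 5) (h : G t k u l) :
      SubGlue G (t, some (k + 1)) 4 (u, some l) 0

/-- The effect of a symmetry of a tile on the vertex numbers of its outer tiles. -/
def outerSym : DihedralGroup 5 → DihedralGroup 5
  | .r _ => 1
  | .sr _ => .sr 0

/-- A decorated version of the subdivision rule: a decoration of a tile determines the decorations
of the six tiles of its subdivision, in a way that does not depend on the numbering of vertices.
The decorated pentagon `seed` is, up to a symmetry of the pentagon, the central tile of its own
subdivision. -/
structure Decoration (X : Type) [MulAction (DihedralGroup 5) X] where
  /-- the decoration of the central tile -/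
  centre : X → X
  /-- the decoration of the outer tile at vertex `k` -/
  outer : X → ZMod 5 → X
  centre_smul : ∀ (g : DihedralGroup 5) (x : X), centre (g • x) = g • centre x
  outer_smul : ∀ (g : DihedralGroup 5) (x : X) (k : ZMod 5),
    outer (g • x) (symIdx g k) = outerSym g • outer x k
  /-- the decoration of the initial pentagon -/
  seed : X
  /-- the position of the initial pentagon in the centre of its subdivision -/
  turn : DihedralGroup 5
  centre_seed : centre seed = turn • seed

/-- The ratio of the side of the inner pentagon of the partition of a tile to the side of the
tile. -/
def innerRatio : ℝ := (√5 - √(4 - √5)) / 2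

/-- The vertices of the inner pentagon; `inner k` lies on the segment from the centre to the
midpoint of edge `k`. -/
def inner (k : ZMod 5) : ℂ := -innerRatio * vert (k + 3)

/-- The midpoint of edge `k`. -/
def mid (k : ZMod 5) : ℂ := midpoint ℝ (vert k) (vert (k + 1))

namespace Decoration

variable {X : Type} [MulAction (DihedralGroup 5) X] (D : Decoration X)

/-- The complex `ω(L)`: each tile is replaced by six tiles, again unit regular pentagons. -/
def subst (L : PentComplex X) : PentComplex X where
  tile := L.tile × Option (ZMod 5)
  glue := SubGlue L.glue
  deco
    | (t, none) => D.centre (L.deco t)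
    | (t, some k) => D.outer (L.deco t) k

/-- The graph of the map `ω` from the points of `L` to the points of `ω(L)`. The inner pentagon of
a tile is mapped onto the central tile by a similarity; at each vertex `k`, three triangles are
mapped affinely onto the three triangles into which the outer tile at `k` is divided by the two
diagonals from its vertex `0`. -/
inductive SubstGraph (L : PentComplex X) : L.Point → (D.subst L).Point → Prop
  | centre (t : L.tile) (p q : Pent) (h : (p : ℂ) = -innerRatio * (q : ℂ)) :
      SubstGraph L (L.pt t p) ((D.subst L).pt (t, none) q)
  | middle (t : L.tile) (k : ZMod 5) (a b c : ℝ) (p q : Pent)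
      (ha : 0 ≤ a) (hb : 0 ≤ b) (hc : 0 ≤ c) (habc : a + b + c = 1)
      (hp : (p : ℂ) = a * vert k + b * inner k + c * inner (k - 1))
      (hq : (q : ℂ) = a * vert 0 + b * vert 2 + c * vert 3) :
      SubstGraph L (L.pt t p) ((D.subst L).pt (t, some k) q)
  | next (t : L.tile) (k : ZMod 5) (a b c : ℝ) (p q : Pent)
      (ha : 0 ≤ a) (hb : 0 ≤ b) (hc : 0 ≤ c) (habc : a + b + c = 1)
      (hp : (p : ℂ) = a * vert k + b * mid k + c * inner k)
      (hq : (q : ℂ) = a * vert 0 + b * vert 1 + c * vert 2) :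
      SubstGraph L (L.pt t p) ((D.subst L).pt (t, some k) q)
  | prev (t : L.tile) (k : ZMod 5) (a b c : ℝ) (p q : Pent)
      (ha : 0 ≤ a) (hb : 0 ≤ b) (hc : 0 ≤ c) (habc : a + b + c = 1)
      (hp : (p : ℂ) = a * vert k + b * inner (k - 1) + c * mid (k - 1))
      (hq : (q : ℂ) = a * vert 0 + b * vert 3 + c * vert 4) :
      SubstGraph L (L.pt t p) ((D.subst L).pt (t, some k) q)

/-! ### The tiling `K` -/

/-- The supertile `ω^n` of a single pentagon. -/
def superTile (x : X) : ℕ → PentComplex X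
  | 0 => PentComplex.single x
  | n + 1 => D.subst (superTile x n)

/-- The embedding of `ω^n` of a pentagon into `ω^(n+1)` of a pentagon, onto `ω^n` of the central
tile. -/
def embed (x y : X) : (n : ℕ) → (D.superTile x n).tile → (D.superTile y (n + 1)).tile
  | 0, t => (t, none)
  | n + 1, (t, o) => (embed x y n t, o)

theorem deco_embed (x y : X) (h : D.centre y = x) (n : ℕ) (t : (D.superTile x n).tile) :
    (D.superTile y (n + 1)).deco (D.embed x y n t) = (D.superTile x n).deco t := by
  induction n with
  | zero => exact h
  | succ n ih =>
    obtain ⟨t, o⟩ := t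
    have h1 := ih t
    cases o with
    | none => exact congrArg D.centre h1
    | some k => exact congrArg (fun z => D.outer z k) h1

/-- The decoration of the initial pentagon, with its vertices numbered such that the central tile
of the subdivision of `seedAt (n + 1)` is `seedAt n` as a pentagon with numbered vertices. -/
def seedAt (n : ℕ) : X := (D.turn⁻¹) ^ n • D.seed

theorem centre_seedAt (n : ℕ) : D.centre (D.seedAt (n + 1)) = D.seedAt n := by
  unfold seedAt
  rw [D.centre_smul, D.centre_seed, smul_smul, pow_succ, inv_mul_cancel_right]

/-- The supertile `K_n`, which is `ω^n` of the initial pentagon. -/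
def supertileK (n : ℕ) : PentComplex X := D.superTile (D.seedAt n) n

/-- The embedding of `K_n` into `K_(n+1)` that maps the central tile to the central tile. -/
def embedK (n : ℕ) : (D.supertileK n).tile → (D.supertileK (n + 1)).tile :=
  D.embed (D.seedAt n) (D.seedAt (n + 1)) n

/-- The identification of a tile of `K_n` with its image in `K_(n+1)`. -/
def LimitRel (a b : Σ n, (D.supertileK n).tile) : Prop := b = ⟨a.1 + 1, D.embedK a.1 a.2⟩

/-- The complex `K`, the direct limit of the supertiles `K_n`. -/
def limitK : PentComplex X where
  tile := Quot D.LimitRel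
  glue a i b j := ∃ (n : ℕ) (t u : (D.supertileK n).tile),
    a = Quot.mk _ ⟨n, t⟩ ∧ b = Quot.mk _ ⟨n, u⟩ ∧ (D.supertileK n).glue t i u j
  deco := Quot.lift (fun a => (D.supertileK a.1).deco a.2) (by
    rintro ⟨n, t⟩ _ rfl
    exact (D.deco_embed _ _ (D.centre_seedAt n) n t).symm)

/-! ### The continuous hull -/

/-- `L` is a combinatorial tiling locally isomorphic to `K`. -/
structure InHull (L : PentComplex X) : Prop where
  tiling : L.IsTiling
  locallyIso : L.LocallyIsoTo D.limitK

/-- A combinatorial tiling locally isomorphic to `K`, with a point of it. -/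
structure PointedTiling where
  /-- the tiling -/
  L : PentComplex X
  inHull : D.InHull L
  /-- the point -/
  x : L.Point

/-- The isomorphism of pointed tilings. -/
instance isoSetoid : Setoid D.PointedTiling where
  r a b := ∃ φ : a.L.Point ≃ b.L.Point, a.L.IsIso b.L φ ∧ φ a.x = b.x
  iseqv := {
    refl := fun a => ⟨Equiv.refl _, PentComplex.IsIso.refl _, rfl⟩
    symm := by
      rintro a b ⟨φ, h, hx⟩
      exact ⟨φ.symm, h.symm, by rw [← hx, Equiv.symm_apply_apply]⟩
    trans := by
      rintro a b c ⟨φ, h, hx⟩ ⟨ψ, h', hx'⟩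
      exact ⟨φ.trans ψ, h.trans h', by rw [Equiv.trans_apply, hx, hx']⟩ }

/-- The continuous hull `Ω`. -/
def Hull : Type 1 := Quotient D.isoSetoid

/-- The element `[L, x]` of the continuous hull. -/
def toHull (L : PentComplex X) (hL : D.InHull L) (x : L.Point) : D.Hull :=
  Quotient.mk D.isoSetoid ⟨L, hL, x⟩

/-- There is a map from the ball of radius `1 / ε` about the point of `a` to the tiling of `b` that
is an isometry, preserves cells, decorations and degrees, and moves the point of `a` to within `ε`
of the point of `b`. -/
def Near (a b : D.PointedTiling) (ε : ℝ) : Prop :=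
  ∃ φ : a.L.Point → b.L.Point,
    a.L.IsPatchIsometry b.L φ (a.L.ball a.x (1 / ε)) ∧ b.L.pathDist (φ a.x) b.x ≤ ε

/-- The metric of the continuous hull: the minimum of `1 / √2` and of the infimum of all `ε > 0`
such that `a` and `b` have representatives that are near to each other, both ways, up to `ε`.
(The number `1 / √2` is inserted into the set, so the infimum is never one of the empty set.) -/
def hullDist (a b : D.Hull) : ℝ :=
  sInf (insert (1 / √2) {ε : ℝ | 0 < ε ∧ ∃ u v : D.PointedTiling,
    Quotient.mk D.isoSetoid u = a ∧ Quotient.mk D.isoSetoid v = b ∧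
      D.Near u v ε ∧ D.Near v u ε})

/-- The topology of the metric: a set is open if it contains a ball about each of its points. -/
instance : TopologicalSpace D.Hull where
  IsOpen U := ∀ a ∈ U, ∃ ε > 0, ∀ b, D.hullDist a b < ε → b ∈ U
  isOpen_univ := fun _ _ => ⟨1, one_pos, fun _ _ => trivial⟩
  isOpen_inter := by
    rintro U V hU hV a ⟨haU, haV⟩
    obtain ⟨ε, hε, h⟩ := hU a haU
    obtain ⟨δ, hδ, h'⟩ := hV a haV
    exact ⟨min ε δ, lt_min hε hδ, fun b hb =>
      ⟨h b (lt_of_lt_of_le hb (min_le_left _ _)), h' b (lt_of_lt_of_le hb (min_le_right _ _))⟩⟩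
  isOpen_sUnion := by
    rintro S hS a ⟨U, hU, haU⟩
    obtain ⟨ε, hε, h⟩ := hS U hU a haU
    exact ⟨ε, hε, fun b hb => ⟨U, hU, h b hb⟩⟩

end Decoration

end PentHull

end

open scoped ComplexConjugate

noncomputable section

namespace PentHull

/-! ### Coordinates adapted to the pentagon -/

/-! Geometrically, substitution loses nothing. On one tile the relation `Cell` is a piecewise affine
bijection from each of the six cells onto a new tile. Cells that meet agree on their common edge,
neighbouring tiles agree on halves of their common edge, and everything commutes with the symmetries
of the pentagon. So every complex L has a bijection `mapEquiv` onto ω(L), which is a homeomorphism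
(`mapHomeo`) and is bi-Lipschitz for the path metrics with one constant `lipConst` for all L
(`pathDist_map_le`, `pathDist_le_map`). Conjugation with it turns a tile-preserving map L → L' into
one ω(L) → ω(L') (`PatchMap.push`).

The converse is recognition. All corners of a central tile have degree three, while an outer tile
has a corner at the midpoint of an old edge, where four tiles meet. Hence a tile-preserving map
between subdivisions carries whole subdivided tiles to whole subdivided tiles
(`IndexMap.recognition`) and descends to L → L' (`PatchMap.pull`). The same local criterion finds
the central tiles in an abstract tiling M that is locally isomorphic to K. Patches of M embed into
ω(K), the type of each edge is determined by a finite patch (`exists_isTyping_univ`), and the pieces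
compose to a tiling L with ω(L) ≅ M (`exists_desubstitution`). That ω(K) and K are locally
isomorphic, both ways, follows from K_(n+1) ≅ ω(K_n) and the fact that finite patches of K lie in
some K_n.

The remaining difficulty is decorations: the rule on them need not be injective, so ω(L) need not
determine those of L. All notions therefore carry a level n, meaning that decorations need only
agree after n substitutions (`Eqv`). Pushing a map lowers the level by one and pulling it back
raises it by one. Since X is finite, some N satisfies: agreement at level N + 1 implies agreement at
level N (`exists_eqv_stable`). Every tiling of the hull is ω^N(A) for some A. If ω^(N+1)(A) ≅
ω^(N+1)(A'), then A and A' are isomorphic at level N + 1, hence at level N, and pushing N times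
gives ω^N(A) ≅ ω^N(A'). This is injectivity. For surjectivity, desubstitute N + 1 times to a tiling
that is locally isomorphic to K at level N + 1, hence at level N, and substitute N times to return
to the hull.

For continuity in both directions, isomorphisms are replaced by maps of the patch of tiles within
distance R of the point that move the point by at most r (`PatchNear`). Push and pull change R and r
only by the factor `lipConst` and a tile diameter, and `PatchNear` is equivalent to the nearness in
the metric up to such changes (`Near.patchNear`, `PatchNear.near`). The route through ω^N(A) then
gives continuity of the inverse. -/

/-- Twice the cosine of `2 * π / 5`, the inverse of the golden ratio. -/
def tau : ℝ := (√5 - 1) / 2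

theorem tau_sq : tau ^ 2 = 1 - tau := by
  have h : √5 ^ 2 = (5 : ℝ) := Real.sq_sqrt (by norm_num)
  unfold tau; nlinarith

theorem tau_bounds : 0.618 < tau ∧ tau < 0.619 := by
  have h : √5 ^ 2 = (5 : ℝ) := Real.sq_sqrt (by norm_num)
  have h0 := Real.sqrt_nonneg (5 : ℝ)
  unfold tau; constructor <;> nlinarith

theorem tau_pos : 0 < tau := by linarith [tau_bounds.1]

theorem innerRatio_bounds : 0.4 < innerRatio ∧ innerRatio < 0.5 := by
  have h : √5 ^ 2 = (5 : ℝ) := Real.sq_sqrt (by norm_num)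
  have h0 := Real.sqrt_nonneg (5 : ℝ)
  have h1 : √5 < 2.2361 := by nlinarith
  have h2 : 2.236 < √5 := by nlinarith
  have h' : √(4 - √5) ^ 2 = 4 - √5 := Real.sq_sqrt (by linarith)
  have h0' := Real.sqrt_nonneg (4 - √5)
  have h3 : √(4 - √5) < 1.33 := by nlinarith
  have h4 : 1.32 < √(4 - √5) := by nlinarith
  unfold innerRatio; constructor <;> linarith

theorem innerRatio_pos : 0 < innerRatio := by linarith [innerRatio_bounds.1]

theorem unitRoot_zero : unitRoot 0 = 1 := by simp [unitRoot]

theorem unitRoot_one : unitRoot 1 = Complex.exp ((2 * Real.pi / 5 : ℝ) * Complex.I) := by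
  have h := ZMod.stdAddChar_coe (N := 5) 1
  unfold unitRoot
  rw [Int.cast_one] at h
  rw [h]
  congr 1
  push_cast
  ring

theorem unitRoot_one_im_pos : 0 < (unitRoot 1).im := by
  rw [unitRoot_one, Complex.exp_ofReal_mul_I_im]
  apply Real.sin_pos_of_pos_of_lt_pi <;> linarith [Real.pi_pos]

theorem unitRoot_rel (k : ZMod 5) : unitRoot (k + 1) + unitRoot (k - 1) = tau * unitRoot k := by
  have h5 : √5 ^ 2 = (5 : ℝ) := Real.sq_sqrt (by norm_num)
  have h2 : 2 * (unitRoot 1).re = tau := by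
    rw [unitRoot_one, Complex.exp_ofReal_mul_I_re,
      show 2 * Real.pi / 5 = 2 * (Real.pi / 5) by ring, Real.cos_two_mul, Real.cos_pi_div_five]
    unfold tau; nlinarith
  have h1 : unitRoot 1 + unitRoot (-1) = tau := by
    rw [← conj_unitRoot, Complex.add_conj, h2]
  rw [sub_eq_add_neg, unitRoot_add, unitRoot_add, ← h1]
  ring

theorem circumradius_pos : 0 < circumradius := by
  have : 0 < Real.sin (Real.pi / 5) := by
    apply Real.sin_pos_of_pos_of_lt_pi <;> linarith [Real.pi_pos]
  unfold circumradius; positivity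

theorem vert_rel (k : ZMod 5) : vert (k + 1) + vert (k - 1) = tau * vert k := by
  have := unitRoot_rel k
  unfold vert
  linear_combination (circumradius : ℂ) * this

/-- The direction from the centre of the pentagon to the midpoint of edge `k`. -/
def wv (k : ZMod 5) : ℂ := -vert (k + 3)

theorem tau_sq' : (tau : ℂ) ^ 2 = 1 - tau := by exact_mod_cast tau_sq

theorem vert_add_two (k : ZMod 5) : vert (k + 2) = -wv (k - 1) := by
  unfold wv; rw [neg_neg]; congr 1; ring

theorem vert_add_three (k : ZMod 5) : vert (k + 3) = -wv k := by
  unfold wv; rw [neg_neg]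

theorem zmod5_eqs : (4 : ZMod 5) = -1 ∧ (3 : ZMod 5) = -2 ∧ (5 : ZMod 5) = 0 := by decide

theorem vert_add_one (k : ZMod 5) : vert (k + 1) = -tau * wv (k - 1) + wv k := by
  have h := vert_rel (k + 2)
  rw [vert_add_two, show k + 2 + 1 = k + 3 by ring, vert_add_three,
    show k + 2 - 1 = k + 1 by ring] at h
  linear_combination h

theorem vert_add_four (k : ZMod 5) : vert (k + 4) = wv (k - 1) - tau * wv k := by
  have h := vert_rel (k + 3)
  rw [vert_add_three, show k + 3 - 1 = k + 2 by ring, vert_add_two,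
    show k + 3 + 1 = k + 4 by ring] at h
  linear_combination h

theorem vert_self (k : ZMod 5) : vert k = tau * wv (k - 1) + tau * wv k := by
  have h := vert_rel (k + 1)
  rw [show k + 1 + 1 = k + 2 by ring, vert_add_two, vert_add_one, add_sub_cancel_right] at h
  linear_combination h - wv (k - 1) * tau_sq'

theorem wv_rel (k : ZMod 5) : wv (k + 1) = tau * wv k - wv (k - 1) := by
  have h := vert_rel (k + 3)
  unfold wv
  rw [show k + 1 + 3 = k + 3 + 1 by ring, show k - 1 + 3 = k + 3 - 1 by ring]
  linear_combination -h

theorem mid_eq (k : ZMod 5) : mid k = ((1 + tau) / 2 : ℝ) * wv k := by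
  unfold mid
  rw [midpoint_eq_smul_add, Complex.real_smul, vert_add_one, vert_self]
  push_cast
  rw [invOf_eq_inv]
  push_cast
  ring

theorem inner_eq (k : ZMod 5) : inner k = innerRatio * wv k := by
  unfold inner wv; ring

/-! ### The area form and coordinates in the five sectors -/

/-- The area form of the plane. -/
def crs (z w : ℂ) : ℝ := z.re * w.im - z.im * w.re

theorem crs_vert (j k : ZMod 5) :
    crs (vert j) (vert k) = circumradius ^ 2 * (unitRoot (k - j)).im := by
  rw [sub_eq_add_neg, unitRoot_add, ← conj_unitRoot]
  simp only [crs, vert, Complex.mul_re, Complex.mul_im, Complex.conj_re, Complex.conj_im,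
    Complex.ofReal_re, Complex.ofReal_im]
  ring

/-- The coordinate functional that vanishes on `wv k`, normalized. -/
def co (k : ZMod 5) : ℂ →ₗ[ℝ] ℝ where
  toFun p := crs (wv k) p / (circumradius ^ 2 * (unitRoot 1).im)
  map_add' x y := by simp only [crs, Complex.add_re, Complex.add_im]; ring
  map_smul' r x := by
    simp only [crs, Complex.real_smul, Complex.mul_re, Complex.mul_im, Complex.ofReal_re,
      Complex.ofReal_im, RingHom.id_apply, smul_eq_mul]; ring

theorem co_wv (j k : ZMod 5) : co k (wv j) = (unitRoot (j - k)).im / (unitRoot 1).im := by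
  have h : crs (wv k) (wv j) = crs (vert (k + 3)) (vert (j + 3)) := by
    simp only [crs, wv, Complex.neg_re, Complex.neg_im]; ring
  have h1 := circumradius_pos.ne'
  have h2 := unitRoot_one_im_pos.ne'
  change crs (wv k) (wv j) / _ = _
  rw [h, crs_vert, add_sub_add_right_eq_sub]
  field_simp

theorem co_wv_self (k : ZMod 5) : co k (wv k) = 0 := by
  rw [co_wv, sub_self, unitRoot_zero]; simp

theorem co_wv_next (k : ZMod 5) : co (k - 1) (wv k) = 1 := by
  rw [co_wv, sub_sub_cancel]; exact div_self unitRoot_one_im_pos.ne'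

theorem co_wv_prev (k : ZMod 5) : co k (wv (k - 1)) = -1 := by
  rw [co_wv, show k - 1 - k = -1 by ring, ← conj_unitRoot, Complex.conj_im, neg_div,
    div_self unitRoot_one_im_pos.ne']

theorem co_real_mul (k : ZMod 5) (r : ℝ) (p : ℂ) : co k (r * p) = r * co k p := by
  rw [← Complex.real_smul, map_smul, smul_eq_mul]

theorem co_comb (k : ZMod 5) (A B : ℝ) :
    co k (A * wv (k - 1) + B * wv k) = -A ∧ co (k - 1) (A * wv (k - 1) + B * wv k) = B := by
  simp only [map_add, co_real_mul, co_wv_self, co_wv_next, co_wv_prev]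
  constructor <;> ring

theorem crs_eq_zero {u w z : ℂ} (h : crs u w ≠ 0) (h1 : crs u z = 0) (h2 : crs w z = 0) :
    z = 0 := by
  unfold crs at *
  have e1 : z.re * (u.re * w.im - u.im * w.re) = 0 := by linear_combination w.re * h1 - u.re * h2
  have e2 : z.im * (u.re * w.im - u.im * w.re) = 0 := by linear_combination w.im * h1 - u.im * h2
  apply Complex.ext
  · simpa [h] using e1
  · simpa [h] using e2

/-- Both sides have the same area with each of two independent vectors, so they agree. Points of a
sector are read in this basis, formed by the two midpoint directions that bound it. -/
theorem co_expand (k : ZMod 5) (p : ℂ) :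
    p = ((-co k p : ℝ) : ℂ) * wv (k - 1) + (co (k - 1) p : ℝ) * wv k := by
  have hpos : circumradius ^ 2 * (unitRoot 1).im ≠ 0 :=
    mul_ne_zero (pow_ne_zero _ circumradius_pos.ne') unitRoot_one_im_pos.ne'
  obtain ⟨h1, h2⟩ := co_comb k (-co k p) (co (k - 1) p)
  set q : ℂ := ((-co k p : ℝ) : ℂ) * wv (k - 1) + (co (k - 1) p : ℝ) * wv k
  have key : ∀ j, co j p = co j q → crs (wv j) (p - q) = 0 := by
    intro j hj
    have : co j (p - q) = 0 := by rw [map_sub, hj, sub_self]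
    exact (div_eq_zero_iff.mp this).resolve_right hpos
  refine sub_eq_zero.mp (crs_eq_zero (u := wv (k - 1)) (w := wv k) ?_ (key _ h2.symm)
    (key _ (by rw [h1, neg_neg])))
  intro h
  have : co (k - 1) (wv k) = 0 := by
    change crs _ _ / _ = 0
    rw [h, zero_div]
  rw [co_wv_next] at this
  exact one_ne_zero this

theorem co_rel (k : ZMod 5) (p : ℂ) : co (k + 1) p = tau * co k p - co (k - 1) p := by
  change crs _ _ / _ = tau * (crs _ _ / _) - crs _ _ / _
  rw [wv_rel]
  simp only [crs, Complex.sub_re, Complex.sub_im, Complex.mul_re, Complex.mul_im,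
    Complex.ofReal_re, Complex.ofReal_im]
  ring

/-- All values of the functionals in terms of two of them. -/
theorem co_values (k : ZMod 5) (p : ℂ) :
    co (k + 1) p = tau * co k p - co (k - 1) p ∧
    co (k + 2) p = -tau * co k p - tau * co (k - 1) p ∧
    co (k + 3) p = - co k p + tau * co (k - 1) p ∧ co (k + 4) p = co (k - 1) p := by
  have h1 := co_rel k p
  have h2 := co_rel (k + 1) p
  have h3 := co_rel (k + 2) p
  rw [show k + 1 + 1 = k + 2 by ring, add_sub_cancel_right] at h2
  rw [show k + 2 + 1 = k + 3 by ring, show k + 2 - 1 = k + 1 by ring] at h3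
  have h4 : k + 4 = k - 1 := by rw [zmod5_eqs.1]; ring
  have ht := tau_sq
  refine ⟨h1, ?_, ?_, by rw [h4]⟩
  · rw [h2, h1]; linear_combination co k p * ht
  · rw [h3, h2, h1]; linear_combination ht * (tau * co k p - co (k - 1) p)- co k p * ht

/-- The sector `k` of the plane, bounded by the directions of the midpoints of the edges
`k - 1` and `k`. -/
def Sector (k : ZMod 5) (p : ℂ) : Prop := co k p ≤ 0 ∧ 0 ≤ co (k - 1) p

/-- The five values `co k p` sum to zero. If p were in no sector, a nonnegative value would force
the next one to be positive; going round, either all are positive or all are negative, and both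
contradict the sum. -/
theorem exists_sector (p : ℂ) : ∃ k, Sector k p := by
  by_contra! h
  have hk : ∀ k, 0 ≤ co k p → 0 < co (k + 1) p := by
    intro k hk
    by_contra! hc
    exact h (k + 1) ⟨hc, by rwa [add_sub_cancel_right]⟩
  obtain ⟨h1, h2, h3, h4⟩ := co_values 0 p
  have e0 := hk 0
  have e1 := hk 1
  have e2 := hk 2
  have e3 := hk 3
  have e4 := hk 4
  rw [show (4 + 1 : ZMod 5) = 0 by decide] at e4
  rw [show (3 + 1 : ZMod 5) = 4 by decide] at e3
  rw [show (2 + 1 : ZMod 5) = 3 by decide] at e2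
  rw [show (1 + 1 : ZMod 5) = 2 by decide] at e1
  simp only [zero_add, zero_sub] at h1 h2 h3 h4 e0
  have hsum : co 0 p + co 1 p + co 2 p + co 3 p + co 4 p = 0 := by linear_combination h1 + h2 + h3 + h4
  rcases lt_or_ge (co 0 p) 0 with c0 | c0 <;> rcases lt_or_ge (co 1 p) 0 with c1 | c1 <;>
  rcases lt_or_ge (co 2 p) 0 with c2 | c2 <;> rcases lt_or_ge (co 3 p) 0 with c3 | c3 <;>
  rcases lt_or_ge (co 4 p) 0 with c4 | c4 <;> grind

/-- Adjacent sectors share a ray and others only the origin: for a nonadjacent offset `co_values`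
turns the four sign conditions into the vanishing of both coordinates. -/
theorem sector_unique {k l : ZMod 5} {p : ℂ} (hk : Sector k p) (hl : Sector l p) :
    l = k ∨ (l = k + 1 ∧ co k p = 0) ∨ (k = l + 1 ∧ co l p = 0) ∨ p = 0 := by
  obtain ⟨d, rfl⟩ : ∃ d, l = k + d := ⟨l - k, by ring⟩
  obtain ⟨h1, h2, h3, h4⟩ := co_values k p
  obtain ⟨k1, k2⟩ := hk
  obtain ⟨l1, l2⟩ := hl
  have ht := tau_pos
  have hz : co k p = 0 → co (k - 1) p = 0 → p = 0 := by
    intro a b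
    rw [co_expand k p, a, b]; simp
  fin_cases d
  · left; exact add_zero k
  · right; left
    change 0 ≤ co (k + 1 - 1) p at l2
    rw [add_sub_cancel_right] at l2
    exact ⟨rfl, le_antisymm k1 l2⟩
  · right; right; right
    change 0 ≤ co (k + 2 - 1) p at l2
    rw [show k + 2 - 1 = k + 1 by ring] at l2
    apply hz <;> nlinarith
  · right; right; right
    change co (k + 3) p ≤ 0 at l1
    apply hz <;> nlinarith
  · right; right; left
    change co (k + 4) p ≤ 0 at l1
    refine ⟨?_, ?_⟩
    · change k = k + 4 + 1
      rw [zmod5_eqs.1]; ring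
    · change co (k + 4) p = 0
      exact le_antisymm l1 (by linarith)

theorem abs_co_le (k : ZMod 5) : ∃ C, 0 < C ∧ ∀ p, |co k p| ≤ C * ‖p‖ := by
  refine ⟨‖(co k).toContinuousLinearMap‖ + 1, by positivity, fun p => ?_⟩
  have h := (co k).toContinuousLinearMap.le_opNorm p
  have h2 := norm_nonneg p
  change |co k p| ≤ _ at h
  linarith

theorem exists_co_bound : ∃ C, 0 < C ∧ ∀ k p, |co k p| ≤ C * ‖p‖ := by
  choose C hC using abs_co_le
  refine ⟨∑ k, C k, Finset.sum_pos (fun k _ => (hC k).1) ⟨0, Finset.mem_univ _⟩, fun k p => ?_⟩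
  refine ((hC k).2 p).trans ?_
  gcongr
  exact Finset.single_le_sum (f := C) (fun k _ => (hC k).1.le) (Finset.mem_univ k)

theorem norm_wv (k : ZMod 5) : ‖wv k‖ = circumradius := by
  unfold wv vert unitRoot
  rw [norm_neg, norm_mul, ZMod.stdAddChar_apply, Circle.norm_coe]
  simp [abs_of_pos circumradius_pos]

theorem norm_vert (k : ZMod 5) : ‖vert k‖ = circumradius := by
  have := norm_wv (k - 3)
  rwa [wv, norm_neg, sub_add_cancel] at this

/-! ### Points of the pentagon -/

theorem zmod5_cases (k l : ZMod 5) :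
    l = k ∨ l = k + 1 ∨ l = k + 2 ∨ l = k + 3 ∨ l = k + 4 := by
  obtain ⟨d, rfl⟩ : ∃ d, l = k + d := ⟨l - k, by ring⟩
  fin_cases d
  · exact Or.inl (add_zero k)
  all_goals first
    | exact Or.inr (Or.inl rfl) | exact Or.inr (Or.inr (Or.inl rfl))
    | exact Or.inr (Or.inr (Or.inr (Or.inl rfl))) | exact Or.inr (Or.inr (Or.inr (Or.inr rfl)))

theorem le_of_mem_pentagon (f : ℂ →ₗ[ℝ] ℝ) (c : ℝ) (k : ZMod 5) (h0 : f (vert k) ≤ c)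
    (h1 : f (vert (k + 1)) ≤ c) (h2 : f (vert (k + 2)) ≤ c) (h3 : f (vert (k + 3)) ≤ c)
    (h4 : f (vert (k + 4)) ≤ c) {p : ℂ} (hp : p ∈ pentagon) : f p ≤ c := by
  have hs : Convex ℝ {z | f z ≤ c} := convex_halfSpace_le f.isLinear c
  refine convexHull_min ?_ hs hp
  rintro _ ⟨l, rfl⟩
  rcases zmod5_cases k l with rfl | rfl | rfl | rfl | rfl <;> assumption

theorem vert_mem (k : ZMod 5) : vert k ∈ pentagon := (vertP k).2

theorem convex_pentagon : Convex ℝ pentagon := convex_convexHull _ _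

theorem comb_mem {u v w : ℂ} (hu : u ∈ pentagon) (hv : v ∈ pentagon) (hw : w ∈ pentagon)
    {a b c : ℝ} (ha : 0 ≤ a) (hb : 0 ≤ b) (hc : 0 ≤ c) (h : a + b + c = 1) :
    a * u + b * v + c * w ∈ pentagon := by
  have := convex_pentagon.sum_mem (t := Finset.univ) (w := ![a, b, c]) (z := ![u, v, w])
    (by intro i _; fin_cases i <;> simpa)
    (by simp [Fin.sum_univ_three, h]) (by intro i _; fin_cases i <;> simpa)
  simpa [Fin.sum_univ_three] using this

theorem comb_two_mem {u v : ℂ} (hu : u ∈ pentagon) (hv : v ∈ pentagon)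
    {a b : ℝ} (ha : 0 ≤ a) (hb : 0 ≤ b) (h : a + b = 1) : a * u + b * v ∈ pentagon := by
  simpa using comb_mem hu hv hv ha hb le_rfl (by simpa using h)

theorem isCompact_pentagon : IsCompact pentagon :=
  (Set.finite_range vert).isCompact_convexHull ℝ

instance : CompactSpace Pent := isCompact_iff_compactSpace.mp isCompact_pentagon

theorem norm_le_of_mem_pentagon {p : ℂ} (hp : p ∈ pentagon) : ‖p‖ ≤ circumradius := by
  have : pentagon ⊆ Metric.closedBall 0 circumradius := by
    refine convexHull_min ?_ (convex_closedBall _ _)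
    rintro _ ⟨k, rfl⟩
    simp [norm_vert]
  simpa using this hp

theorem dist_pent_le (p q : Pent) : dist p q ≤ 2 * circumradius := by
  rw [Subtype.dist_eq]
  have h1 := norm_le_of_mem_pentagon p.2
  have h2 := norm_le_of_mem_pentagon q.2
  rw [dist_eq_norm]
  linarith [norm_sub_le (p : ℂ) q]

/-! ### Edges of the pentagon -/

/-- The functional that is maximal on edge `k` of the pentagon. -/
def edgeFun (k : ZMod 5) : ℂ →ₗ[ℝ] ℝ := co (k - 1) - (tau / 2) • co k

theorem edgeFun_comb (k : ZMod 5) (A B : ℝ) :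
    edgeFun k (A * wv (k - 1) + B * wv k) = B + tau / 2 * A := by
  obtain ⟨h1, h2⟩ := co_comb k A B
  simp only [edgeFun, LinearMap.sub_apply, LinearMap.smul_apply, h1, h2, smul_eq_mul]
  ring

theorem edgeFun_vert (k : ZMod 5) : edgeFun k (vert k) = (1 + tau) / 2 ∧
    edgeFun k (vert (k + 1)) = (1 + tau) / 2 ∧ edgeFun k (vert (k + 2)) = -(tau / 2) ∧
    edgeFun k (vert (k + 3)) = -1 ∧ edgeFun k (vert (k + 4)) = -(tau / 2) := by
  have ht := tau_sq
  refine ⟨?_, ?_, ?_, ?_, ?_⟩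
  · rw [vert_self, edgeFun_comb]; linear_combination ht / 2
  · have := edgeFun_comb k (-tau) 1
    push_cast at this
    rw [one_mul] at this
    rw [vert_add_one, this]; linear_combination -ht / 2
  · have := edgeFun_comb k (-1) 0
    push_cast at this
    rw [zero_mul, add_zero, neg_one_mul] at this
    rw [vert_add_two, this]; ring
  · have := edgeFun_comb k 0 (-1)
    push_cast at this
    rw [zero_mul, zero_add, neg_one_mul] at this
    rw [vert_add_three, this]; ring
  · have := edgeFun_comb k 1 (-tau)
    push_cast at this
    rw [one_mul, neg_mul, ← sub_eq_add_neg] at this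
    rw [vert_add_four, this]; ring

theorem edgeFun_le {p : ℂ} (hp : p ∈ pentagon) (k : ZMod 5) : edgeFun k p ≤ (1 + tau) / 2 := by
  obtain ⟨h0, h1, h2, h3, h4⟩ := edgeFun_vert k
  have := tau_pos
  apply le_of_mem_pentagon (edgeFun k) _ k _ _ _ _ _ hp <;> linarith

theorem edgeFun_vert_eq {k l : ZMod 5} (h : (1 + tau) / 2 ≤ edgeFun k (vert l)) :
    l = k ∨ l = k + 1 := by
  obtain ⟨h0, h1, h2, h3, h4⟩ := edgeFun_vert k
  have := tau_pos
  rcases zmod5_cases k l with rfl | rfl | rfl | rfl | rfl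
  · exact Or.inl rfl
  · exact Or.inr rfl
  all_goals exfalso; linarith

/-- The point of edge `k` with parameter `s`. -/
def edgePt (k : ZMod 5) (s : ℝ) : ℂ := (1 - s : ℝ) * vert k + s * vert (k + 1)

theorem edgePt_eq_lineMap (k : ZMod 5) (s : ℝ) :
    edgePt k s = AffineMap.lineMap (vert k) (vert (k + 1)) s := by
  rw [AffineMap.lineMap_apply_module', Complex.real_smul, edgePt]
  push_cast; ring

theorem edgePt_mem (k : ZMod 5) {s : ℝ} (h0 : 0 ≤ s) (h1 : s ≤ 1) : edgePt k s ∈ pentagon :=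
  comb_two_mem (vert_mem _) (vert_mem _) (by linarith) h0 (by ring)

theorem edgeFun_edgePt (k l : ZMod 5) (s : ℝ) :
    edgeFun k (edgePt l s) = (1 - s) * edgeFun k (vert l) + s * edgeFun k (vert (l + 1)) := by
  simp only [edgePt, map_add, ← Complex.real_smul, map_smul, smul_eq_mul]

theorem edgeFun_edgePt_self (k : ZMod 5) (s : ℝ) : edgeFun k (edgePt k s) = (1 + tau) / 2 := by
  obtain ⟨h0, h1, -⟩ := edgeFun_vert k
  rw [edgeFun_edgePt, h0, h1]; ring

/-- Along edge k the functional `edgeFun (k + 1)` increases strictly from −τ/2 to (1 + τ)/2. -/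
theorem edgePt_inj_param {k : ZMod 5} {s s' : ℝ} (h : edgePt k s = edgePt k s') : s = s' := by
  obtain ⟨-, -, -, -, h4⟩ := edgeFun_vert (k + 1)
  obtain ⟨h0, -⟩ := edgeFun_vert (k + 1)
  rw [show k + 1 + 4 = k by rw [zmod5_eqs.1]; ring] at h4
  have := congrArg (edgeFun (k + 1)) h
  rw [edgeFun_edgePt, edgeFun_edgePt, h4, h0] at this
  have ht := tau_pos
  have : (s - s') * (1 / 2 + tau) = 0 := by linear_combination this
  rcases mul_eq_zero.mp this with h | h
  · linarith
  · linarith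

/-- An inner point of an edge lies on no other edge. -/
theorem edgePt_inj {k l : ZMod 5} {s s' : ℝ} (h0 : 0 < s) (h1 : s < 1)
    (h : edgePt k s = edgePt l s') : k = l ∧ s = s' := by
  have hkl : k = l := by
    have e := congrArg (edgeFun l) h
    rw [edgeFun_edgePt_self, edgeFun_edgePt] at e
    have a := edgeFun_le (vert_mem k) l
    have b := edgeFun_le (vert_mem (k + 1)) l
    -- A combination with positive weights attains the maximum only if both end points do.
    have a' : (1 + tau) / 2 ≤ edgeFun l (vert k) := by nlinarith
    have b' : (1 + tau) / 2 ≤ edgeFun l (vert (k + 1)) := by nlinarith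
    rcases edgeFun_vert_eq a' with r | r
    · exact r
    · rcases edgeFun_vert_eq b' with r' | r'
      · rw [r, add_assoc, add_eq_left] at r'
        exact absurd r' (by decide)
      · exact add_right_cancel r'
  subst hkl
  exact ⟨rfl, edgePt_inj_param h⟩

/-- The edges keep away from the centre. -/
theorem exists_norm_edgePt : ∃ r, 0 < r ∧ ∀ k s, r ≤ ‖edgePt k s‖ := by
  obtain ⟨C, hC, h⟩ := exists_co_bound
  have ht := tau_pos
  refine ⟨(1 + tau) / 2 / (C * (1 + tau)), by positivity, fun k s => ?_⟩
  rw [div_le_iff₀ (by positivity)]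
  have e := edgeFun_edgePt_self k s
  have a := abs_le.mp (h (k - 1) (edgePt k s))
  have b := abs_le.mp (h k (edgePt k s))
  simp only [edgeFun, LinearMap.sub_apply, LinearMap.smul_apply, smul_eq_mul] at e
  have hn := norm_nonneg (edgePt k s)
  have : 0 ≤ C * ‖edgePt k s‖ := by positivity
  nlinarith

/-- A radius about the centre such that the disc does not meet the edges. -/
def coreRadius : ℝ := exists_norm_edgePt.choose

theorem coreRadius_pos : 0 < coreRadius := exists_norm_edgePt.choose_spec.1

theorem coreRadius_le (k : ZMod 5) (s : ℝ) : coreRadius ≤ ‖edgePt k s‖ :=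
  exists_norm_edgePt.choose_spec.2 k s

/-! ### The action of the symmetries -/

/-- The action of the symmetries on the numbers of the edges. -/
def edgeIdx : DihedralGroup 5 → ZMod 5 → ZMod 5
  | .r i, k => i + k
  | .sr i, k => -i - k - 1

/-- The action of the symmetries on the parameter along an edge. -/
def edgePar : DihedralGroup 5 → ℝ → ℝ
  | .r _, s => s
  | .sr _, s => 1 - s

/-- Whether a symmetry is a reflection. -/
def isRefl : DihedralGroup 5 → Prop
  | .r _ => False
  | .sr _ => True

theorem sym_real_comb (g : DihedralGroup 5) (a b : ℝ) (u v : ℂ) :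
    sym g (a * u + b * v) = a * sym g u + b * sym g v := by
  have h := sym_isLinear g
  rw [h.map_add, ← Complex.real_smul, ← Complex.real_smul, h.map_smul, h.map_smul,
    Complex.real_smul, Complex.real_smul]

theorem sym_edgePt (g : DihedralGroup 5) (k : ZMod 5) (s : ℝ) :
    sym g (edgePt k s) = edgePt (edgeIdx g k) (edgePar g s) := by
  rcases g with i | i
  · simp only [edgePt, sym_real_comb, sym_vert, symIdx, edgeIdx, edgePar]
    rw [add_assoc i k 1]
  · simp only [edgePt, sym_real_comb, sym_vert, symIdx, edgeIdx, edgePar]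
    rw [show -i - (k + 1) = -i - k - 1 by ring, show -i - k - 1 + 1 = -i - k by ring]
    push_cast; ring

theorem norm_sym (g : DihedralGroup 5) (z : ℂ) : ‖sym g z‖ = ‖z‖ := by
  have h : ∀ i, ‖unitRoot i‖ = 1 := fun i => by
    unfold unitRoot; rw [ZMod.stdAddChar_apply, Circle.norm_coe]
  rcases g with i | i <;> simp [sym, h]

theorem sym_sub (g : DihedralGroup 5) (z w : ℂ) : sym g (z - w) = sym g z - sym g w :=
  (sym_isLinear g).map_sub z w

theorem symP_mul (g h : DihedralGroup 5) (p : Pent) : symP (g * h) p = symP g (symP h p) :=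
  Subtype.ext (sym_mul g h p)

theorem symP_one (p : Pent) : symP 1 p = p := Subtype.ext (sym_one p)

theorem symP_inv_symP (g : DihedralGroup 5) (p : Pent) : symP g⁻¹ (symP g p) = p := by
  rw [← symP_mul, inv_mul_cancel, symP_one]

theorem symP_symP_inv (g : DihedralGroup 5) (p : Pent) : symP g (symP g⁻¹ p) = p := by
  rw [← symP_mul, mul_inv_cancel, symP_one]

theorem symP_injective (g : DihedralGroup 5) : Function.Injective (symP g) :=
  Function.LeftInverse.injective (symP_inv_symP g)

theorem dist_symP (g : DihedralGroup 5) (p q : Pent) : dist (symP g p) (symP g q) = dist p q := by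
  rw [Subtype.dist_eq, Subtype.dist_eq, dist_eq_norm, dist_eq_norm]
  change ‖sym g p - sym g q‖ = _
  rw [← sym_sub, norm_sym]

theorem continuous_symP (g : DihedralGroup 5) : Continuous (symP g) :=
  (Isometry.of_dist_eq (dist_symP g)).continuous

theorem symP_vertP (g : DihedralGroup 5) (k : ZMod 5) : symP g (vertP k) = vertP (symIdx g k) :=
  Subtype.ext (sym_vert g k)

/-- The centre of the pentagon. -/
def centreP : Pent := ⟨0, by
  -- The origin is the mean of the five vertices, grouped as 0, {1, 4}, {2, 3}.
  have h := comb_mem (vert_mem 0) (comb_two_mem (vert_mem 1) (vert_mem 4) (a := 1 / 2) (b := 1 / 2)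
    (by norm_num) (by norm_num) (by norm_num)) (comb_two_mem (vert_mem 2) (vert_mem 3) (a := 1 / 2)
    (b := 1 / 2) (by norm_num) (by norm_num) (by norm_num)) (a := 1 / 5) (b := 2 / 5) (c := 2 / 5)
    (by norm_num) (by norm_num) (by norm_num) (by norm_num)
  have h0 := vert_self 0
  have h1 := vert_add_one 0
  have h2 := vert_add_two 0
  have h3 := vert_add_three 0
  have h4 := vert_add_four 0
  simp only [zero_add] at h1 h2 h3 h4
  convert h using 1
  rw [h1, h2, h3, h4, h0]
  push_cast
  ring⟩

theorem symP_centreP (g : DihedralGroup 5) : symP g centreP = centreP :=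
  Subtype.ext ((sym_isLinear g).map_zero)

/-- The point of edge `k` with parameter `s`, as a point of the pentagon. -/
def edgeP (k : ZMod 5) (s : Set.Icc (0 : ℝ) 1) : Pent := ⟨edgePt k s, edgePt_mem k s.2.1 s.2.2⟩

/-- The reversed parameter. -/
def revPar (s : Set.Icc (0 : ℝ) 1) : Set.Icc (0 : ℝ) 1 :=
  ⟨1 - s, by linarith [s.2.2], by linarith [s.2.1]⟩

theorem revPar_revPar (s : Set.Icc (0 : ℝ) 1) : revPar (revPar s) = s :=
  Subtype.ext (sub_sub_cancel _ _)

namespace PentComplex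

variable {X : Type}

/-! ### The points of a complex -/

/-- The pasting of edges is symmetric, and every edge is pasted to at most one edge, which is
different from it. -/
structure IsPasting (L : PentComplex X) : Prop where
  symm : ∀ {t i u j}, L.glue t i u j → L.glue u j t i
  irrefl : ∀ t i, ¬ L.glue t i t i
  unique : ∀ {t i u j u' j'}, L.glue t i u j → L.glue t i u' j' → u = u' ∧ j = j'

theorem IsTiling.isPasting {L : PentComplex X} (h : L.IsTiling) : L.IsPasting where
  symm := h.symm _ _ _ _
  irrefl := h.irrefl
  unique {t i u j u' j'} h1 h2 := by
    have := (h.closed t i).unique (y₁ := (u, j)) (y₂ := (u', j')) h1 h2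
    exact ⟨congrArg Prod.fst this, congrArg Prod.snd this⟩

theorem exists_pt {L : PentComplex X} (x : L.Point) : ∃ t p, L.pt t p = x := by
  obtain ⟨⟨t, p⟩, rfl⟩ := Quot.exists_rep x
  exact ⟨t, p, rfl⟩

theorem pointGlue_iff {L : PentComplex X} {a b : Σ _ : L.tile, Pent} :
    L.PointGlue a b ↔ ∃ i j s, L.glue a.1 i b.1 j ∧ a.2 = edgeP i s ∧ b.2 = edgeP j (revPar s) := by
  constructor
  · rintro ⟨t, u, i, j, s, p, q, h, hs, hp, hq⟩
    refine ⟨i, j, ⟨s, hs⟩, h, Subtype.ext ?_, Subtype.ext ?_⟩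
    · rw [hp, ← edgePt_eq_lineMap]; rfl
    · rw [hq, ← edgePt_eq_lineMap]; rfl
  · obtain ⟨t, p⟩ := a
    obtain ⟨u, q⟩ := b
    rintro ⟨i, j, s, h, rfl, rfl⟩
    exact ⟨t, u, i, j, s, _, _, h, s.2, edgePt_eq_lineMap _ _, edgePt_eq_lineMap _ _⟩

theorem pt_edgeP {L : PentComplex X} {t u : L.tile} {i j : ZMod 5} (h : L.glue t i u j)
    (s : Set.Icc (0 : ℝ) 1) : L.pt t (edgeP i s) = L.pt u (edgeP j (revPar s)) :=
  Quot.sound (pointGlue_iff.mpr ⟨i, j, s, h, rfl, rfl⟩)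

theorem pt_eq_of_edge {L : PentComplex X} {t u : L.tile} {i j : ZMod 5} (h : L.glue t i u j)
    {s s' : ℝ} (h0 : 0 ≤ s) (h1 : s ≤ 1) (hs : s' = 1 - s) {p q : Pent}
    (hp : (p : ℂ) = edgePt i s) (hq : (q : ℂ) = edgePt j s') : L.pt t p = L.pt u q := by
  subst hs
  have := L.pt_edgeP h ⟨s, h0, h1⟩
  rwa [← show p = edgeP i ⟨s, h0, h1⟩ from Subtype.ext hp,
    ← show q = edgeP j (revPar ⟨s, h0, h1⟩) from Subtype.ext hq] at this

/-- A property of representatives that is compatible with the pasting is a property of points. -/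
theorem pt_transfer {L : PentComplex X} (P : L.tile → Pent → Prop)
    (h : ∀ t i u j s, L.glue t i u j → (P t (edgeP i s) ↔ P u (edgeP j (revPar s))))
    {t u : L.tile} {p q : Pent} (he : L.pt t p = L.pt u q) : P t p ↔ P u q := by
  let F : L.Point → Prop := Quot.lift (fun a => P a.1 a.2) (by
    rintro ⟨t, p⟩ ⟨u, q⟩ hab
    obtain ⟨i, j, s, hg, h1, h2⟩ := pointGlue_iff.mp hab
    dsimp only at hg h1 h2 ⊢
    rw [h1, h2]
    exact propext (h t i u j s hg))
  exact iff_of_eq (congrArg F he)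

/-- The point together with its partners across the edge is closed under pasting: an interior point
of an edge lies on no other edge, and by uniqueness the partner of the partner is the original. So
this is the whole class. At vertices, where longer cycles of tiles meet, no such description is
available. -/
theorem pt_eq_edge {L : PentComplex X} (hL : L.IsPasting) {t u : L.tile} {i : ZMod 5}
    {s : Set.Icc (0 : ℝ) 1} (h0 : 0 < (s : ℝ)) (h1 : (s : ℝ) < 1) {q : Pent}
    (h : L.pt t (edgeP i s) = L.pt u q) :
    (u = t ∧ q = edgeP i s) ∨ ∃ j, L.glue t i u j ∧ q = edgeP j (revPar s) := by
  have inj : ∀ {k l : ZMod 5} {r : Set.Icc (0 : ℝ) 1}, edgeP k r = edgeP i s → k = i ∧ r = s := by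
    intro k l r e
    obtain ⟨a, b⟩ := edgePt_inj h0 h1 (congrArg Subtype.val e).symm
    exact ⟨a.symm, Subtype.ext b.symm⟩
  have inj' : ∀ {k j : ZMod 5} {r : Set.Icc (0 : ℝ) 1}, edgeP k r = edgeP j (revPar s) →
      k = j ∧ r = revPar s := by
    intro k l r e
    obtain ⟨a, b⟩ := edgePt_inj (s := revPar s) (by change 0 < 1 - (s : ℝ); linarith)
      (by change 1 - (s : ℝ) < 1; linarith) (congrArg Subtype.val e).symm
    exact ⟨a.symm, Subtype.ext b.symm⟩
  refine (pt_transfer (fun u q => (u = t ∧ q = edgeP i s) ∨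
    ∃ j, L.glue t i u j ∧ q = edgeP j (revPar s)) ?_ h).mp (Or.inl ⟨rfl, rfl⟩)
  have key : ∀ (t' : L.tile) (i' : ZMod 5) (u' : L.tile) (j' : ZMod 5) (r : Set.Icc (0 : ℝ) 1),
      L.glue t' i' u' j' → ((t' = t ∧ edgeP i' r = edgeP i s) ∨
        ∃ j, L.glue t i t' j ∧ edgeP i' r = edgeP j (revPar s)) →
      ((u' = t ∧ edgeP j' (revPar r) = edgeP i s) ∨
        ∃ j, L.glue t i u' j ∧ edgeP j' (revPar r) = edgeP j (revPar s)) := by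
    rintro t' i' u' j' r hg (⟨rfl, e⟩ | ⟨j, hj, e⟩)
    · obtain ⟨rfl, rfl⟩ := inj (l := 0) e
      exact Or.inr ⟨j', hg, rfl⟩
    · obtain ⟨rfl, rfl⟩ := inj' e
      obtain ⟨rfl, rfl⟩ := hL.unique (hL.symm hj) hg
      exact Or.inl ⟨rfl, by rw [revPar_revPar]⟩
  intro t' i' u' j' r hg
  refine ⟨key _ _ _ _ _ hg, fun h => ?_⟩
  have := key u' j' t' i' (revPar r) (hL.symm hg) h
  rwa [revPar_revPar] at this

/-- Pasting identifies points of edges only, and these have norm at least `coreRadius`, so the class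
of p is a singleton. -/
theorem pt_eq_core {L : PentComplex X} {t u : L.tile} {p q : Pent} (hp : ‖(p : ℂ)‖ < coreRadius)
    (h : L.pt t p = L.pt u q) : u = t ∧ q = p := by
  refine (pt_transfer (fun u q => u = t ∧ q = p) ?_ h).mp ⟨rfl, rfl⟩
  intro t' i u' j s _
  constructor
  · rintro ⟨-, e⟩
    have := coreRadius_le i s
    rw [← e] at hp
    exact absurd hp (not_lt.mpr this)
  · rintro ⟨-, e⟩
    have := coreRadius_le j (revPar s)
    rw [← e] at hp
    exact absurd hp (not_lt.mpr this)

theorem pt_eq_centre {L : PentComplex X} {t u : L.tile} {q : Pent}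
    (h : L.pt t centreP = L.pt u q) : u = t ∧ q = centreP :=
  pt_eq_core (by simpa [centreP] using coreRadius_pos) h

theorem isClosed_iff {L : PentComplex X} {C : Set L.Point} :
    IsClosed C ↔ ∀ t, IsClosed {p | L.pt t p ∈ C} := by
  have h : IsClosed C ↔ IsClosed (Quot.mk L.PointGlue ⁻¹' C) :=
    isQuotientMap_quot_mk.isClosed_preimage.symm
  rw [h, isClosed_sigma_iff]
  rfl

/-! ### The path metric -/

theorem PathLength.nonneg {L : PentComplex X} {x y : L.Point} {l : ℝ} (h : L.PathLength x y l) :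
    0 ≤ l := by
  induction h with
  | nil => exact le_rfl
  | cons t p q y l _ ih => positivity

theorem PathLength.append {L : PentComplex X} {x y z : L.Point} {l m : ℝ}
    (h : L.PathLength x y l) (h' : L.PathLength y z m) : L.PathLength x z (l + m) := by
  induction h with
  | nil => rwa [zero_add]
  | cons t p q y l _ ih => rw [add_assoc]; exact .cons t p q z _ (ih h')

theorem PathLength.single (L : PentComplex X) (t : L.tile) (p q : Pent) :
    L.PathLength (L.pt t p) (L.pt t q) (dist p q) := by
  have := PathLength.cons t p q _ _ (PathLength.nil (L.pt t q))
  rwa [add_zero] at this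

theorem PathLength.reverse {L : PentComplex X} {x y : L.Point} {l : ℝ}
    (h : L.PathLength x y l) : L.PathLength y x l := by
  induction h with
  | nil => exact .nil _
  | cons t p q y l _ ih =>
    have := ih.append (.single L t q p)
    rwa [dist_comm, add_comm] at this

/-- Any two points are joined by a path. -/
def IsJoined (L : PentComplex X) : Prop := ∀ x y : L.Point, ∃ l, L.PathLength x y l

/-- The set of points reachable from x is a union of whole tiles, and so is its complement; both are
therefore closed in the quotient topology, and a space homeomorphic to the plane is connected. -/
theorem IsTiling.isJoined {L : PentComplex X} (hL : L.IsTiling) : L.IsJoined := by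
  obtain ⟨e⟩ := hL.plane
  have : PreconnectedSpace L.Point := by
    constructor
    have := (isPreconnected_univ (α := ℂ)).image e.symm e.symm.continuous.continuousOn
    rwa [Set.image_univ, e.symm.surjective.range_eq] at this
  intro x
  have slice : ∀ t p q, (∃ l, L.PathLength x (L.pt t p) l) → ∃ l, L.PathLength x (L.pt t q) l :=
    fun t p q ⟨l, hl⟩ => ⟨_, hl.append (.single L t p q)⟩
  have hclopen : IsClopen {y | ∃ l, L.PathLength x y l} := by
    constructor
    · refine isClosed_iff.mpr fun t => ?_
      by_cases h : ∃ p, ∃ l, L.PathLength x (L.pt t p) l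
      · obtain ⟨p, hp⟩ := h
        convert isClosed_univ using 1
        exact Set.eq_univ_of_forall fun q => slice t p q hp
      · convert isClosed_empty using 1
        exact Set.eq_empty_of_forall_notMem fun q hq => h ⟨q, hq⟩
    · rw [← isClosed_compl_iff]
      refine isClosed_iff.mpr fun t => ?_
      by_cases h : ∃ p, ∃ l, L.PathLength x (L.pt t p) l
      · obtain ⟨p, hp⟩ := h
        convert isClosed_empty using 1
        exact Set.eq_empty_of_forall_notMem fun q hq => hq (slice t p q hp)
      · convert isClosed_univ using 1
        exact Set.eq_univ_of_forall fun q hq => h ⟨q, hq⟩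
  rcases isClopen_iff.mp hclopen with h | h
  · exact absurd (show x ∈ {y | ∃ l, L.PathLength x y l} from ⟨0, .nil x⟩) (by simp [h])
  · exact fun y => show y ∈ {y | ∃ l, L.PathLength x y l} by rw [h]; trivial

theorem pathDist_le {L : PentComplex X} {x y : L.Point} {l : ℝ} (h : L.PathLength x y l) :
    L.pathDist x y ≤ l :=
  csInf_le ⟨0, fun _ h => PathLength.nonneg h⟩ h

theorem pathDist_nonneg (L : PentComplex X) (x y : L.Point) : 0 ≤ L.pathDist x y :=
  Real.sInf_nonneg fun _ h => PathLength.nonneg h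

theorem pathDist_self (L : PentComplex X) (x : L.Point) : L.pathDist x x = 0 :=
  le_antisymm (pathDist_le (.nil x)) (L.pathDist_nonneg x x)

theorem pathDist_comm (L : PentComplex X) (x y : L.Point) : L.pathDist x y = L.pathDist y x := by
  unfold pathDist
  congr 1
  ext l
  exact ⟨PathLength.reverse, PathLength.reverse⟩

theorem IsJoined.exists_path {L : PentComplex X} (hL : L.IsJoined) {x y : L.Point} {r : ℝ}
    (h : L.pathDist x y < r) : ∃ l < r, L.PathLength x y l := by
  obtain ⟨l, hl, hlr⟩ := exists_lt_of_csInf_lt (hL x y) h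
  exact ⟨l, hlr, hl⟩

theorem IsJoined.pathDist_triangle {L : PentComplex X} (hL : L.IsJoined) (x y z : L.Point) :
    L.pathDist x z ≤ L.pathDist x y + L.pathDist y z := by
  refine le_of_forall_pos_le_add fun ε hε => ?_
  obtain ⟨l, hl, h⟩ := hL.exists_path (show L.pathDist x y < L.pathDist x y + ε / 2 by linarith)
  obtain ⟨m, hm, h'⟩ := hL.exists_path (show L.pathDist y z < L.pathDist y z + ε / 2 by linarith)
  linarith [pathDist_le (h.append h')]

/-- In the core disc a point has a single representative, so every segment of a short path continues
in the same tile, and the norm grows by at most the length. -/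
theorem PathLength.core {L : PentComplex X} {x y : L.Point} {l : ℝ} (h : L.PathLength x y l) :
    ∀ t p, x = L.pt t p → ‖(p : ℂ)‖ + l < coreRadius →
      ∃ q : Pent, y = L.pt t q ∧ ‖(q : ℂ)‖ < coreRadius := by
  induction h with
  | nil x => exact fun t p h1 h2 => ⟨p, h1, by linarith⟩
  | cons t' p' q' y l h ih =>
    intro t p h1 h2
    have h0 := h.nonneg
    have hd := dist_nonneg (x := p') (y := q')
    obtain ⟨rfl, rfl⟩ := pt_eq_core (by linarith) h1.symm
    refine ih t' q' rfl ?_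
    have : ‖(q' : ℂ)‖ ≤ ‖(p' : ℂ)‖ + dist p' q' := by
      rw [Subtype.dist_eq, dist_eq_norm]
      have := norm_sub_norm_le (q' : ℂ) p'
      rw [norm_sub_rev] at this
      linarith
    linarith

/-- The centres of different tiles are at a positive distance. -/
theorem IsJoined.tile_eq_of_pathDist {L : PentComplex X} (hL : L.IsJoined) {t u : L.tile}
    (h : L.pathDist (L.pt t centreP) (L.pt u centreP) = 0) : t = u := by
  obtain ⟨l, hl, hp⟩ := hL.exists_path (h.trans_lt coreRadius_pos)
  obtain ⟨q, hq, hn⟩ := hp.core t centreP rfl (by simpa [centreP] using hl)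
  exact (pt_eq_centre hq).1

end PentComplex

/-! ### The substitution of points on a single tile -/

/-- The ratio of the distance of the centre from an edge to the circumradius. -/
def midRatio : ℝ := (1 + tau) / 2

theorem mid_eq' (k : ZMod 5) : mid k = midRatio * wv k := mid_eq k

theorem ratio_bounds : 0 < midRatio - innerRatio ∧ 0 < tau - innerRatio := by
  have h1 := tau_bounds
  have h2 := innerRatio_bounds
  unfold midRatio
  constructor <;> linarith

/-- The points `p` of the tile and `q` of the new tile `o` correspond to each other. -/
def Cell : Option (ZMod 5) → ℂ → ℂ → Prop
  | none, p, q => p = -innerRatio * q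
  | some k, p, q => ∃ a b c : ℝ, (0 ≤ a ∧ 0 ≤ b ∧ 0 ≤ c ∧ a + b + c = 1) ∧
      ((p = a * vert k + b * inner k + c * inner (k - 1) ∧
          q = a * vert 0 + b * vert 2 + c * vert 3) ∨
        (p = a * vert k + b * mid k + c * inner k ∧
          q = a * vert 0 + b * vert 1 + c * vert 2) ∨
        (p = a * vert k + b * inner (k - 1) + c * mid (k - 1) ∧
          q = a * vert 0 + b * vert 3 + c * vert 4))

/-- The correspondence of an outer cell in coordinates. -/
def Piece (A B x y : ℝ) : Prop := ∃ a b c : ℝ, (0 ≤ a ∧ 0 ≤ b ∧ 0 ≤ c ∧ a + b + c = 1) ∧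
  ((A = a * tau + c * innerRatio ∧ B = a * tau + b * innerRatio ∧ x = b ∧ y = c) ∨
    (A = a * tau ∧ B = a * tau + b * midRatio + c * innerRatio ∧ x = b + c ∧ y = -tau * b) ∨
    (A = a * tau + b * innerRatio + c * midRatio ∧ B = a * tau ∧ x = -tau * c ∧ y = b + c))

/-- Coordinates of an outer tile with respect to the diagonals from its vertex `0`. -/
def diagPt (x y : ℝ) : ℂ := vert 0 + x * (vert 2 - vert 0) + y * (vert 3 - vert 0)

theorem vert_one_diag : vert 1 = diagPt 1 (-tau) := by
  have h0 := vert_self 0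
  have h1 := vert_add_one 0
  have h2 := vert_add_two 0
  have h3 := vert_add_three 0
  simp only [zero_add] at h1 h2 h3
  unfold diagPt
  rw [h2, h3, h1, h0]
  push_cast
  linear_combination (-wv 0 - wv (0 - 1)) * tau_sq'

theorem vert_four_diag : vert 4 = diagPt (-tau) 1 := by
  have h0 := vert_self 0
  have h1 := vert_add_four 0
  have h2 := vert_add_two 0
  have h3 := vert_add_three 0
  simp only [zero_add] at h1 h2 h3
  unfold diagPt
  rw [h2, h3, h1, h0]
  push_cast
  linear_combination (-wv 0 - wv (0 - 1)) * tau_sq'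

theorem diag_comb {a b c : ℝ} (h : a + b + c = 1) :
    (a * vert 0 + b * vert 2 + c * vert 3 : ℂ) = diagPt b c ∧
    (a * vert 0 + b * vert 1 + c * vert 2 : ℂ) = diagPt (b + c) (-tau * b) ∧
    (a * vert 0 + b * vert 3 + c * vert 4 : ℂ) = diagPt (-tau * c) (b + c) := by
  have ha : (a : ℂ) = 1 - b - c := by
    rw [show a = 1 - b - c by linarith]; push_cast; ring
  rw [vert_one_diag, vert_four_diag, ha]
  unfold diagPt
  push_cast
  refine ⟨?_, ?_, ?_⟩ <;> ring

theorem wv_comb (k : ZMod 5) (a b c : ℝ) :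
    (a * vert k + b * inner k + c * inner (k - 1) : ℂ) =
      ((a * tau + c * innerRatio : ℝ) : ℂ) * wv (k - 1) +
        ((a * tau + b * innerRatio : ℝ) : ℂ) * wv k ∧
    (a * vert k + b * mid k + c * inner k : ℂ) = ((a * tau : ℝ) : ℂ) * wv (k - 1) +
      ((a * tau + b * midRatio + c * innerRatio : ℝ) : ℂ) * wv k ∧
    (a * vert k + b * inner (k - 1) + c * mid (k - 1) : ℂ) =
      ((a * tau + b * innerRatio + c * midRatio : ℝ) : ℂ) * wv (k - 1) +
        ((a * tau : ℝ) : ℂ) * wv k := by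
  rw [inner_eq, inner_eq, mid_eq', mid_eq', vert_self]
  push_cast
  refine ⟨?_, ?_, ?_⟩ <;> ring

theorem cell_some_iff {k : ZMod 5} {p q : ℂ} : Cell (some k) p q ↔
    ∃ A B x y, Piece A B x y ∧ p = A * wv (k - 1) + B * wv k ∧ q = diagPt x y := by
  constructor
  · rintro ⟨a, b, c, h, hpq⟩
    obtain ⟨d1, d2, d3⟩ := diag_comb h.2.2.2
    obtain ⟨w1, w2, w3⟩ := wv_comb k a b c
    rcases hpq with ⟨hp, hq⟩ | ⟨hp, hq⟩ | ⟨hp, hq⟩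
    · exact ⟨_, _, _, _, ⟨a, b, c, h, Or.inl ⟨rfl, rfl, rfl, rfl⟩⟩, hp.trans w1, hq.trans d1⟩
    · exact ⟨_, _, _, _, ⟨a, b, c, h, Or.inr (Or.inl ⟨rfl, rfl, rfl, rfl⟩)⟩, hp.trans w2,
        hq.trans d2⟩
    · exact ⟨_, _, _, _, ⟨a, b, c, h, Or.inr (Or.inr ⟨rfl, rfl, rfl, rfl⟩)⟩, hp.trans w3,
        hq.trans d3⟩
  · rintro ⟨A, B, x, y, ⟨a, b, c, h, hpq⟩, hp, hq⟩
    obtain ⟨d1, d2, d3⟩ := diag_comb h.2.2.2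
    obtain ⟨w1, w2, w3⟩ := wv_comb k a b c
    refine ⟨a, b, c, h, ?_⟩
    rcases hpq with ⟨rfl, rfl, rfl, rfl⟩ | ⟨rfl, rfl, rfl, rfl⟩ | ⟨rfl, rfl, rfl, rfl⟩
    · exact Or.inl ⟨hp.trans w1.symm, hq.trans d1.symm⟩
    · exact Or.inr (Or.inl ⟨hp.trans w2.symm, hq.trans d2.symm⟩)
    · exact Or.inr (Or.inr ⟨hp.trans w3.symm, hq.trans d3.symm⟩)

/-! #### The piecewise linear map in coordinates -/

/-- The functional whose sign separates the cells `middle` and `next`. -/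
def sep (A B : ℝ) : ℝ := tau * B - (tau - innerRatio) * A - innerRatio * tau

/-- The first coordinate of the image. -/
def imgX (A B : ℝ) : ℝ := -sep B A / (innerRatio * (2 * tau - innerRatio))
  - (tau - innerRatio) / (tau * (innerRatio * (2 * tau - innerRatio))) * max (sep A B) 0
  + (1 / (innerRatio * (2 * tau - innerRatio)) - 1 / (midRatio - innerRatio)) * max (sep B A) 0

/-- The first coordinate of the preimage. -/
def preA (x y : ℝ) : ℝ := tau - tau * x + (innerRatio - tau) * y - (tau - innerRatio) * max (-y) 0
  + ((midRatio - innerRatio) / tau - tau) * max (-x) 0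

theorem Piece.swap {A B x y : ℝ} (h : Piece A B x y) : Piece B A y x := by
  obtain ⟨a, b, c, ⟨h1, h2, h3, h4⟩, h⟩ := h
  refine ⟨a, c, b, ⟨h1, h3, h2, by linarith⟩, ?_⟩
  rcases h with ⟨rfl, rfl, rfl, rfl⟩ | ⟨rfl, rfl, rfl, rfl⟩ | ⟨rfl, rfl, rfl, rfl⟩
  · exact Or.inl ⟨rfl, rfl, rfl, rfl⟩
  · exact Or.inr (Or.inr ⟨by ring, rfl, rfl, by ring⟩)
  · exact Or.inr (Or.inl ⟨rfl, by ring, by ring, rfl⟩)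

/-- The three affine maps agree on common sides, so together they are the affine map of the middle
triangle plus multiples of the positive parts of `sep`, each of which vanishes outside one of the
other triangles. One formula thus gives uniqueness of the image and a Lipschitz bound; `Piece.swap`
supplies the second coordinate. -/
theorem Piece.imgX_eq {A B x y : ℝ} (h : Piece A B x y) : x = imgX A B := by
  obtain ⟨a, b, c, ⟨h1, h2, h3, h4⟩, h⟩ := h
  obtain ⟨r1, r2⟩ := ratio_bounds
  have ht := tau_pos
  have hr := innerRatio_pos
  have hm : 0 < 2 * tau - innerRatio := by linarith
  have hg : 0 < midRatio := by linarith
  have hm' : tau * 2 - innerRatio ≠ 0 := by linarith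
  have r1' := r1.ne'
  obtain rfl : a = 1 - b - c := by linarith
  unfold imgX
  rcases h with ⟨rfl, rfl, rfl, rfl⟩ | ⟨rfl, rfl, rfl, rfl⟩ | ⟨rfl, rfl, rfl, rfl⟩
  · have e1 : sep ((1 - x - y) * tau + y * innerRatio) ((1 - x - y) * tau + x * innerRatio) =
      -(y * (innerRatio * (2 * tau - innerRatio))) := by unfold sep; ring
    have e2 : sep ((1 - x - y) * tau + x * innerRatio) ((1 - x - y) * tau + y * innerRatio) =
      -(x * (innerRatio * (2 * tau - innerRatio))) := by unfold sep; ring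
    rw [e1, e2, max_eq_right (neg_nonpos.mpr (by positivity)),
      max_eq_right (neg_nonpos.mpr (by positivity))]
    field_simp
    ring
  · have e1 : sep ((1 - b - c) * tau) ((1 - b - c) * tau + b * midRatio + c * innerRatio) =
      tau * b * (midRatio - innerRatio) := by unfold sep; ring
    have e2 : sep ((1 - b - c) * tau + b * midRatio + c * innerRatio) ((1 - b - c) * tau) =
      -((b + c) * innerRatio * tau + (tau - innerRatio) * (b * midRatio + c * innerRatio)) := by
        unfold sep; ring
    rw [e1, e2, max_eq_left (by positivity), max_eq_right (neg_nonpos.mpr (by positivity))]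
    field_simp
    ring
  · have e1 : sep ((1 - b - c) * tau) ((1 - b - c) * tau + b * innerRatio + c * midRatio) =
      tau * c * (midRatio - innerRatio) := by unfold sep; ring
    have e2 : sep ((1 - b - c) * tau + b * innerRatio + c * midRatio) ((1 - b - c) * tau) =
      -((b + c) * innerRatio * tau + (tau - innerRatio) * (b * innerRatio + c * midRatio)) := by
        unfold sep; ring
    rw [e1, e2, max_eq_right (neg_nonpos.mpr (by positivity)), max_eq_left (by positivity)]
    field_simp
    ring

/-- In the new tile the dividing lines are the diagonals x = 0 and y = 0, so here the corrections
are multiples of the positive parts of −x and −y. -/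
theorem Piece.preA_eq {A B x y : ℝ} (h : Piece A B x y) : A = preA x y := by
  obtain ⟨a, b, c, ⟨h1, h2, h3, h4⟩, h⟩ := h
  have ht := tau_pos
  obtain rfl : a = 1 - b - c := by linarith
  unfold preA
  rcases h with ⟨rfl, rfl, rfl, rfl⟩ | ⟨rfl, rfl, rfl, rfl⟩ | ⟨rfl, rfl, rfl, rfl⟩
  · rw [max_eq_right (by linarith), max_eq_right (by linarith)]
    ring
  · rw [max_eq_left (by nlinarith), max_eq_right (by linarith)]
    ring
  · rw [max_eq_right (by linarith), max_eq_left (by nlinarith)]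
    field_simp
    ring

/-- The outer cell lies in its sector, beyond the side of the inner pentagon, whose equation is A +
B = `innerRatio`. -/
theorem Piece.bounds {A B x y : ℝ} (h : Piece A B x y) :
    0 ≤ A ∧ 0 ≤ B ∧ innerRatio ≤ A + B := by
  obtain ⟨a, b, c, ⟨h1, h2, h3, h4⟩, h⟩ := h
  obtain ⟨r1, r2⟩ := ratio_bounds
  have ht := tau_pos
  have hr := innerRatio_pos
  have hg : 0 < midRatio := by linarith
  have : innerRatio = a * innerRatio + b * innerRatio + c * innerRatio := by
    rw [← add_mul, ← add_mul, h4, one_mul]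
  have i1 : a * innerRatio ≤ a * tau := by gcongr; linarith
  have i2 : b * innerRatio ≤ b * midRatio := by gcongr; linarith
  have i3 : c * innerRatio ≤ c * midRatio := by gcongr; linarith
  have j1 : 0 ≤ a * tau := by positivity
  have j2 : 0 ≤ b * innerRatio := by positivity
  have j3 : 0 ≤ c * innerRatio := by positivity
  rcases h with ⟨rfl, rfl, rfl, rfl⟩ | ⟨rfl, rfl, rfl, rfl⟩ | ⟨rfl, rfl, rfl, rfl⟩ <;>
    refine ⟨?_, ?_, ?_⟩ <;> linarith

/-- On the line from the centre to the midpoint of an edge. -/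
theorem Piece.of_left_zero {B x y : ℝ} (h : Piece 0 B x y) : ∃ s, 0 ≤ s ∧ s ≤ 1 ∧
    B = (1 - s) * midRatio + s * innerRatio ∧ x = 1 ∧ y = -tau * (1 - s) := by
  obtain ⟨a, b, c, ⟨h1, h2, h3, h4⟩, h⟩ := h
  obtain ⟨r1, r2⟩ := ratio_bounds
  have ht := tau_pos
  have hr := innerRatio_pos
  have hg : 0 < midRatio := by linarith
  have j1 : 0 ≤ a * tau := by positivity
  have j2 : 0 ≤ b * innerRatio := by positivity
  have j3 : 0 ≤ c * innerRatio := by positivity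
  have j4 : 0 ≤ c * midRatio := by positivity
  rcases h with ⟨hA, rfl, rfl, rfl⟩ | ⟨hA, rfl, rfl, rfl⟩ | ⟨hA, rfl, rfl, rfl⟩
  · obtain rfl : a = 0 := (mul_eq_zero.mp (show a * tau = 0 by linarith)).resolve_right ht.ne'
    obtain rfl : y = 0 := (mul_eq_zero.mp (show y * innerRatio = 0 by linarith)).resolve_right hr.ne'
    exact ⟨1, by norm_num, le_rfl, by rw [show x = 1 by linarith]; ring, by linarith, by ring⟩
  · obtain rfl : a = 0 := (mul_eq_zero.mp hA.symm).resolve_right ht.ne'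
    refine ⟨c, h3, by linarith, ?_, by linarith, ?_⟩ <;> rw [show b = 1 - c by linarith]
    ring
  · exfalso
    have e1 := (mul_eq_zero.mp (show a * tau = 0 by linarith)).resolve_right ht.ne'
    have e2 := (mul_eq_zero.mp (show b * innerRatio = 0 by linarith)).resolve_right hr.ne'
    have e3 := (mul_eq_zero.mp (show c * midRatio = 0 by linarith)).resolve_right hg.ne'
    linarith

/-- On the boundary of the central cell. -/
theorem Piece.of_add_eq {A B x y : ℝ} (h : Piece A B x y) (hAB : A + B = innerRatio) :
    ∃ s, 0 ≤ s ∧ s ≤ 1 ∧ A = s * innerRatio ∧ B = (1 - s) * innerRatio ∧ x = 1 - s ∧ y = s := by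
  obtain ⟨a, b, c, ⟨h1, h2, h3, h4⟩, h⟩ := h
  obtain ⟨r1, r2⟩ := ratio_bounds
  have hr := innerRatio_pos
  have ht := tau_pos
  obtain rfl : a = 1 - b - c := by linarith
  have i1 : 0 ≤ (1 - b - c) * (2 * tau - innerRatio) := mul_nonneg h1 (by linarith)
  have i2 : 0 ≤ b * (midRatio - innerRatio) := by positivity
  have i3 : 0 ≤ c * (midRatio - innerRatio) := by positivity
  have hm : 2 * tau - innerRatio ≠ 0 := by linarith
  rcases h with ⟨rfl, rfl, rfl, rfl⟩ | ⟨rfl, rfl, rfl, rfl⟩ | ⟨rfl, rfl, rfl, rfl⟩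
  · have e : (1 - x - y) * (2 * tau - innerRatio) = 0 := by linear_combination hAB
    have e' := (mul_eq_zero.mp e).resolve_right hm
    obtain rfl : x = 1 - y := by linarith
    exact ⟨y, h3, by linarith, by ring, by ring, rfl, rfl⟩
  · have e : (1 - b - c) * (2 * tau - innerRatio) + b * (midRatio - innerRatio) = 0 := by
      linear_combination hAB
    have e1 := (mul_eq_zero.mp (show (1 - b - c) * (2 * tau - innerRatio) = 0 by
      linarith)).resolve_right hm
    have e2 := (mul_eq_zero.mp (show b * (midRatio - innerRatio) = 0 by
      linarith)).resolve_right r1.ne'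
    subst e2
    obtain rfl : c = 1 := by linarith
    exact ⟨0, le_rfl, by norm_num, by ring, by ring, by ring, by ring⟩
  · have e : (1 - b - c) * (2 * tau - innerRatio) + c * (midRatio - innerRatio) = 0 := by
      linear_combination hAB
    have e1 := (mul_eq_zero.mp (show (1 - b - c) * (2 * tau - innerRatio) = 0 by
      linarith)).resolve_right hm
    have e2 := (mul_eq_zero.mp (show c * (midRatio - innerRatio) = 0 by
      linarith)).resolve_right r1.ne'
    subst e2
    obtain rfl : b = 1 := by linarith
    exact ⟨1, by norm_num, le_rfl, by ring, by ring, by ring, by ring⟩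

/-- The last two hypotheses place the point on the inner side of edges k and k − 1. The two lines on
which `sep` vanishes cut the resulting region into the three triangles. -/
theorem exists_piece_of_kite {A B : ℝ} (hA : 0 ≤ A) (hB : 0 ≤ B) (hAB : innerRatio ≤ A + B)
    (h1 : B + tau / 2 * A ≤ midRatio) (h2 : A + tau / 2 * B ≤ midRatio) :
    ∃ x y, Piece A B x y := by
  obtain ⟨r1, r2⟩ := ratio_bounds
  have hr := innerRatio_pos
  have ht := tau_pos
  have ht2 := tau_sq
  have hm : 0 < 2 * tau - innerRatio := by linarith
  -- The weights are the barycentric coordinates in the triangle v_k m_k c_k: the equation of each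
  -- side, normalized to be 1 at the opposite vertex.
  have next : ∀ {A B : ℝ}, 0 ≤ A → B + tau / 2 * A ≤ midRatio → 0 ≤ sep A B →
      ∃ x y, Piece A B x y := by
    intro A B hA h1 hs
    refine ⟨_, _, A / tau, sep A B / (tau * (midRatio - innerRatio)),
      (midRatio - B - tau / 2 * A) / (midRatio - innerRatio), ⟨by positivity, by positivity,
      div_nonneg (by linarith) r1.le, ?_⟩, Or.inr (Or.inl ⟨?_, ?_, rfl, rfl⟩)⟩
    · field_simp
      unfold sep midRatio
      linear_combination -A * ht2
    · field_simp
    · field_simp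
      unfold sep midRatio
      linear_combination innerRatio * A * ht2
  rcases le_total 0 (sep A B) with s1 | s1
  · exact next hA h1 s1
  rcases le_total 0 (sep B A) with s2 | s2
  · obtain ⟨x, y, h⟩ := next hB h2 s2
    exact ⟨y, x, h.swap⟩
  · refine ⟨_, _, (A + B - innerRatio) / (2 * tau - innerRatio),
      -sep B A / (innerRatio * (2 * tau - innerRatio)),
      -sep A B / (innerRatio * (2 * tau - innerRatio)), ⟨div_nonneg (by linarith) hm.le,
      div_nonneg (by linarith) (by positivity), div_nonneg (by linarith) (by positivity), ?_⟩,
      Or.inl ⟨?_, ?_, rfl, rfl⟩⟩ <;> unfold sep <;> field_simp <;> ring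

theorem exists_piece_of_diag {x y : ℝ} (h0 : x + y ≤ 1) (hx : x ≤ 1) (hy : y ≤ 1)
    (h1 : 0 ≤ tau * x + y) (h2 : 0 ≤ x + tau * y) : ∃ A B, Piece A B x y := by
  have ht := tau_pos
  have next : ∀ {x y : ℝ}, x ≤ 1 → 0 ≤ tau * x + y → y ≤ 0 → ∃ A B, Piece A B x y := by
    intro x y hx h1 hy
    refine ⟨_, _, 1 - x, -y / tau, (tau * x + y) / tau, ⟨by linarith,
      div_nonneg (by linarith) ht.le, by positivity, by field_simp; ring⟩,
      Or.inr (Or.inl ⟨rfl, rfl, by field_simp; ring, by field_simp⟩)⟩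
  rcases le_total y 0 with s | s
  · exact next hx h1 s
  rcases le_total x 0 with s' | s'
  · obtain ⟨A, B, h⟩ := next hy (by linarith) s'
    exact ⟨B, A, h.swap⟩
  · exact ⟨_, _, 1 - x - y, x, y, ⟨by linarith, s', s, by ring⟩, Or.inl ⟨rfl, rfl, rfl, rfl⟩⟩

/-! ### Correspondence of cells: existence, uniqueness and compatibility -/

theorem diagPt_eq_wv (x y : ℝ) : diagPt x y =
    ((tau - (1 + tau) * x - tau * y : ℝ) : ℂ) * wv (0 - 1) +
      ((tau - tau * x - (1 + tau) * y : ℝ) : ℂ) * wv 0 := by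
  have h0 := vert_self 0
  have h2 := vert_add_two 0
  have h3 := vert_add_three 0
  simp only [zero_add] at h2 h3
  unfold diagPt
  rw [h2, h3, h0]
  push_cast
  ring

/-- The first coordinate of a point of an outer tile with respect to the diagonals. -/
def diagX (q : ℂ) : ℝ := ((2 * tau + co 0 q - co (0 - 1) q) / (1 + 2 * tau)
  + (co (0 - 1) q + co 0 q)) / 2

/-- The second coordinate of a point of an outer tile with respect to the diagonals. -/
def diagY (q : ℂ) : ℝ := ((2 * tau + co 0 q - co (0 - 1) q) / (1 + 2 * tau)
  - (co (0 - 1) q + co 0 q)) / 2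

/-- By `diagPt_eq_wv` the difference and the sum of the two functionals are, up to constants, x + y
and x − y, from which x and y are recovered. -/
theorem diag_coord (x y : ℝ) : diagX (diagPt x y) = x ∧ diagY (diagPt x y) = y := by
  obtain ⟨h1, h2⟩ := co_comb 0 (tau - (1 + tau) * x - tau * y) (tau - tau * x - (1 + tau) * y)
  rw [← diagPt_eq_wv] at h1 h2
  have ht := tau_pos
  unfold diagX diagY
  rw [h1, h2]
  constructor <;> field_simp <;> ring

theorem Cell.coords {k : ZMod 5} {p q : ℂ} (h : Cell (some k) p q) :
    Piece (-co k p) (co (k - 1) p) (diagX q) (diagY q) ∧ q = diagPt (diagX q) (diagY q) := by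
  obtain ⟨A, B, x, y, hP, rfl, rfl⟩ := cell_some_iff.mp h
  obtain ⟨h1, h2⟩ := co_comb k A B
  obtain ⟨h3, h4⟩ := diag_coord x y
  rw [h1, h2, h3, h4, neg_neg]
  exact ⟨hP, rfl⟩

theorem Cell.sector {k : ZMod 5} {p q : ℂ} (h : Cell (some k) p q) : Sector k p := by
  obtain ⟨h1, h2, -⟩ := h.coords.1.bounds
  exact ⟨by linarith, h2⟩

/-- The closed formula `imgX` makes the image a function of the point, so the three triangles need
not be compared pairwise. -/
theorem Cell.right_unique {o : Option (ZMod 5)} {p q q' : ℂ} (h : Cell o p q) (h' : Cell o p q') :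
    q = q' := by
  cases o with
  | none =>
    have hr : (innerRatio : ℂ) ≠ 0 := by exact_mod_cast innerRatio_pos.ne'
    have e : -(innerRatio : ℂ) * q = -innerRatio * q' := h.symm.trans h'
    exact mul_left_cancel₀ (neg_ne_zero.mpr hr) e
  | some k =>
    obtain ⟨h1, h2⟩ := h.coords
    obtain ⟨h1', h2'⟩ := h'.coords
    rw [h2, h2', h1.imgX_eq, h1'.imgX_eq, h1.swap.imgX_eq, h1'.swap.imgX_eq]

theorem Cell.left_unique {o : Option (ZMod 5)} {p p' q : ℂ} (h : Cell o p q) (h' : Cell o p' q) :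
    p = p' := by
  cases o with
  | none => exact Eq.trans h (Eq.symm h')
  | some k =>
    obtain ⟨h1, -⟩ := h.coords
    obtain ⟨h1', -⟩ := h'.coords
    rw [co_expand k p, co_expand k p', h1.preA_eq, h1'.preA_eq, h1.swap.preA_eq, h1'.swap.preA_eq]

theorem mid_eq_edgePt (k : ZMod 5) : mid k = edgePt k (1 / 2) := by
  rw [edgePt, mid, midpoint_eq_smul_add, Complex.real_smul, invOf_eq_inv]
  push_cast; ring

theorem mid_mem (k : ZMod 5) : mid k ∈ pentagon := by
  rw [mid_eq_edgePt]
  exact edgePt_mem k (by norm_num) (by norm_num)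

theorem inner_mem (k : ZMod 5) : inner k ∈ pentagon := by
  obtain ⟨r1, -⟩ := ratio_bounds
  have hr := innerRatio_pos
  have hg : 0 < midRatio := by linarith
  have := comb_two_mem (mid_mem k) centreP.2 (a := innerRatio / midRatio) (b := 1 - innerRatio / midRatio)
    (by positivity) (by rw [sub_nonneg, div_le_one hg]; linarith) (by ring)
  rw [mid_eq', show (centreP : ℂ) = 0 from rfl, mul_zero, add_zero, ← mul_assoc,
    ← Complex.ofReal_mul, div_mul_cancel₀ _ hg.ne'] at this
  rwa [inner_eq]

theorem neg_innerRatio_mul_mem {q : ℂ} (hq : q ∈ pentagon) : -innerRatio * q ∈ pentagon := by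
  have hlin : IsLinearMap ℝ (fun q : ℂ => -(innerRatio : ℂ) * q) := by
    constructor
    · intro x y; ring
    · intro r x; simp only [Complex.real_smul]; ring
  have : pentagon ⊆ (fun q : ℂ => -(innerRatio : ℂ) * q) ⁻¹' pentagon := by
    refine convexHull_min ?_ (convex_pentagon.is_linear_preimage hlin)
    rintro _ ⟨k, rfl⟩
    have := inner_mem (k - 3)
    rwa [inner, sub_add_cancel] at this
  exact this hq

theorem Cell.left_mem {o : Option (ZMod 5)} {p q : ℂ} (h : Cell o p q) (hq : q ∈ pentagon) :
    p ∈ pentagon := by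
  cases o with
  | none => rw [show p = _ from h]; exact neg_innerRatio_mul_mem hq
  | some k =>
    obtain ⟨a, b, c, ⟨h1, h2, h3, h4⟩, ⟨rfl, -⟩ | ⟨rfl, -⟩ | ⟨rfl, -⟩⟩ := h
    · exact comb_mem (vert_mem _) (inner_mem _) (inner_mem _) h1 h2 h3 h4
    · exact comb_mem (vert_mem _) (mid_mem _) (inner_mem _) h1 h2 h3 h4
    · exact comb_mem (vert_mem _) (inner_mem _) (mid_mem _) h1 h2 h3 h4

theorem Cell.right_mem {k : ZMod 5} {p q : ℂ} (h : Cell (some k) p q) : q ∈ pentagon := by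
  obtain ⟨a, b, c, ⟨h1, h2, h3, h4⟩, ⟨-, rfl⟩ | ⟨-, rfl⟩ | ⟨-, rfl⟩⟩ := h <;>
  exact comb_mem (vert_mem _) (vert_mem _) (vert_mem _) h1 h2 h3 h4

/-- Inside its sector the point lies either on the centre's side of the line A + B = `innerRatio`,
hence in the inner pentagon, or beyond it, hence in the outer cell. -/
theorem exists_cell_of_left (p : Pent) : ∃ o, ∃ q : Pent, Cell o p q := by
  have hr := innerRatio_pos
  obtain ⟨k, h1, h2⟩ := exists_sector (p : ℂ)
  rcases le_total (-co k p + co (k - 1) p) innerRatio with h | h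
  -- Passing to the central tile is multiplication by −1/`innerRatio`, so the sector at vertex k
  -- goes to the one spanned by the opposite vertices k + 2 and k + 3.
  · refine ⟨none, ⟨_, comb_mem (vert_mem (k + 2)) (vert_mem (k + 3)) centreP.2
      (a := -co k p / innerRatio) (b := co (k - 1) p / innerRatio)
      (c := 1 - (-co k p + co (k - 1) p) / innerRatio)
      (div_nonneg (by linarith) hr.le) (by positivity) (by rwa [sub_nonneg, div_le_one hr])
      (by ring)⟩, ?_⟩
    have hr' : (innerRatio : ℂ) ≠ 0 := by exact_mod_cast hr.ne'
    change (p : ℂ) = -innerRatio * (_ + _ * (centreP : ℂ))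
    rw [show (centreP : ℂ) = 0 from rfl, vert_add_two, vert_add_three]
    conv_lhs => rw [co_expand k p]
    push_cast
    field_simp
    ring
  · have e1 := edgeFun_le p.2 k
    have e2 := edgeFun_le p.2 (k - 1)
    obtain ⟨-, -, h3, -⟩ := co_values k p
    simp only [edgeFun, LinearMap.sub_apply, LinearMap.smul_apply, smul_eq_mul] at e1 e2
    rw [show k - 1 - 1 = k + 3 by rw [zmod5_eqs.2.1]; ring, h3] at e2
    obtain ⟨x, y, hp⟩ := exists_piece_of_kite (A := -co k p) (B := co (k - 1) p) (by linarith) h2 h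
      (by unfold midRatio; linarith) (by unfold midRatio; linarith)
    have hc : Cell (some k) p (diagPt x y) :=
      cell_some_iff.mpr ⟨_, _, _, _, hp, co_expand k p, rfl⟩
    exact ⟨some k, ⟨_, hc.right_mem⟩, hc⟩

/-- The inequalities describe the pentagon in diagonal coordinates. Only one inclusion is needed,
and by convexity it suffices to check the vertices. -/
theorem exists_diag {q : ℂ} (hq : q ∈ pentagon) : ∃ x y, q = diagPt x y ∧ x + y ≤ 1 ∧ x ≤ 1 ∧
    y ≤ 1 ∧ 0 ≤ tau * x + y ∧ 0 ≤ x + tau * y := by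
  have ht := tau_bounds
  have ht2 := tau_sq
  have hconv : Convex ℝ {q : ℂ | ∃ x y, q = diagPt x y ∧ x + y ≤ 1 ∧ x ≤ 1 ∧
    y ≤ 1 ∧ 0 ≤ tau * x + y ∧ 0 ≤ x + tau * y} := by
    rintro _ ⟨x, y, rfl, h1, h2, h3, h4, h5⟩ _ ⟨x', y', rfl, h1', h2', h3', h4', h5'⟩ a b ha hb hab
    refine ⟨a * x + b * x', a * y + b * y', ?_, ?_, ?_, ?_, ?_, ?_⟩
    · simp only [diagPt, Complex.real_smul]
      push_cast
      have hab' : (a : ℂ) + b = 1 := by exact_mod_cast hab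
      linear_combination vert 0 * hab'
    all_goals nlinarith
  refine convexHull_min ?_ hconv hq
  rintro _ ⟨k, rfl⟩
  fin_cases k
  · exact ⟨0, 0, show vert 0 = _ by simp [diagPt], by norm_num, by norm_num, by norm_num, by norm_num, by norm_num⟩
  · exact ⟨1, -tau, vert_one_diag, by linarith, by linarith, by linarith, by linarith, by nlinarith⟩
  · exact ⟨1, 0, show vert 2 = _ by simp [diagPt], by norm_num, by norm_num, by norm_num, by linarith, by norm_num⟩
  · exact ⟨0, 1, show vert 3 = _ by simp [diagPt], by norm_num, by norm_num, by norm_num, by norm_num, by linarith⟩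
  · exact ⟨-tau, 1, vert_four_diag, by linarith, by linarith, by linarith, by nlinarith, by linarith⟩

theorem exists_cell_of_right (o : Option (ZMod 5)) (q : Pent) : ∃ p : Pent, Cell o p q := by
  cases o with
  | none => exact ⟨⟨_, neg_innerRatio_mul_mem q.2⟩, rfl⟩
  | some k =>
    obtain ⟨x, y, hq, h1, h2, h3, h4, h5⟩ := exists_diag q.2
    obtain ⟨A, B, h⟩ := exists_piece_of_diag h1 h2 h3 h4 h5
    have hc : Cell (some k) (A * wv (k - 1) + B * wv k) q :=
      cell_some_iff.mpr ⟨_, _, _, _, h, rfl, hq⟩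
    exact ⟨⟨_, hc.left_mem q.2⟩, hc⟩

theorem diagPt_edge_one (s : ℝ) : diagPt 1 (-tau * (1 - s)) = edgePt 1 s := by
  rw [edgePt, vert_one_diag, show (1 + 1 : ZMod 5) = 2 by decide]
  unfold diagPt; push_cast; ring

theorem diagPt_edge_two (s : ℝ) : diagPt (1 - s) s = edgePt 2 s := by
  rw [edgePt, show (2 + 1 : ZMod 5) = 3 by decide]
  unfold diagPt; push_cast; ring

theorem diagPt_edge_three (s : ℝ) : diagPt (-tau * (1 - s)) 1 = edgePt 3 (1 - s) := by
  rw [edgePt, show (3 + 1 : ZMod 5) = 4 by decide, vert_four_diag]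
  unfold diagPt; push_cast; ring

/-- Being in an outer cell gives `co k q - co (k - 1) q ≥ 1`, and q lying in the pentagon gives the
reverse inequality, from edge k + 2. Equality puts p on the side c_(k−1)c_k, where both
correspondences are explicit. -/
theorem Cell.inner_outer {k : ZMod 5} {p q q' : ℂ} (hq : q ∈ pentagon) (h : Cell none p q)
    (h' : Cell (some k) p q') :
    ∃ s, 0 ≤ s ∧ s ≤ 1 ∧ q = edgePt (k + 2) s ∧ q' = edgePt 2 (1 - s) := by
  have hr := innerRatio_pos
  obtain ⟨hP, hq'⟩ := h'.coords
  have hp : p = -innerRatio * q := h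
  have hs : ∀ j, co j p = -innerRatio * co j q := by
    intro j; rw [hp, ← Complex.ofReal_neg, co_real_mul]
  obtain ⟨b1, b2, b3⟩ := hP.bounds
  simp only [hs] at b1 b2 b3 hP
  have e := edgeFun_le hq (k + 2)
  obtain ⟨c1, c2, -, -⟩ := co_values k q
  simp only [edgeFun, LinearMap.sub_apply, LinearMap.smul_apply, smul_eq_mul] at e
  rw [show k + 2 - 1 = k + 1 by ring, c1, c2] at e
  have ht := tau_pos
  have ht2 := tau_sq
  have e2 : (co k q - co (k - 1) q) * (1 + tau) ≤ 1 + tau := by nlinarith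
  have e3 : co k q - co (k - 1) q ≤ 1 := le_of_mul_le_mul_right (by linarith) (by linarith : 0 < 1 + tau)
  have e4 : 1 ≤ co k q - co (k - 1) q :=
    le_of_mul_le_mul_left (by linarith) hr
  have e5 : co k q - co (k - 1) q = 1 := le_antisymm e3 e4
  obtain ⟨s, s0, s1, sA, sB, sx, sy⟩ := hP.of_add_eq (by linear_combination innerRatio * e5)
  have sA' : co k q = s := mul_left_cancel₀ hr.ne' (by linear_combination sA)
  refine ⟨1 - s, by linarith, by linarith, ?_, ?_⟩
  · have sB' : co (k - 1) q = s - 1 := by linarith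
    rw [co_expand k q, sA', sB', edgePt, vert_add_two, show k + 2 + 1 = k + 3 by ring,
      vert_add_three]
    push_cast; ring
  · rw [hq', sx, sy, diagPt_edge_two, sub_sub_cancel]

/-- The common part of the two cells is the segment from m_k to c_k, and both maps are affine on it.
The two parameters coincide because `midRatio` and `innerRatio` differ. -/
theorem Cell.outer_outer {k : ZMod 5} {p q q' : ℂ} (h : Cell (some k) p q)
    (h' : Cell (some (k + 1)) p q') (h0 : co k p = 0) :
    ∃ s, 0 ≤ s ∧ s ≤ 1 ∧ q = edgePt 1 s ∧ q' = edgePt 3 (1 - s) := by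
  obtain ⟨hP, hq⟩ := h.coords
  obtain ⟨hP', hq'⟩ := h'.coords
  rw [h0, neg_zero] at hP
  obtain ⟨c1, -⟩ := co_values k p
  rw [add_sub_cancel_right, h0, c1, h0, mul_zero, zero_sub, neg_neg] at hP'
  obtain ⟨s, s0, s1, sB, sx, sy⟩ := hP.of_left_zero
  obtain ⟨s', -, -, sB', sx', sy'⟩ := hP'.swap.of_left_zero
  have hs : s' = s := by
    have e : (s' - s) * (midRatio - innerRatio) = 0 := by linear_combination sB' - sB
    have := (mul_eq_zero.mp e).resolve_right ratio_bounds.1.ne'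
    linarith
  refine ⟨s, s0, s1, ?_, ?_⟩
  · rw [hq, sx, sy, diagPt_edge_one]
  · rw [hq', sx', sy', hs, diagPt_edge_three]

theorem Cell.some_ne_zero {k : ZMod 5} {p q : ℂ} (h : Cell (some k) p q) : p ≠ 0 := by
  rintro rfl
  have := h.coords.1.bounds.2.2
  rw [map_zero, map_zero] at this
  linarith [innerRatio_pos]

/-- Each half of an old edge is stretched by the factor two onto an edge of an outer tile; this
makes the substitution agree across pasted edges. -/
theorem cell_first_half (k : ZMod 5) {r : ℝ} (h0 : 0 ≤ r) (h1 : r ≤ 1) :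
    Cell (some k) (edgePt k (r / 2)) (edgePt 0 r) := by
  refine ⟨1 - r, r, 0, ⟨by linarith, h0, le_rfl, by ring⟩, Or.inr (Or.inl ⟨?_, ?_⟩)⟩
  · rw [edgePt, mid, midpoint_eq_smul_add, Complex.real_smul, invOf_eq_inv]
    push_cast; ring
  · rw [edgePt, zero_add]; push_cast; ring

theorem cell_second_half (k : ZMod 5) {r : ℝ} (h0 : 0 ≤ r) (h1 : r ≤ 1) :
    Cell (some (k + 1)) (edgePt k ((1 + r) / 2)) (edgePt 4 r) := by
  refine ⟨r, 0, 1 - r, ⟨h0, le_rfl, by linarith, by ring⟩, Or.inr (Or.inr ⟨?_, ?_⟩)⟩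
  · rw [edgePt, mid, midpoint_eq_smul_add, Complex.real_smul, invOf_eq_inv, add_sub_cancel_right]
    push_cast; ring
  · rw [edgePt, show (4 + 1 : ZMod 5) = 0 by decide]; push_cast; ring

theorem cell_inner_edge (k : ZMod 5) {s : ℝ} (h0 : 0 ≤ s) (h1 : s ≤ 1) :
    ∃ p, Cell none p (edgePt (k + 2) s) ∧ Cell (some k) p (edgePt 2 (1 - s)) := by
  refine ⟨_, rfl, 0, s, 1 - s, ⟨le_rfl, h0, by linarith, by ring⟩, Or.inl ⟨?_, ?_⟩⟩
  · rw [edgePt, inner, inner, show k + 2 + 1 = k + 3 by ring, show k - 1 + 3 = k + 2 by ring]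
    push_cast; ring
  · rw [edgePt, show (2 + 1 : ZMod 5) = 3 by decide]; push_cast; ring

theorem cell_outer_edge (k : ZMod 5) {s : ℝ} (h0 : 0 ≤ s) (h1 : s ≤ 1) :
    ∃ p, Cell (some k) p (edgePt 1 s) ∧ Cell (some (k + 1)) p (edgePt 3 (1 - s)) := by
  refine ⟨_, ⟨0, 1 - s, s, ⟨le_rfl, by linarith, h0, by ring⟩, Or.inr (Or.inl ⟨rfl, ?_⟩)⟩,
    0, s, 1 - s, ⟨le_rfl, h0, by linarith, by ring⟩, Or.inr (Or.inr ⟨?_, ?_⟩)⟩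
  · rw [edgePt, show (1 + 1 : ZMod 5) = 2 by decide]; push_cast; ring
  · rw [add_sub_cancel_right]; push_cast; ring
  · rw [edgePt, show (3 + 1 : ZMod 5) = 4 by decide]; push_cast; ring

/-! #### Symmetry -/

/-- The effect of a symmetry of a tile on the numbers of the new tiles. -/
def cellIdx (g : DihedralGroup 5) : Option (ZMod 5) → Option (ZMod 5) := Option.map (symIdx g)

/-- The effect of a symmetry of a tile on the points of the new tile with a given number. -/
def cellSym (g : DihedralGroup 5) : Option (ZMod 5) → DihedralGroup 5
  | none => g
  | some _ => outerSym g

theorem sym_comb (g : DihedralGroup 5) (a b c : ℝ) (u v w : ℂ) :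
    sym g (a * u + b * v + c * w) = a * sym g u + b * sym g v + c * sym g w := by
  have := sym_real_comb g 1 c (a * u + b * v) w
  simp only [Complex.ofReal_one, one_mul] at this
  rw [this, sym_real_comb]

/-- A rotation permutes the cells and leaves the numbering of an outer tile, which starts at the
vertex of the old tile, unchanged. A reflection also exchanges the two side triangles and, with
them, the weights b and c. -/
theorem Cell.sym {o : Option (ZMod 5)} {p q : ℂ} (h : Cell o p q) (g : DihedralGroup 5) :
    Cell (cellIdx g o) (sym g p) (sym (cellSym g o) q) := by
  cases o with
  | none =>
    change PentHull.sym g p = -innerRatio * PentHull.sym g q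
    rw [show p = -innerRatio * q from h]
    have := sym_real_comb g (-innerRatio) 0 q 0
    simpa using this
  | some k =>
    have hi : ∀ k, PentHull.sym g (inner k) = inner (edgeIdx g k) := by
      intro k
      have := sym_real_comb g (-innerRatio) 0 (vert (k + 3)) 0
      simp only [Complex.ofReal_neg, Complex.ofReal_zero, mul_zero, zero_mul, add_zero, sym_vert] at this
      unfold inner
      rw [this]
      congr 2
      rcases g with i | i <;> simp only [symIdx, edgeIdx]
      · ring
      · linear_combination -zmod5_eqs.2.2
    have hm : ∀ k, PentHull.sym g (mid k) = mid (edgeIdx g k) := by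
      intro k
      rw [mid_eq_edgePt, sym_edgePt, mid_eq_edgePt]
      congr 1
      rcases g with i | i <;> simp only [edgePar]; norm_num
    obtain ⟨a, b, c, ⟨h1, h2, h3, h4⟩, h⟩ := h
    rcases g with i | i
    · refine ⟨a, b, c, ⟨h1, h2, h3, h4⟩, ?_⟩
      have hq : PentHull.sym (cellSym (.r i) (some k)) q = q := sym_one q
      rw [hq]
      simp only [symIdx]
      rw [show i + k - 1 = i + (k - 1) by ring]
      rcases h with ⟨rfl, rfl⟩ | ⟨rfl, rfl⟩ | ⟨rfl, rfl⟩
      · exact Or.inl ⟨by rw [sym_comb, sym_vert, hi, hi]; rfl, rfl⟩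
      · exact Or.inr (Or.inl ⟨by rw [sym_comb, sym_vert, hi, hm]; rfl, rfl⟩)
      · exact Or.inr (Or.inr ⟨by rw [sym_comb, sym_vert, hi, hm]; rfl, rfl⟩)
    · refine ⟨a, c, b, ⟨h1, h3, h2, by linarith⟩, ?_⟩
      have e1 : edgeIdx (.sr i) k = -i - k - 1 := rfl
      have e2 : edgeIdx (.sr i) (k - 1) = -i - k := by simp only [edgeIdx]; ring
      simp only [cellSym, outerSym]
      rcases h with ⟨rfl, rfl⟩ | ⟨rfl, rfl⟩ | ⟨rfl, rfl⟩ <;>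
        simp only [sym_comb, sym_vert, hi, hm, e1, e2, symIdx]
      · refine Or.inl ⟨by ring, ?_⟩
        rw [show (-0 - 0 : ZMod 5) = 0 by decide, show (-0 - 2 : ZMod 5) = 3 by decide,
          show (-0 - 3 : ZMod 5) = 2 by decide]
        ring
      · refine Or.inr (Or.inr ⟨by ring, ?_⟩)
        rw [show (-0 - 0 : ZMod 5) = 0 by decide, show (-0 - 1 : ZMod 5) = 4 by decide,
          show (-0 - 2 : ZMod 5) = 3 by decide]
        ring
      · refine Or.inr (Or.inl ⟨by ring, ?_⟩)
        rw [show (-0 - 0 : ZMod 5) = 0 by decide, show (-0 - 3 : ZMod 5) = 2 by decide,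
          show (-0 - 4 : ZMod 5) = 1 by decide]
        ring

/-- For an outer cell the relation is the union of three continuous images of the compact simplex of
barycentric weights. -/
theorem isClosed_cell (o : Option (ZMod 5)) : IsClosed {a : Pent × Pent | Cell o a.1 a.2} := by
  cases o with
  | none =>
    refine isClosed_eq (f := fun a : Pent × Pent => (a.1 : ℂ))
      (g := fun a : Pent × Pent => -innerRatio * (a.2 : ℂ)) ?_ ?_ <;> fun_prop
  | some k =>
    let S : Set (ℝ × ℝ × ℝ) := {a | 0 ≤ a.1 ∧ 0 ≤ a.2.1 ∧ 0 ≤ a.2.2 ∧ a.1 + a.2.1 + a.2.2 = 1}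
    have hS : IsCompact S := by
      refine (isCompact_Icc (a := ((0, 0, 0) : ℝ × ℝ × ℝ)) (b := (1, 1, 1))).of_isClosed_subset ?_ ?_
      · exact (isClosed_le continuous_const continuous_fst).inter
          ((isClosed_le continuous_const (continuous_fst.comp continuous_snd)).inter
          ((isClosed_le continuous_const (continuous_snd.comp continuous_snd)).inter
            (isClosed_eq (f := fun a : ℝ × ℝ × ℝ => a.1 + a.2.1 + a.2.2) (by fun_prop)
              continuous_const)))
      · rintro ⟨a, b, c⟩ ⟨h1, h2, h3, h4⟩
        dsimp only at h1 h2 h3 h4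
        exact ⟨⟨h1, h2, h3⟩, ⟨by change a ≤ 1; linarith, by change b ≤ 1; linarith,
          by change c ≤ 1; linarith⟩⟩
    have key : ∀ u v w u' v' w' : ℂ, IsClosed {a : Pent × Pent | ∃ s ∈ S,
        (s.1 * u + s.2.1 * v + s.2.2 * w, s.1 * u' + s.2.1 * v' + s.2.2 * w') =
          ((a.1 : ℂ), (a.2 : ℂ))} := by
      intro u v w u' v' w'
      have h := (hS.image (f := fun s : ℝ × ℝ × ℝ => ((s.1 * u + s.2.1 * v + s.2.2 * w : ℂ),
        (s.1 * u' + s.2.1 * v' + s.2.2 * w' : ℂ))) (by fun_prop)).isClosed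
      exact h.preimage (f := fun a : Pent × Pent => ((a.1 : ℂ), (a.2 : ℂ))) (by fun_prop)
    convert ((key (vert k) (inner k) (inner (k - 1)) (vert 0) (vert 2) (vert 3)).union
      ((key (vert k) (mid k) (inner k) (vert 0) (vert 1) (vert 2)).union
      (key (vert k) (inner (k - 1)) (mid (k - 1)) (vert 0) (vert 3) (vert 4)))) using 1
    ext ⟨p, q⟩
    constructor
    · rintro ⟨a, b, c, h, ⟨hp, hq⟩ | ⟨hp, hq⟩ | ⟨hp, hq⟩⟩
      · exact Or.inl ⟨(a, b, c), h, Prod.ext hp.symm hq.symm⟩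
      · exact Or.inr (Or.inl ⟨(a, b, c), h, Prod.ext hp.symm hq.symm⟩)
      · exact Or.inr (Or.inr ⟨(a, b, c), h, Prod.ext hp.symm hq.symm⟩)
    · rintro (⟨⟨a, b, c⟩, h, e⟩ | ⟨⟨a, b, c⟩, h, e⟩ | ⟨⟨a, b, c⟩, h, e⟩) <;>
        obtain ⟨e1, e2⟩ := Prod.ext_iff.mp e
      · exact ⟨a, b, c, h, Or.inl ⟨e1.symm, e2.symm⟩⟩
      · exact ⟨a, b, c, h, Or.inr (Or.inl ⟨e1.symm, e2.symm⟩)⟩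
      · exact ⟨a, b, c, h, Or.inr (Or.inr ⟨e1.symm, e2.symm⟩)⟩

/-! ### Lipschitz bounds for the correspondence of cells -/

/-- Lipschitz continuity with some constant. -/
def IsLip {E : Type} [PseudoEMetricSpace E] (f : ℂ → E) : Prop := ∃ K, LipschitzWith K f

theorem IsLip.add {E : Type} [SeminormedAddCommGroup E] {f g : ℂ → E} (hf : IsLip f)
    (hg : IsLip g) : IsLip (fun p => f p + g p) :=
  ⟨_, hf.choose_spec.add hg.choose_spec⟩

theorem IsLip.sub {E : Type} [SeminormedAddCommGroup E] {f g : ℂ → E} (hf : IsLip f)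
    (hg : IsLip g) : IsLip (fun p => f p - g p) :=
  ⟨_, hf.choose_spec.sub hg.choose_spec⟩

theorem IsLip.neg {E : Type} [SeminormedAddCommGroup E] {f : ℂ → E} (hf : IsLip f) :
    IsLip (fun p => -f p) :=
  ⟨_, hf.choose_spec.neg⟩

theorem isLip_const {E : Type} [PseudoEMetricSpace E] (c : E) : IsLip (fun _ : ℂ => c) :=
  ⟨0, LipschitzWith.const c⟩

theorem isLip_co (k : ZMod 5) : IsLip (fun p => co k p) :=
  ⟨_, (co k).toContinuousLinearMap.lipschitz⟩

theorem IsLip.const_mul {f : ℂ → ℝ} (hf : IsLip f) (c : ℝ) : IsLip (fun p => c * f p) :=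
  ⟨_, (lipschitzWith_smul c).comp hf.choose_spec⟩

theorem IsLip.div_const {f : ℂ → ℝ} (hf : IsLip f) (c : ℝ) : IsLip (fun p => f p / c) := by
  simp only [div_eq_inv_mul]
  exact hf.const_mul _

theorem IsLip.max_zero {f : ℂ → ℝ} (hf : IsLip f) : IsLip (fun p => max (f p) 0) :=
  ⟨_, hf.choose_spec.max_const 0⟩

theorem IsLip.mul_const {f : ℂ → ℝ} (hf : IsLip f) (w : ℂ) : IsLip (fun p => (f p : ℂ) * w) := by
  have h : LipschitzWith ‖w‖₊ (fun r : ℝ => (r : ℂ) * w) := by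
    refine LipschitzWith.of_dist_le_mul fun r s => ?_
    rw [dist_eq_norm, ← sub_mul, norm_mul, ← Complex.ofReal_sub, Complex.norm_real, mul_comm,
      dist_eq_norm]
    rfl
  exact ⟨_, h.comp hf.choose_spec⟩

theorem IsLip.sep {f g : ℂ → ℝ} (hf : IsLip f) (hg : IsLip g) : IsLip (fun p => sep (f p) (g p)) :=
  ((hg.const_mul _).sub (hf.const_mul _)).sub (isLip_const _)

theorem IsLip.imgX {f g : ℂ → ℝ} (hf : IsLip f) (hg : IsLip g) :
    IsLip (fun p => imgX (f p) (g p)) :=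
  (((hg.sep hf).neg.div_const _).sub ((hf.sep hg).max_zero.const_mul _)).add
    ((hg.sep hf).max_zero.const_mul _)

theorem IsLip.preA {f g : ℂ → ℝ} (hf : IsLip f) (hg : IsLip g) :
    IsLip (fun p => preA (f p) (g p)) :=
  (((((isLip_const _).sub (hf.const_mul _)).add (hg.const_mul _)).sub
    (hg.neg.max_zero.const_mul _))).add (hf.neg.max_zero.const_mul _)

theorem IsLip.diagPt {f g : ℂ → ℝ} (hf : IsLip f) (hg : IsLip g) :
    IsLip (fun p => diagPt (f p) (g p)) :=
  ((isLip_const _).add (hf.mul_const _)).add (hg.mul_const _)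

theorem isLip_diagX : IsLip diagX :=
  (((((isLip_const _).add (isLip_co _)).sub (isLip_co _)).div_const _).add
    ((isLip_co _).add (isLip_co _))).div_const _

theorem isLip_diagY : IsLip diagY :=
  (((((isLip_const _).add (isLip_co _)).sub (isLip_co _)).div_const _).sub
    ((isLip_co _).add (isLip_co _))).div_const _

theorem exists_cell_bound (o : Option (ZMod 5)) : ∃ K : ℝ, 0 < K ∧ ∀ p q p' q',
    Cell o p q → Cell o p' q' → ‖q - q'‖ ≤ K * ‖p - p'‖ ∧ ‖p - p'‖ ≤ K * ‖q - q'‖ := by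
  -- The closed formulas are Lipschitz on the whole plane, so no convexity of the cells is needed.
  suffices h : ∃ F G : ℂ → ℂ, IsLip F ∧ IsLip G ∧ ∀ p q, Cell o p q → q = F p ∧ p = G q by
    obtain ⟨F, G, ⟨K, hK⟩, ⟨K', hK'⟩, h⟩ := h
    refine ⟨K + K' + 1, by positivity, fun p q p' q' h1 h2 => ?_⟩
    have a := hK.dist_le_mul p p'
    have b := hK'.dist_le_mul q q'
    rw [← (h _ _ h1).1, ← (h _ _ h2).1, dist_eq_norm, dist_eq_norm] at a
    rw [← (h _ _ h1).2, ← (h _ _ h2).2, dist_eq_norm, dist_eq_norm] at b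
    constructor
    · refine a.trans ?_
      gcongr
      linarith [K'.coe_nonneg]
    · refine b.trans ?_
      gcongr
      linarith [K.coe_nonneg]
  cases o with
  | none =>
    have hr : (innerRatio : ℂ) ≠ 0 := by exact_mod_cast innerRatio_pos.ne'
    have hmul : ∀ w : ℂ, IsLip (fun p => w * p) := fun w => ⟨_, lipschitzWith_smul w⟩
    refine ⟨_, _, hmul (-innerRatio)⁻¹, hmul (-innerRatio), fun p q h => ⟨?_, h⟩⟩
    rw [show p = _ from h, inv_mul_cancel_left₀ (neg_ne_zero.mpr hr)]
  | some k =>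
    have hA := (isLip_co k).neg
    have hB := isLip_co (k - 1)
    refine ⟨_, _, (hA.imgX hB).diagPt (hB.imgX hA),
      ((isLip_diagX.preA isLip_diagY).mul_const (wv (k - 1))).add
        ((isLip_diagY.preA isLip_diagX).mul_const (wv k)), fun p q h => ?_⟩
    obtain ⟨h1, h2⟩ := h.coords
    rw [← h1.imgX_eq, ← h1.swap.imgX_eq, ← h1.preA_eq, ← h1.swap.preA_eq]
    exact ⟨h2, co_expand k p⟩

theorem exists_lip_bound : ∃ K : ℝ, 1 ≤ K ∧ ∀ o p q p' q',
    Cell o p q → Cell o p' q' → ‖q - q'‖ ≤ K * ‖p - p'‖ ∧ ‖p - p'‖ ≤ K * ‖q - q'‖ := by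
  choose K hK h using exists_cell_bound
  have hsum : ∀ o, K o ≤ 1 + ∑ o, K o := fun o => by
    have := Finset.single_le_sum (f := K) (fun o _ => (hK o).le) (Finset.mem_univ o)
    linarith
  refine ⟨1 + ∑ o, K o, ?_, fun o p q p' q' h1 h2 => ?_⟩
  · have := Finset.sum_nonneg (s := Finset.univ) (fun o _ => (hK o).le)
    linarith
  · obtain ⟨a, b⟩ := h o p q p' q' h1 h2
    constructor
    · exact a.trans (mul_le_mul_of_nonneg_right (hsum o) (norm_nonneg _))
    · exact b.trans (mul_le_mul_of_nonneg_right (hsum o) (norm_nonneg _))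

/-- A common Lipschitz constant of the substitution of points and its inverse. -/
def lipConst : ℝ := exists_lip_bound.choose

theorem one_le_lipConst : 1 ≤ lipConst := exists_lip_bound.choose_spec.1

theorem lipConst_pos : 0 < lipConst := by linarith [one_le_lipConst]

theorem Cell.dist_right_le {o : Option (ZMod 5)} {p q p' q' : Pent} (h : Cell o p q)
    (h' : Cell o p' q') : dist q q' ≤ lipConst * dist p p' := by
  rw [Subtype.dist_eq, Subtype.dist_eq, dist_eq_norm, dist_eq_norm]
  exact (exists_lip_bound.choose_spec.2 o _ _ _ _ h h').1

theorem Cell.dist_left_le {o : Option (ZMod 5)} {p q p' q' : Pent} (h : Cell o p q)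
    (h' : Cell o p' q') : dist p p' ≤ lipConst * dist q q' := by
  rw [Subtype.dist_eq, Subtype.dist_eq, dist_eq_norm, dist_eq_norm]
  exact (exists_lip_bound.choose_spec.2 o _ _ _ _ h h').2

/-! ### The substitution of points of a complex -/

/-- The pasting of the new tiles comes from equality of points or the pasting of the old tiles. -/
theorem PentComplex.exists_cell_subGlue {X : Type} (L : PentComplex X) {t u : L.tile} {o o' : Option (ZMod 5)}
    {i j : ZMod 5} (hg : SubGlue L.glue (t, o) i (u, o') j) (s : Set.Icc (0 : ℝ) 1) :
    ∃ p p' : Pent, Cell o p (edgeP i s) ∧ Cell o' p' (edgeP j (revPar s)) ∧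
      L.pt t p = L.pt u p' := by
  have same : ∀ {t : L.tile} {o o' : Option (ZMod 5)} {q q' : Pent},
      (∃ p, Cell o p q ∧ Cell o' p q') → ∃ p p' : Pent, Cell o p q ∧ Cell o' p' q' ∧
        L.pt t p = L.pt t p' :=
    fun {t o o' q q'} ⟨p, h, h'⟩ => ⟨⟨p, h.left_mem q.2⟩, ⟨p, h.left_mem q.2⟩, h, h', rfl⟩
  have hs : (edgeP i s : ℂ) = edgePt i (1 - revPar s) := by
    change _ = edgePt i (1 - (1 - s)); rw [sub_sub_cancel]; rfl
  cases hg with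
  | centre_outer t k => exact same (cell_inner_edge k s.2.1 s.2.2)
  | outer_centre t k =>
    obtain ⟨p, h, h'⟩ := cell_inner_edge k (revPar s).2.1 (revPar s).2.2
    exact same ⟨p, by rw [hs]; exact h', h⟩
  | outer_next t k => exact same (cell_outer_edge k s.2.1 s.2.2)
  | outer_prev t k =>
    obtain ⟨p, h, h'⟩ := cell_outer_edge k (revPar s).2.1 (revPar s).2.2
    exact same ⟨p, by rw [hs]; exact h', h⟩
  | first_half t u k l h =>
    obtain ⟨s, s0, s1⟩ := s
    refine ⟨⟨_, edgePt_mem k (s := s / 2) (by linarith) (by linarith)⟩,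
      ⟨_, edgePt_mem l (s := (1 + (1 - s)) / 2) (by linarith) (by linarith)⟩,
      cell_first_half k s0 s1, cell_second_half l (by linarith) (by linarith), ?_⟩
    exact PentComplex.pt_eq_of_edge h (by linarith) (by linarith) (by ring) rfl rfl
  | second_half t u k l h =>
    obtain ⟨s, s0, s1⟩ := s
    refine ⟨⟨_, edgePt_mem k (s := (1 + s) / 2) (by linarith) (by linarith)⟩,
      ⟨_, edgePt_mem l (s := (1 - s) / 2) (by linarith) (by linarith)⟩,
      cell_second_half k s0 s1, cell_first_half l (by linarith) (by linarith), ?_⟩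
    exact PentComplex.pt_eq_of_edge h (by linarith) (by linarith) (by ring) rfl rfl

namespace Decoration

open PentComplex

variable {X : Type} [MulAction (DihedralGroup 5) X] (D : Decoration X)

/-- The point of `ω(L)` given by the point `q` of the tile `o` of the subdivision of `t`. -/
def subPt (L : PentComplex X) (t : L.tile) (o : Option (ZMod 5)) (q : Pent) : (D.subst L).Point :=
  (D.subst L).pt (t, o) q

theorem exists_subPt {L : PentComplex X} (y : (D.subst L).Point) :
    ∃ t o q, D.subPt L t o q = y := by
  obtain ⟨⟨t, o⟩, q, rfl⟩ := exists_pt y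
  exact ⟨t, o, q, rfl⟩

theorem substGraph_iff {L : PentComplex X} {x : L.Point} {y : (D.subst L).Point} :
    D.SubstGraph L x y ↔ ∃ (t : L.tile) (o : Option (ZMod 5)) (p q : Pent), Cell o p q ∧
      x = L.pt t p ∧ y = D.subPt L t o q := by
  constructor
  · rintro (⟨t, p, q, h⟩ | ⟨t, k, a, b, c, p, q, ha, hb, hc, habc, hp, hq⟩ |
      ⟨t, k, a, b, c, p, q, ha, hb, hc, habc, hp, hq⟩ |
      ⟨t, k, a, b, c, p, q, ha, hb, hc, habc, hp, hq⟩)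
    · exact ⟨t, none, p, q, h, rfl, rfl⟩
    · exact ⟨t, some k, p, q, ⟨a, b, c, ⟨ha, hb, hc, habc⟩, Or.inl ⟨hp, hq⟩⟩, rfl, rfl⟩
    · exact ⟨t, some k, p, q, ⟨a, b, c, ⟨ha, hb, hc, habc⟩, Or.inr (Or.inl ⟨hp, hq⟩)⟩, rfl, rfl⟩
    · exact ⟨t, some k, p, q, ⟨a, b, c, ⟨ha, hb, hc, habc⟩, Or.inr (Or.inr ⟨hp, hq⟩)⟩, rfl, rfl⟩
  · rintro ⟨t, o, p, q, h, rfl, rfl⟩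
    cases o with
    | none => exact .centre t p q h
    | some k =>
      obtain ⟨a, b, c, ⟨ha, hb, hc, habc⟩, ⟨hp, hq⟩ | ⟨hp, hq⟩ | ⟨hp, hq⟩⟩ := h
      · exact .middle t k a b c p q ha hb hc habc hp hq
      · exact .next t k a b c p q ha hb hc habc hp hq
      · exact .prev t k a b c p q ha hb hc habc hp hq

/-- The images of a point that lies in several cells agree. -/
theorem pt_eq_of_cell (L : PentComplex X) (t : L.tile) {o o' : Option (ZMod 5)} {p q q' : Pent}
    (h : Cell o p q) (h' : Cell o' p q') :
    D.subPt L t o q = D.subPt L t o' q' := by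
  have inout : ∀ {k : ZMod 5} {q q' : Pent}, Cell none p q → Cell (some k) p q' →
      D.subPt L t none q = D.subPt L t (some k) q' := by
    intro k q q' h h'
    obtain ⟨s, s0, s1, h1, h2⟩ := h.inner_outer q.2 h'
    exact pt_eq_of_edge (L := D.subst L) (SubGlue.centre_outer t k) s0 s1 rfl h1 h2
  have outout : ∀ {k : ZMod 5} {q q' : Pent}, co k p = 0 → Cell (some k) p q →
      Cell (some (k + 1)) p q' →
      D.subPt L t (some k) q = D.subPt L t (some (k + 1)) q' := by
    intro k q q' h0 h h'
    obtain ⟨s, s0, s1, h1, h2⟩ := h.outer_outer h' h0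
    exact pt_eq_of_edge (L := D.subst L) (SubGlue.outer_next t k) s0 s1 rfl h1 h2
  cases o with
  | none =>
    cases o' with
    | none => rw [Subtype.ext (h.right_unique h')]
    | some k => exact inout h h'
  | some l =>
    cases o' with
    | none => exact (inout h' h).symm
    | some k =>
      rcases sector_unique h.sector h'.sector with rfl | ⟨rfl, h0⟩ | ⟨rfl, h0⟩ | h0
      · rw [Subtype.ext (h.right_unique h')]
      · exact outout h0 h h'
      · exact (outout h0 h' h).symm
      · exact absurd h0 h.some_ne_zero

/-- The partition of the tiles is compatible with the pasting of the tiles. -/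
theorem exists_cell_edge (L : PentComplex X) {t u : L.tile} {i j : ZMod 5} (hg : L.glue t i u j)
    (s : Set.Icc (0 : ℝ) 1) : ∃ (o o' : Option (ZMod 5)) (q q' : Pent), Cell o (edgeP i s) q ∧
      Cell o' (edgeP j (revPar s)) q' ∧ D.subPt L t o q = D.subPt L u o' q' := by
  obtain ⟨s, s0, s1⟩ := s
  rcases le_total s (1 / 2) with h | h
  · refine ⟨some i, some (j + 1), ⟨_, edgePt_mem 0 (s := 2 * s) (by linarith) (by linarith)⟩,
      ⟨_, edgePt_mem 4 (s := 1 - 2 * s) (by linarith) (by linarith)⟩, ?_, ?_, ?_⟩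
    · have := cell_first_half i (r := 2 * s) (by linarith) (by linarith)
      rwa [mul_div_cancel_left₀ _ (two_ne_zero)] at this
    · have := cell_second_half j (r := 1 - 2 * s) (by linarith) (by linarith)
      rwa [show (1 + (1 - 2 * s)) / 2 = 1 - s by ring] at this
    · exact pt_eq_of_edge (L := D.subst L) (SubGlue.first_half t u i j hg) (by linarith)
        (by linarith) rfl rfl rfl
  · refine ⟨some (i + 1), some j, ⟨_, edgePt_mem 4 (s := 2 * s - 1) (by linarith) (by linarith)⟩,
      ⟨_, edgePt_mem 0 (s := 2 - 2 * s) (by linarith) (by linarith)⟩, ?_, ?_, ?_⟩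
    · have := cell_second_half i (r := 2 * s - 1) (by linarith) (by linarith)
      rwa [show (1 + (2 * s - 1)) / 2 = s by ring] at this
    · have := cell_first_half j (r := 2 - 2 * s) (by linarith) (by linarith)
      rwa [show (2 - 2 * s) / 2 = 1 - s by ring] at this
    · exact pt_eq_of_edge (L := D.subst L) (SubGlue.second_half t u i j hg) (by linarith)
        (by linarith) (by ring) rfl rfl

theorem exists_cell_transfer (L : PentComplex X) (y : (D.subst L).Point) {t u : L.tile}
    {p p' : Pent} (h : L.pt t p = L.pt u p')
    (hy : ∃ o, ∃ q : Pent, Cell o p q ∧ D.subPt L t o q = y) :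
    ∃ o, ∃ q : Pent, Cell o p' q ∧ D.subPt L u o q = y := by
  refine (pt_transfer (fun u p => ∃ o, ∃ q : Pent, Cell o p q ∧ D.subPt L u o q = y)
    (fun t' i u' j s hg => ?_) h).mp hy
  obtain ⟨o1, o2, q1, q2, c1, c2, e⟩ := D.exists_cell_edge L hg s
  constructor
  · rintro ⟨o3, q3, c3, rfl⟩
    exact ⟨o2, q2, c2, e.symm.trans (D.pt_eq_of_cell L _ c1 c3)⟩
  · rintro ⟨o3, q3, c3, rfl⟩
    exact ⟨o1, q1, c1, e.trans (D.pt_eq_of_cell L _ c2 c3)⟩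

/-- Existence holds because the cells cover the tile. For uniqueness, any image obtained in one
representative of x is obtained in every other, and images in overlapping cells of one tile agree.
-/
theorem existsUnique_substGraph (L : PentComplex X) (x : L.Point) :
    ∃! y : (D.subst L).Point, D.SubstGraph L x y := by
  obtain ⟨t, p, rfl⟩ := exists_pt x
  obtain ⟨o, q, h⟩ := exists_cell_of_left p
  refine ⟨D.subPt L t o q, (D.substGraph_iff).mpr ⟨t, o, p, q, h, rfl, rfl⟩, ?_⟩
  intro y hy
  obtain ⟨u, o', p', q', h', hx, rfl⟩ := D.substGraph_iff.mp hy
  obtain ⟨o'', q'', h'', e⟩ := D.exists_cell_transfer L (D.subPt L t o q) hx ⟨o, q, h, rfl⟩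
  rw [← e]
  exact D.pt_eq_of_cell L u h' h''

/-- The same argument in the opposite direction: each pasting of new tiles comes from a shared point
of one old tile or from a pasting of old tiles. -/
theorem existsUnique_substGraph' (L : PentComplex X) (y : (D.subst L).Point) :
    ∃! x : L.Point, D.SubstGraph L x y := by
  obtain ⟨t, o, q, rfl⟩ := D.exists_subPt y
  obtain ⟨p, h⟩ := exists_cell_of_right o q
  refine ⟨L.pt t p, (D.substGraph_iff).mpr ⟨t, o, p, q, h, rfl, rfl⟩, ?_⟩
  intro x hx
  obtain ⟨u, o', p', q', h', rfl, hy⟩ := D.substGraph_iff.mp hx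
  have key : ∃ p₁ : Pent, Cell o' p₁ q' ∧ L.pt u p₁ = L.pt t p := by
    refine (pt_transfer (L := D.subst L) (fun (a : L.tile × Option (ZMod 5)) (q : Pent) =>
      ∃ p'' : Pent, Cell a.2 p'' q ∧ L.pt a.1 p'' = L.pt t p) ?_ hy).mp ⟨p, h, rfl⟩
    rintro ⟨t1, o1⟩ i ⟨t2, o2⟩ j s hg
    obtain ⟨p1, p2, c1, c2, e⟩ := L.exists_cell_subGlue hg s
    constructor
    · rintro ⟨p3, c3, e3⟩
      rw [Subtype.ext (c3.left_unique c1)] at e3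
      exact ⟨p2, c2, e.symm.trans e3⟩
    · rintro ⟨p3, c3, e3⟩
      rw [Subtype.ext (c3.left_unique c2)] at e3
      exact ⟨p1, c1, e.trans e3⟩
  obtain ⟨p3, c3, e3⟩ := key
  rw [Subtype.ext (h'.left_unique c3), e3]

/-- The substitution of points as a function. -/
def mapFun (L : PentComplex X) (x : L.Point) : (D.subst L).Point :=
  (D.existsUnique_substGraph L x).choose

theorem substGraph_mapFun (L : PentComplex X) (x : L.Point) :
    D.SubstGraph L x (D.mapFun L x) := (D.existsUnique_substGraph L x).choose_spec.1

theorem mapFun_eq_iff {L : PentComplex X} {x : L.Point} {y : (D.subst L).Point} :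
    D.mapFun L x = y ↔ D.SubstGraph L x y :=
  ⟨fun h => h ▸ D.substGraph_mapFun L x,
    fun h => (D.existsUnique_substGraph L x).unique (D.substGraph_mapFun L x) h⟩

/-- The substitution of points. -/
def mapEquiv (L : PentComplex X) : L.Point ≃ (D.subst L).Point :=
  Equiv.ofBijective (D.mapFun L) ⟨fun x x' h =>
    (D.existsUnique_substGraph' L _).unique (D.substGraph_mapFun L x)
      (by rw [h]; exact D.substGraph_mapFun L x'), fun y => by
    obtain ⟨x, hx, -⟩ := D.existsUnique_substGraph' L y
    exact ⟨x, D.mapFun_eq_iff.mpr hx⟩⟩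

theorem mapEquiv_eq_iff {L : PentComplex X} {x : L.Point} {y : (D.subst L).Point} :
    D.mapEquiv L x = y ↔ D.SubstGraph L x y := D.mapFun_eq_iff

theorem mapEquiv_pt (L : PentComplex X) (t : L.tile) {o : Option (ZMod 5)} {p q : Pent}
    (h : Cell o p q) : D.mapEquiv L (L.pt t p) = D.subPt L t o q :=
  D.mapEquiv_eq_iff.mpr (D.substGraph_iff.mpr ⟨t, o, p, q, h, rfl, rfl⟩)

theorem mapEquiv_symm_pt (L : PentComplex X) (t : L.tile) {o : Option (ZMod 5)} {p q : Pent}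
    (h : Cell o p q) : (D.mapEquiv L).symm (D.subPt L t o q) = L.pt t p := by
  rw [Equiv.symm_apply_eq, D.mapEquiv_pt L t h]

/-- The substitution of points is a homeomorphism. -/
def mapHomeo (L : PentComplex X) : L.Point ≃ₜ (D.subst L).Point where
  toEquiv := D.mapEquiv L
  continuous_toFun := by
    refine continuous_iff_isClosed.mpr fun C hC => isClosed_iff.mpr fun t => ?_
    -- Restricted to a tile, the preimage is a finite union of projections of closed subsets of the
    -- compact space `Pent × Pent`.
    have h : {p | L.pt t p ∈ D.mapEquiv L ⁻¹' C} = ⋃ o : Option (ZMod 5),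
        Prod.fst '' ({a : Pent × Pent | Cell o a.1 a.2} ∩ Prod.snd ⁻¹' {q | D.subPt L t o q ∈ C}) := by
      ext p
      simp only [Set.mem_ofPred_eq, Set.mem_preimage, Set.mem_iUnion, Set.mem_image, Set.mem_inter_iff,
        Prod.exists, exists_and_right, exists_eq_right]
      constructor
      · intro h
        obtain ⟨o, q, hc⟩ := exists_cell_of_left p
        exact ⟨o, q, hc, by rwa [← D.mapEquiv_pt L t hc]⟩
      · rintro ⟨o, q, hc, h⟩
        rwa [D.mapEquiv_pt L t hc]
    have hC' := isClosed_iff.mp hC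
    change IsClosed {p | L.pt t p ∈ D.mapEquiv L ⁻¹' C}
    rw [h]
    refine isClosed_iUnion_of_finite fun o => ?_
    exact (((isClosed_cell o).inter ((hC' (t, o)).preimage continuous_snd)).isCompact.image
      continuous_fst).isClosed
  continuous_invFun := by
    refine continuous_iff_isClosed.mpr fun C hC => isClosed_iff.mpr ?_
    rintro ⟨t, o⟩
    have h : {q | D.subPt L t o q ∈ (D.mapEquiv L).symm ⁻¹' C} =
        Prod.snd '' ({a : Pent × Pent | Cell o a.1 a.2} ∩ Prod.fst ⁻¹' {p | L.pt t p ∈ C}) := by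
      ext q
      simp only [Set.mem_ofPred_eq, Set.mem_preimage, Set.mem_image, Set.mem_inter_iff,
        Prod.exists, exists_eq_right]
      constructor
      · intro h
        obtain ⟨p, hc⟩ := exists_cell_of_right o q
        exact ⟨p, hc, by rwa [← D.mapEquiv_symm_pt L t hc]⟩
      · rintro ⟨p, hc, h⟩
        rwa [D.mapEquiv_symm_pt L t hc]
    change IsClosed {q | D.subPt L t o q ∈ (D.mapEquiv L).symm ⁻¹' C}
    rw [h]
    exact (((isClosed_cell o).inter ((isClosed_iff.mp hC t).preimage continuous_fst)).isCompact.image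
      continuous_snd).isClosed

end Decoration

/-! ### Lengths of paths under the substitution of points -/

/-- A curve that is divided by finitely many closed sets, on each of which distances are controlled,
is controlled. -/
theorem exists_chain_of_cover {Z ι : Type} (P : Z → Z → ℝ → Prop)
    (trans : ∀ {x y z l m}, P x y l → P y z m → P x z (l + m)) (f : ℝ → Z) (K : ℝ)
    (A : ι → Set ℝ) (hA : ∀ i, IsClosed (A i))
    (step : ∀ i s t, s ≤ t → s ∈ A i → t ∈ A i → ∃ l ≤ K * (t - s), P (f s) (f t) l)
    (S : Finset ι) : ∀ a b, a ≤ b → Set.Icc a b ⊆ ⋃ i ∈ S, A i →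
      ∃ l ≤ K * (b - a), P (f a) (f b) l := by
  classical
  induction S using Finset.strongInduction with
  | H S ih =>
    intro a b hab hS
    obtain ⟨i, hi, hai⟩ := Set.mem_iUnion₂.mp (hS (Set.left_mem_Icc.mpr hab))
    have hc : IsCompact (A i ∩ Set.Icc a b) := isCompact_Icc.inter_left (hA i)
    have hu := hc.sSup_mem ⟨a, hai, Set.left_mem_Icc.mpr hab⟩
    set u := sSup (A i ∩ Set.Icc a b) with hudef
    obtain ⟨l, hl, hP⟩ := step i a u hu.2.1 hai hu.1
    rcases hu.2.2.eq_or_lt with h | h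
    · rw [h] at hl hP
      exact ⟨l, hl, hP⟩
    -- After the last parameter u in `A i` only the other sets occur; since they are closed, they
    -- also contain u itself. The induction can therefore drop i.
    · have hsub : Set.Icc u b ⊆ ⋃ j ∈ S.erase i, A j := by
        rw [← closure_Ioc h.ne]
        refine closure_minimal ?_ ((S.erase i).finite_toSet.isClosed_biUnion fun j _ => hA j)
        intro s hs
        obtain ⟨j, hj, hsj⟩ := Set.mem_iUnion₂.mp (hS ⟨hu.2.1.trans hs.1.le, hs.2⟩)
        refine Set.mem_iUnion₂.mpr ⟨j, Finset.mem_erase.mpr ⟨?_, hj⟩, hsj⟩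
        rintro rfl
        exact absurd (le_csSup hc.bddAbove ⟨hsj, hu.2.1.trans hs.1.le, hs.2⟩) (not_le.mpr hs.1)
      obtain ⟨m, hm, hP'⟩ := ih _ (Finset.erase_ssubset hi) u b h.le hsub
      exact ⟨l + m, by linarith, trans hP hP'⟩

/-- The segment between two points of the pentagon, with constant continuation. -/
def segment (p q : Pent) (s : ℝ) : Pent :=
  ⟨AffineMap.lineMap (p : ℂ) (q : ℂ) (Set.projIcc (0 : ℝ) 1 zero_le_one s : ℝ),
    convex_pentagon.segment_subset p.2 q.2 (by
      rw [segment_eq_image_lineMap]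
      exact ⟨_, (Set.projIcc (0 : ℝ) 1 zero_le_one s).2, rfl⟩)⟩

theorem segment_zero (p q : Pent) : segment p q 0 = p := by
  apply Subtype.ext
  simp [segment]

theorem segment_one (p q : Pent) : segment p q 1 = q := by
  apply Subtype.ext
  simp [segment]

theorem continuous_segment (p q : Pent) : Continuous (segment p q) := by
  unfold segment
  refine Continuous.subtype_mk ?_ _
  exact AffineMap.lineMap_continuous.comp (continuous_subtype_val.comp continuous_projIcc)

theorem dist_segment_le (p q : Pent) {s t : ℝ} (h : s ≤ t) :
    dist (segment p q s) (segment p q t) ≤ dist p q * (t - s) := by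
  rw [Subtype.dist_eq, Subtype.dist_eq]
  simp only [segment]
  rw [dist_lineMap_lineMap, mul_comm, Real.dist_eq]
  gcongr
  have := Set.abs_projIcc_sub_projIcc (α := ℝ) (a := 0) (b := 1) (c := s) (d := t) zero_le_one
  refine this.trans ?_
  rw [abs_sub_comm, abs_of_nonneg (by linarith)]

namespace Decoration

open PentComplex

variable {X : Type} [MulAction (DihedralGroup 5) X] (D : Decoration X)

/-- A segment of an old tile may cross several cells, and the map is controlled on one cell at a
time, so the segment is cut where it changes cells. -/
theorem exists_path_map_segment (L : PentComplex X) (t : L.tile) (p q : Pent) :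
    ∃ l ≤ lipConst * dist p q, (D.subst L).PathLength (D.mapEquiv L (L.pt t p))
      (D.mapEquiv L (L.pt t q)) l := by
  have h := exists_chain_of_cover (Z := (D.subst L).Point)
    (fun x y l => (D.subst L).PathLength x y l) (fun h h' => h.append h')
    (fun s => D.mapEquiv L (L.pt t (segment p q s))) (lipConst * dist p q)
    (fun o : Option (ZMod 5) => {s | ∃ q' : Pent, Cell o (segment p q s) q'}) ?_ ?_
    Finset.univ 0 1 zero_le_one ?_
  · simpa only [segment_zero, segment_one, sub_zero, mul_one] using h
  · intro o
    have h : IsClosed {p : Pent | ∃ q' : Pent, Cell o p q'} := by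
      have := ((isClosed_cell o).isCompact.image continuous_fst).isClosed
      convert this using 1
      ext p
      simp
    exact h.preimage (continuous_segment p q)
  · rintro o s s' hs ⟨q1, h1⟩ ⟨q2, h2⟩
    refine ⟨dist q1 q2, ?_, ?_⟩
    · refine (h1.dist_right_le h2).trans ?_
      rw [mul_assoc]
      exact mul_le_mul_of_nonneg_left (dist_segment_le p q hs) lipConst_pos.le
    · rw [D.mapEquiv_pt L t h1, D.mapEquiv_pt L t h2]
      exact .single (D.subst L) (t, o) q1 q2
  · intro s _
    obtain ⟨o, q', h⟩ := exists_cell_of_left (segment p q s)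
    exact Set.mem_iUnion₂.mpr ⟨o, Finset.mem_univ _, q', h⟩

theorem exists_path_map {L : PentComplex X} {x y : L.Point} {l : ℝ} (h : L.PathLength x y l) :
    ∃ m ≤ lipConst * l, (D.subst L).PathLength (D.mapEquiv L x) (D.mapEquiv L y) m := by
  induction h with
  | nil x => exact ⟨0, by simp, .nil _⟩
  | cons t p q y l _ ih =>
    obtain ⟨m, hm, h⟩ := ih
    obtain ⟨m', hm', h'⟩ := D.exists_path_map_segment L t p q
    exact ⟨m' + m, by rw [mul_add]; linarith, h'.append h⟩

/-- No cutting is needed in this direction: a segment of a new tile has both ends in one cell, so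
their preimages are joined by one segment in the old tile. -/
theorem exists_path_map_symm {L : PentComplex X} {x y : (D.subst L).Point} {l : ℝ}
    (h : (D.subst L).PathLength x y l) : ∃ m ≤ lipConst * l,
      L.PathLength ((D.mapEquiv L).symm x) ((D.mapEquiv L).symm y) m := by
  induction h with
  | nil x => exact ⟨0, by simp, .nil _⟩
  | cons t p q y l _ ih =>
    obtain ⟨m, hm, h⟩ := ih
    obtain ⟨t, o⟩ := t
    obtain ⟨p', hp⟩ := exists_cell_of_right o p
    obtain ⟨q', hq⟩ := exists_cell_of_right o q
    change L.PathLength ((D.mapEquiv L).symm (D.subPt L t o q)) _ _ at h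
    change ∃ m, _ ∧ L.PathLength ((D.mapEquiv L).symm (D.subPt L t o p)) _ _
    rw [D.mapEquiv_symm_pt L t hq] at h
    rw [D.mapEquiv_symm_pt L t hp]
    have := hp.dist_left_le hq
    exact ⟨_, by rw [mul_add]; linarith, (PathLength.single L t p' q').append h⟩

theorem isJoined_subst {L : PentComplex X} (hL : L.IsJoined) : (D.subst L).IsJoined := by
  intro x y
  obtain ⟨l, hl⟩ := hL ((D.mapEquiv L).symm x) ((D.mapEquiv L).symm y)
  obtain ⟨m, -, h⟩ := D.exists_path_map hl
  rw [Equiv.apply_symm_apply, Equiv.apply_symm_apply] at h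
  exact ⟨m, h⟩

theorem pathDist_map_le {L : PentComplex X} (hL : L.IsJoined) (x y : L.Point) :
    (D.subst L).pathDist (D.mapEquiv L x) (D.mapEquiv L y) ≤ lipConst * L.pathDist x y := by
  refine le_of_forall_pos_le_add fun ε hε => ?_
  obtain ⟨l, hl, h⟩ := hL.exists_path (show L.pathDist x y < L.pathDist x y + ε / lipConst by
    have := div_pos hε lipConst_pos; linarith)
  obtain ⟨m, hm, h'⟩ := D.exists_path_map h
  have h1 := mul_lt_mul_of_pos_left hl lipConst_pos
  rw [mul_add, mul_div_cancel₀ _ lipConst_pos.ne'] at h1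
  linarith [pathDist_le h']

theorem pathDist_le_map {L : PentComplex X} (hL : L.IsJoined) (x y : L.Point) :
    L.pathDist x y ≤ lipConst * (D.subst L).pathDist (D.mapEquiv L x) (D.mapEquiv L y) := by
  refine le_of_forall_pos_le_add fun ε hε => ?_
  obtain ⟨l, hl, h⟩ := (D.isJoined_subst hL).exists_path (show (D.subst L).pathDist
    (D.mapEquiv L x) (D.mapEquiv L y) < (D.subst L).pathDist (D.mapEquiv L x) (D.mapEquiv L y)
      + ε / lipConst by have := div_pos hε lipConst_pos; linarith)
  obtain ⟨m, hm, h'⟩ := D.exists_path_map_symm h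
  rw [Equiv.symm_apply_apply, Equiv.symm_apply_apply] at h'
  have h1 := mul_lt_mul_of_pos_left hl lipConst_pos
  rw [mul_add, mul_div_cancel₀ _ lipConst_pos.ne'] at h1
  linarith [pathDist_le h']

end Decoration

/-! ### Maps of pasting relations -/

theorem symIdx_one (k : ZMod 5) : symIdx 1 k = k := zero_add k

theorem symIdx_mul (g h : DihedralGroup 5) (k : ZMod 5) :
    symIdx (g * h) k = symIdx g (symIdx h k) := by
  rcases g with i | i <;> rcases h with j | j <;>
    simp only [DihedralGroup.r_mul_r, DihedralGroup.r_mul_sr, DihedralGroup.sr_mul_r,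
      DihedralGroup.sr_mul_sr, symIdx] <;> ring

theorem symIdx_surjective (g : DihedralGroup 5) : Function.Surjective (symIdx g) := fun k =>
  ⟨symIdx g⁻¹ k, by rw [← symIdx_mul, mul_inv_cancel, symIdx_one]⟩

theorem symIdx_injective (g : DihedralGroup 5) : Function.Injective (symIdx g) := fun k l h => by
  have := congrArg (symIdx g⁻¹) h
  rwa [← symIdx_mul, ← symIdx_mul, inv_mul_cancel, symIdx_one, symIdx_one] at this

theorem edgeIdx_surjective (g : DihedralGroup 5) : Function.Surjective (edgeIdx g) := by
  rcases g with i | i <;> intro k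
  · exact ⟨k - i, by simp only [edgeIdx]; ring⟩
  · exact ⟨-i - k - 1, by simp only [edgeIdx]; ring⟩

/-- A map of tiles together with positions of the images that preserves the pasting and the
orientation on the tiles in `S`. -/
structure IndexMap {T T' : Type} (G : T → ZMod 5 → T → ZMod 5 → Prop)
    (G' : T' → ZMod 5 → T' → ZMod 5 → Prop) (S : Set T) (f : T → T') (g : T → DihedralGroup 5) :
    Prop where
  inj : Set.InjOn f S
  glue : ∀ {t i u j}, t ∈ S → u ∈ S → G t i u j →
    G' (f t) (edgeIdx (g t) i) (f u) (edgeIdx (g u) j)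
  isRefl_iff : ∀ {t i u j}, t ∈ S → u ∈ S → G t i u j → (isRefl (g t) ↔ isRefl (g u))

/-! ### The neighbour across each edge of a subdivided complex -/

section SubGlue

variable {T : Type} {G : T → ZMod 5 → T → ZMod 5 → Prop}

theorem subGlue_none {t : T} {i j : ZMod 5} {b : T × Option (ZMod 5)}
    (h : SubGlue G (t, none) i b j) : b = (t, some (i - 2)) ∧ j = 2 := by
  generalize ha : (t, (none : Option (ZMod 5))) = a at h
  cases h with
  | centre_outer t k => obtain ⟨rfl, -⟩ := Prod.mk.inj ha; simp
  | _ => simp at ha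

theorem subGlue_zero {t : T} {k j : ZMod 5} {b : T × Option (ZMod 5)}
    (h : SubGlue G (t, some k) 0 b j) : ∃ u l, G t k u l ∧ b = (u, some (l + 1)) ∧ j = 4 := by
  generalize ha : (t, some k) = a at h
  generalize hi : (0 : ZMod 5) = i at h
  cases h with
  | centre_outer t k => simp at ha
  | first_half t u k l h =>
    obtain ⟨rfl, h2⟩ := Prod.mk.inj ha
    obtain rfl := Option.some.inj h2
    exact ⟨u, l, h, rfl, rfl⟩
  | _ => exact absurd hi (by decide)

theorem subGlue_one {t : T} {k j : ZMod 5} {b : T × Option (ZMod 5)}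
    (h : SubGlue G (t, some k) 1 b j) : b = (t, some (k + 1)) ∧ j = 3 := by
  generalize ha : (t, some k) = a at h
  generalize hi : (1 : ZMod 5) = i at h
  cases h with
  | centre_outer t k => simp at ha
  | outer_next t k =>
    obtain ⟨rfl, h2⟩ := Prod.mk.inj ha
    obtain rfl := Option.some.inj h2
    exact ⟨rfl, rfl⟩
  | _ => exact absurd hi (by decide)

theorem subGlue_two {t : T} {k j : ZMod 5} {b : T × Option (ZMod 5)}
    (h : SubGlue G (t, some k) 2 b j) : b = (t, none) ∧ j = k + 2 := by
  generalize ha : (t, some k) = a at h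
  generalize hi : (2 : ZMod 5) = i at h
  cases h with
  | centre_outer t k => simp at ha
  | outer_centre t k =>
    obtain ⟨rfl, h2⟩ := Prod.mk.inj ha
    obtain rfl := Option.some.inj h2
    exact ⟨rfl, rfl⟩
  | _ => exact absurd hi (by decide)

theorem subGlue_three {t : T} {k j : ZMod 5} {b : T × Option (ZMod 5)}
    (h : SubGlue G (t, some k) 3 b j) : b = (t, some (k - 1)) ∧ j = 1 := by
  generalize ha : (t, some k) = a at h
  generalize hi : (3 : ZMod 5) = i at h
  cases h with
  | centre_outer t k => simp at ha
  | outer_prev t k =>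
    obtain ⟨rfl, h2⟩ := Prod.mk.inj ha
    obtain rfl := Option.some.inj h2
    rw [add_sub_cancel_right]
    exact ⟨rfl, rfl⟩
  | _ => exact absurd hi (by decide)

theorem subGlue_four {t : T} {k j : ZMod 5} {b : T × Option (ZMod 5)}
    (h : SubGlue G (t, some k) 4 b j) : ∃ u l, G t (k - 1) u l ∧ b = (u, some l) ∧ j = 0 := by
  generalize ha : (t, some k) = a at h
  generalize hi : (4 : ZMod 5) = i at h
  cases h with
  | centre_outer t k => simp at ha
  | second_half t u k l h =>
    obtain ⟨rfl, h2⟩ := Prod.mk.inj ha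
    obtain rfl := Option.some.inj h2
    rw [add_sub_cancel_right]
    exact ⟨u, l, h, rfl, rfl⟩
  | _ => exact absurd hi (by decide)

theorem SubGlue.none_some (t : T) (i : ZMod 5) : SubGlue G (t, none) i (t, some (i - 2)) 2 := by
  have := SubGlue.centre_outer (G := G) t (i - 2)
  rwa [sub_add_cancel] at this

theorem SubGlue.some_none (t : T) (i : ZMod 5) : SubGlue G (t, some (i - 2)) 2 (t, none) i := by
  have := SubGlue.outer_centre (G := G) t (i - 2)
  rwa [sub_add_cancel] at this

theorem SubGlue.some_pred (t : T) (k : ZMod 5) :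
    SubGlue G (t, some k) 3 (t, some (k - 1)) 1 := by
  have := SubGlue.outer_prev (G := G) t (k - 1)
  rwa [sub_add_cancel] at this

theorem SubGlue.pred_some (t : T) (k : ZMod 5) :
    SubGlue G (t, some (k - 1)) 1 (t, some k) 3 := by
  have := SubGlue.outer_next (G := G) t (k - 1)
  rwa [sub_add_cancel] at this

end SubGlue

/-! ### Recognition of subdivided tiles -/

section Recognition

variable {T T' : Type} {G : T → ZMod 5 → T → ZMod 5 → Prop}
  {G' : T' → ZMod 5 → T' → ZMod 5 → Prop}

/-- The tile at the end of a cyclic sequence of three tiles about each of its vertices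
is a central tile. -/
theorem IndexMap.fst_none {S : Set (T × Option (ZMod 5))}
    {f : T × Option (ZMod 5) → T' × Option (ZMod 5)} {g : T × Option (ZMod 5) → DihedralGroup 5}
    (h : IndexMap (SubGlue G) (SubGlue G') S f g) {t : T} (ht : ∀ o, (t, o) ∈ S) :
    ∃ t', f (t, none) = (t', none) := by
  rcases hf : f (t, none) with ⟨t', _ | k⟩
  · exact ⟨t', rfl⟩
  -- If the image were an outer tile, consider its corner between edges 0 and 1, the midpoint of an
  -- old edge. The three tiles about the corresponding corner of the central tile would have images
  -- closing up after three steps, whereas the way round returns across edge 1 from an edge 0, and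
  -- edge 1 is pasted only to an edge 3. The rotation and reflection cases are mirror images.
  exfalso
  rcases hg : g (t, none) with a | a
  · obtain ⟨i, hi⟩ := edgeIdx_surjective (.r a) 1
    have hi' : edgeIdx (.r a) (i - 1) = 0 := by
      simp only [edgeIdx] at hi ⊢
      linear_combination hi
    have g1 := h.glue (ht _) (ht _) (SubGlue.none_some t i)
    have r1 := h.isRefl_iff (ht _) (ht _) (SubGlue.none_some t i)
    have g2 := h.glue (ht _) (ht _) (SubGlue.some_pred t (i - 2))
    have r2 := h.isRefl_iff (ht _) (ht _) (SubGlue.some_pred t (i - 2))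
    have g3 := h.glue (ht _) (ht _) (SubGlue.some_none t (i - 1))
    rw [show i - 1 - 2 = i - 2 - 1 by ring, hf, hg, hi'] at g3
    rw [hf, hg, hi] at g1
    obtain ⟨e1, e2⟩ := subGlue_one g1
    rw [hg] at r1
    rcases hg1 : g (t, some (i - 2)) with b | b
    · rw [hg1] at g2 e2 r2
      simp only [edgeIdx] at e2 g2
      rw [e1, show b + 3 = 4 by linear_combination e2] at g2
      obtain ⟨u, l, -, e3, e4⟩ := subGlue_four g2
      rcases hg2 : g (t, some (i - 2 - 1)) with c | c
      · rw [hg2] at e4 g3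
        simp only [edgeIdx] at e4 g3
        rw [e3, show c + 2 = 1 by linear_combination e4] at g3
        exact absurd (subGlue_one g3).2 (by decide)
      · rw [hg2] at r2
        exact r2.mpr trivial
    · rw [hg1] at r1
      exact r1.mpr trivial
  · obtain ⟨i, hi⟩ := edgeIdx_surjective (.sr a) 0
    have hi' : edgeIdx (.sr a) (i - 1) = 1 := by
      simp only [edgeIdx] at hi ⊢
      linear_combination hi
    have g1 := h.glue (ht _) (ht _) (SubGlue.none_some t (i - 1))
    have r1 := h.isRefl_iff (ht _) (ht _) (SubGlue.none_some t (i - 1))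
    have g2 := h.glue (ht _) (ht _) (SubGlue.pred_some t (i - 2))
    have r2 := h.isRefl_iff (ht _) (ht _) (SubGlue.pred_some t (i - 2))
    have g3 := h.glue (ht _) (ht _) (SubGlue.some_none t i)
    rw [show i - 1 - 2 = i - 2 - 1 by ring] at g1 r1
    rw [hf, hg, hi'] at g1
    rw [hf, hg, hi] at g3
    obtain ⟨e1, e2⟩ := subGlue_one g1
    rw [hg] at r1
    rcases hg1 : g (t, some (i - 2 - 1)) with b | b
    · rw [hg1] at r1
      exact r1.mp trivial
    · rw [hg1] at g2 e2 r2
      simp only [edgeIdx] at e2 g2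
      rw [e1, show -b - 1 - 1 = 4 by linear_combination e2] at g2
      obtain ⟨u, l, -, e3, e4⟩ := subGlue_four g2
      rcases hg2 : g (t, some (i - 2)) with c | c
      · rw [hg2] at r2
        exact r2.mp trivial
      · rw [hg2] at e4 g3
        simp only [edgeIdx] at e4 g3
        rw [e3, show -c - 2 - 1 = 1 by linear_combination e4] at g3
        exact absurd (subGlue_one g3).2 (by decide)

/-- A map between subdivisions carries subdivided tiles to subdivided tiles. -/
theorem IndexMap.recognition {S : Set (T × Option (ZMod 5))}
    {f : T × Option (ZMod 5) → T' × Option (ZMod 5)} {g : T × Option (ZMod 5) → DihedralGroup 5}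
    (h : IndexMap (SubGlue G) (SubGlue G') S f g) {t : T} (ht : ∀ o, (t, o) ∈ S) :
    ∃ t', ∀ o, f (t, o) = (t', cellIdx (g (t, none)) o) ∧ g (t, o) = cellSym (g (t, none)) o := by
  obtain ⟨t', hf⟩ := h.fst_none ht
  refine ⟨t', fun o => ?_⟩
  cases o with
  | none => exact ⟨hf, rfl⟩
  | some k =>
    have g1 := h.glue (ht _) (ht _) (SubGlue.centre_outer t k)
    have r1 := h.isRefl_iff (ht _) (ht _) (SubGlue.centre_outer t k)
    rw [hf] at g1
    obtain ⟨e1, e2⟩ := subGlue_none g1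
    rw [e1]
    rcases hg : g (t, none) with a | a <;> rcases hg1 : g (t, some k) with b | b <;>
      rw [hg, hg1] at r1 <;> rw [hg1] at e2 <;> simp only [edgeIdx] at e2
    · obtain rfl : b = 0 := by linear_combination e2
      refine ⟨?_, rfl⟩
      simp only [cellIdx, Option.map_some, symIdx, edgeIdx]
      congr 2; ring
    · exact absurd (r1.mpr trivial) id
    · exact absurd (r1.mp trivial) id
    · obtain rfl : b = 0 := by linear_combination -e2 - zmod5_eqs.2.2
      refine ⟨?_, rfl⟩
      simp only [cellIdx, Option.map_some, symIdx, edgeIdx]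
      congr 2
      linear_combination -zmod5_eqs.2.2

end Recognition

theorem PentComplex.pt_mem_support {X : Type} {L : PentComplex X} {S : Set L.tile} {t : L.tile}
    (ht : t ∈ S) (p : Pent) :
    L.pt t p ∈ L.support S := ⟨t, ht, p, rfl⟩

namespace Decoration

open PentComplex

variable {X : Type} [MulAction (DihedralGroup 5) X] (D : Decoration X)

/-! ### Decorations that agree after some substitutions -/

/-- The decorated pentagons `x` and `y` have the same `n`-th substitution. -/
def Eqv : ℕ → X → X → Prop
  | 0, x, y => x = y
  | n + 1, x, y => Eqv n (D.centre x) (D.centre y) ∧ ∀ k, Eqv n (D.outer x k) (D.outer y k)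

variable {D}

theorem Eqv.refl (n : ℕ) (x : X) : D.Eqv n x x := by
  induction n generalizing x with
  | zero => rfl
  | succ n ih => exact ⟨ih _, fun _ => ih _⟩

theorem Eqv.symm {n : ℕ} {x y : X} (h : D.Eqv n x y) : D.Eqv n y x := by
  induction n generalizing x y with
  | zero => exact Eq.symm h
  | succ n ih => exact ⟨ih h.1, fun k => ih (h.2 k)⟩

theorem Eqv.trans {n : ℕ} {x y z : X} (h : D.Eqv n x y) (h' : D.Eqv n y z) : D.Eqv n x z := by
  induction n generalizing x y z with
  | zero => exact Eq.trans h h'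
  | succ n ih => exact ⟨ih h.1 h'.1, fun k => ih (h.2 k) (h'.2 k)⟩

theorem Eqv.smul {n : ℕ} {x y : X} (h : D.Eqv n x y) (g : DihedralGroup 5) :
    D.Eqv n (g • x) (g • y) := by
  induction n generalizing x y g with
  | zero => exact congrArg (g • ·) h
  | succ n ih =>
    refine ⟨?_, fun k => ?_⟩
    · rw [D.centre_smul, D.centre_smul]
      exact ih h.1 g
    · obtain ⟨k, rfl⟩ := symIdx_surjective g k
      rw [D.outer_smul, D.outer_smul]
      exact ih (h.2 k) _

theorem Eqv.succ {n : ℕ} {x y : X} (h : D.Eqv n x y) : D.Eqv (n + 1) x y := by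
  induction n generalizing x y with
  | zero =>
    obtain rfl : x = y := h
    exact Eqv.refl 1 x
  | succ n ih => exact ⟨ih h.1, fun k => ih (h.2 k)⟩

theorem Eqv.mono {m n : ℕ} (hmn : m ≤ n) {x y : X} (h : D.Eqv m x y) : D.Eqv n x y := by
  induction hmn with
  | refl => exact h
  | step _ ih => exact ih.succ

variable (D) in
-- These relations increase with n, and there are only finitely many relations on a finite set. This
-- is where finiteness of the set of decorations enters.
theorem exists_eqv_stable [Finite X] : ∃ N, ∀ x y, D.Eqv (N + 1) x y → D.Eqv N x y := by
  have hmono : Monotone (fun n => {a : X × X | D.Eqv n a.1 a.2}) := fun m n hmn a h => h.mono hmn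
  obtain ⟨N, hN⟩ := WellFoundedGT.monotone_chain_condition ⟨_, hmono⟩
  refine ⟨N, fun x y h => ?_⟩
  have : (x, y) ∈ {a : X × X | D.Eqv N a.1 a.2} := by
    have e := hN (N + 1) (Nat.le_succ N)
    change {a : X × X | D.Eqv N a.1 a.2} = {a : X × X | D.Eqv (N + 1) a.1 a.2} at e
    rw [e]
    exact h
  exact this

variable (D)

/-! ### Maps that preserve tiles -/

/-- On the tile `t`, the map `φ` is an isometry onto a tile of `L'` that preserves the decoration
up to `n` substitutions. -/
def TileMap (n : ℕ) (L L' : PentComplex X) (φ : L.Point → L'.Point) (t : L.tile) : Prop :=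
  ∃ (t' : L'.tile) (g : DihedralGroup 5), D.Eqv n (L'.deco t') (g • L.deco t) ∧
    ∀ p : Pent, φ (L.pt t p) = L'.pt t' (symP g p)

/-- An injective map on the union of the tiles in `S` that maps tiles to tiles. -/
structure PatchMap (n : ℕ) (L L' : PentComplex X) (φ : L.Point → L'.Point) (S : Set L.tile) :
    Prop where
  inj : Set.InjOn φ (L.support S)
  tile : ∀ t ∈ S, D.TileMap n L L' φ t

variable {D}

theorem TileMap.mono {m n : ℕ} (hmn : m ≤ n) {L L' : PentComplex X} {φ : L.Point → L'.Point}
    {t : L.tile} (h : D.TileMap m L L' φ t) : D.TileMap n L L' φ t := by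
  obtain ⟨t', g, hd, h⟩ := h
  exact ⟨t', g, hd.mono hmn, h⟩

theorem TileMap.comp {n : ℕ} {L L' L'' : PentComplex X} {φ : L.Point → L'.Point}
    {ψ : L'.Point → L''.Point} {t : L.tile} (h : D.TileMap n L L' φ t)
    (h' : ∀ t', φ (L.pt t centreP) = L'.pt t' centreP → D.TileMap n L' L'' ψ t') :
    D.TileMap n L L'' (ψ ∘ φ) t := by
  obtain ⟨t', g, hd, h⟩ := h
  obtain ⟨t'', g', hd', h''⟩ := h' t' (by rw [h, symP_centreP])
  refine ⟨t'', g' * g, ?_, fun p => ?_⟩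
  · rw [mul_smul]
    exact hd'.trans (hd.smul g')
  · rw [Function.comp_apply, h, h'', symP_mul]

theorem PatchMap.mono {m n : ℕ} (hmn : m ≤ n) {L L' : PentComplex X} {φ : L.Point → L'.Point}
    {S S' : Set L.tile} (hS : S' ⊆ S) (h : D.PatchMap m L L' φ S) : D.PatchMap n L L' φ S' where
  inj := h.inj.mono (by rintro _ ⟨t, ht, hp⟩; exact ⟨t, hS ht, hp⟩)
  tile t ht := (h.tile t (hS ht)).mono hmn

theorem PatchMap.comp {n : ℕ} {L L' L'' : PentComplex X} {φ : L.Point → L'.Point}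
    {ψ : L'.Point → L''.Point} {S : Set L.tile} {S' : Set L'.tile} (h : D.PatchMap n L L' φ S)
    (h' : D.PatchMap n L' L'' ψ S')
    (hS : ∀ t ∈ S, ∀ t', φ (L.pt t centreP) = L'.pt t' centreP → t' ∈ S') :
    D.PatchMap n L L'' (ψ ∘ φ) S where
  inj := by
    refine h'.inj.comp h.inj ?_
    rintro _ ⟨t, ht, p, rfl⟩
    obtain ⟨t', g, -, e⟩ := h.tile t ht
    rw [e]
    exact pt_mem_support (hS t ht t' (by rw [e, symP_centreP])) _
  tile t ht := (h.tile t ht).comp fun t' e => h'.tile t' (hS t ht t' e)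

/-- The inverse of a map of patches. -/
theorem PatchMap.exists_inverse {n : ℕ} {L L' : PentComplex X} {φ : L.Point → L'.Point}
    {S : Set L.tile} [Nonempty L.Point] (h : D.PatchMap n L L' φ S) :
    ∃ ψ, D.PatchMap n L' L ψ {t' | ∃ t ∈ S, φ (L.pt t centreP) = L'.pt t' centreP} ∧
      ∀ x ∈ L.support S, ψ (φ x) = x := by
  have hinv : ∀ x ∈ L.support S, Function.invFunOn φ (L.support S) (φ x) = x :=
    fun x hx => h.inj.leftInvOn_invFunOn hx
  have key : ∀ t' ∈ {t' | ∃ t ∈ S, φ (L.pt t centreP) = L'.pt t' centreP},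
      ∃ t ∈ S, ∃ g, D.Eqv n (L'.deco t') (g • L.deco t) ∧
        ∀ p : Pent, φ (L.pt t p) = L'.pt t' (symP g p) := by
    rintro t' ⟨t, ht, e⟩
    obtain ⟨t'', g, hd, h⟩ := h.tile t ht
    rw [h, symP_centreP] at e
    obtain ⟨rfl, -⟩ := pt_eq_centre e
    exact ⟨t, ht, g, hd, h⟩
  refine ⟨Function.invFunOn φ (L.support S), ⟨?_, ?_⟩, hinv⟩
  · refine Set.LeftInvOn.injOn (f₁' := φ) ?_
    rintro _ ⟨t', ht', p, rfl⟩
    obtain ⟨t, ht, g, -, e⟩ := key t' ht'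
    have e' := e (symP g⁻¹ p)
    rw [symP_symP_inv] at e'
    rw [← e', hinv _ (pt_mem_support ht _)]
  · intro t' ht'
    obtain ⟨t, ht, g, hd, e⟩ := key t' ht'
    refine ⟨t, g⁻¹, ?_, fun p => ?_⟩
    · have := hd.symm.smul g⁻¹
      rwa [inv_smul_smul] at this
    · have e' := e (symP g⁻¹ p)
      rw [symP_symP_inv] at e'
      rw [← e', hinv _ (pt_mem_support ht _)]

/-! #### From maps of points to maps of pasting relations -/

/-- The effect of a symmetry on the parameter along an edge. -/
theorem symP_edgeP (g : DihedralGroup 5) (k : ZMod 5) (s : Set.Icc (0 : ℝ) 1) :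
    ∃ s' : Set.Icc (0 : ℝ) 1, (s' : ℝ) = edgePar g s ∧
      symP g (edgeP k s) = edgeP (edgeIdx g k) s' := by
  rcases g with i | i
  · exact ⟨s, rfl, Subtype.ext (sym_edgePt (.r i) k s)⟩
  · exact ⟨revPar s, rfl, Subtype.ext (sym_edgePt (.sr i) k s)⟩

/-- A map that maps tiles to tiles and separates their centres is a map of the pasting. -/
theorem indexMap_of_tiles {L L' : PentComplex X} (hL : L.IsPasting) (hL' : L'.IsPasting)
    {φ : L.Point → L'.Point} {S : Set L.tile} {f : L.tile → L'.tile}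
    {g : L.tile → DihedralGroup 5} (hf : ∀ t ∈ S, ∀ p, φ (L.pt t p) = L'.pt (f t) (symP (g t) p))
    (hinj : ∀ t ∈ S, ∀ u ∈ S, φ (L.pt t centreP) = φ (L.pt u centreP) → t = u) :
    IndexMap L.glue L'.glue S f g := by
  have inj : Set.InjOn f S := by
    intro t ht u hu e
    refine hinj t ht u hu ?_
    rw [hf t ht, hf u hu, e, symP_centreP, symP_centreP]
  have key : ∀ {t i u j}, t ∈ S → u ∈ S → L.glue t i u j →
      L'.glue (f t) (edgeIdx (g t) i) (f u) (edgeIdx (g u) j) ∧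
        (isRefl (g t) ↔ isRefl (g u)) := by
    intro t i u j ht hu hg
    classical
    -- Any interior parameter other than 1/2 would do: its reversal is different, so the direction
    -- of the edge is visible in the image.
    let s : Set.Icc (0 : ℝ) 1 := ⟨1 / 4, by norm_num, by norm_num⟩
    have e := congrArg φ (pt_edgeP hg s)
    obtain ⟨s1, hs1, e1⟩ := symP_edgeP (g t) i s
    obtain ⟨s2, hs2, e2⟩ := symP_edgeP (g u) j (revPar s)
    rw [hf t ht, hf u hu, e1, e2] at e
    have hr1 : (s1 : ℝ) = if isRefl (g t) then 3 / 4 else 1 / 4 := by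
      rw [hs1]; rcases g t with a | a <;> simp [isRefl, edgePar, s]; norm_num
    have hr2 : (s2 : ℝ) = if isRefl (g u) then 1 / 4 else 3 / 4 := by
      rw [hs2]; rcases g u with a | a <;> simp [isRefl, edgePar, s, revPar]; norm_num
    have hp : 0 < (s1 : ℝ) ∧ (s1 : ℝ) < 1 := by
      rw [hr1]; split_ifs <;> norm_num
    have hp2 : 0 < (s2 : ℝ) ∧ (s2 : ℝ) < 1 := by
      rw [hr2]; split_ifs <;> norm_num
    rcases pt_eq_edge hL' hp.1 hp.2 e with ⟨h1, h2⟩ | ⟨j', h1, h2⟩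
    -- The two images would be the same point of the same tile; then the edge would be pasted to
    -- itself.
    · obtain rfl := inj hu ht h1
      rw [← e1, ← e2] at h2
      have h3 := congrArg Subtype.val (symP_injective _ h2)
      obtain ⟨rfl, -⟩ := edgePt_inj (k := j) (l := i) (s := revPar s) (s' := s)
        (by simp [s, revPar]; norm_num) (by simp [s, revPar]) h3
      exact absurd hg (hL.irrefl _ _)
    · obtain ⟨rfl, h4⟩ := edgePt_inj hp2.1 hp2.2 (congrArg Subtype.val h2)
      refine ⟨h1, ?_⟩
      change (s2 : ℝ) = 1 - s1 at h4
      rw [hr1, hr2] at h4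
      split_ifs at h4 with a b b <;> first | (simp only [a, b]; done) | (exfalso; norm_num at h4)
  exact ⟨inj, fun ht hu hg => (key ht hu hg).1, fun ht hu hg => (key ht hu hg).2⟩

theorem exists_tile_choice {n : ℕ} {L L' : PentComplex X} {φ : L.Point → L'.Point}
    {S : Set L.tile} (h : ∀ t ∈ S, D.TileMap n L L' φ t) :
    ∃ (f : L.tile → L'.tile) (g : L.tile → DihedralGroup 5), ∀ t ∈ S,
      D.Eqv n (L'.deco (f t)) (g t • L.deco t) ∧
        ∀ p, φ (L.pt t p) = L'.pt (f t) (symP (g t) p) := by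
  have : ∀ t, ∃ (t' : L'.tile) (g : DihedralGroup 5), t ∈ S → D.Eqv n (L'.deco t') (g • L.deco t) ∧
        ∀ p, φ (L.pt t p) = L'.pt t' (symP g p) := by
    intro t
    by_cases ht : t ∈ S
    · obtain ⟨t', g, h⟩ := h t ht
      exact ⟨t', g, fun _ => h⟩
    -- Outside S any tile serves; this one shows that there is one.
    · obtain ⟨t', -, -⟩ := exists_pt (φ (L.pt t centreP))
      exact ⟨t', 1, fun h => absurd h ht⟩
  choose f g h using this
  exact ⟨f, g, h⟩

theorem PatchMap.centre_inj {n : ℕ} {L L' : PentComplex X} {φ : L.Point → L'.Point}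
    {S : Set L.tile} (h : D.PatchMap n L L' φ S) :
    ∀ t ∈ S, ∀ u ∈ S, φ (L.pt t centreP) = φ (L.pt u centreP) → t = u := fun _ ht _ hu e =>
  (pt_eq_centre (h.inj (pt_mem_support ht _) (pt_mem_support hu _) e)).1.symm

/-! #### Substitution of maps -/

variable (D)

/-- The map of subdivided complexes induced by a map of complexes. -/
def push (L L' : PentComplex X) (φ : L.Point → L'.Point) :
    (D.subst L).Point → (D.subst L').Point :=
  D.mapEquiv L' ∘ φ ∘ (D.mapEquiv L).symm

/-- The map of complexes induced by a map of the subdivided complexes. -/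
def pull (L L' : PentComplex X) (ψ : (D.subst L).Point → (D.subst L').Point) :
    L.Point → L'.Point :=
  (D.mapEquiv L').symm ∘ ψ ∘ D.mapEquiv L

/-- The tiles of the subdivision of the tiles in `S`. -/
def substSet {L : PentComplex X} (S : Set L.tile) : Set (D.subst L).tile :=
  {a : L.tile × Option (ZMod 5) | a.1 ∈ S}

variable {D}

theorem mapEquiv_mem_support {L : PentComplex X} {S : Set L.tile} {x : L.Point} :
    D.mapEquiv L x ∈ (D.subst L).support (D.substSet S) ↔ x ∈ L.support S := by
  constructor
  · rintro ⟨⟨t, o⟩, ht, q, hx⟩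
    obtain ⟨p, hc⟩ := exists_cell_of_right o q
    have hx' : D.mapEquiv L x = D.mapEquiv L (L.pt t p) := hx.trans (D.mapEquiv_pt L t hc).symm
    rw [(D.mapEquiv L).injective hx']
    exact pt_mem_support (L := L) (S := S) ht p
  · rintro ⟨t, ht, p, rfl⟩
    obtain ⟨o, q, hc⟩ := exists_cell_of_left p
    rw [D.mapEquiv_pt L t hc]
    exact pt_mem_support (L := D.subst L) (S := D.substSet S) (t := (t, o)) ht q

/-- A symmetry on a tile becomes a symmetry on each of the six new tiles because the correspondence
of cells is equivariant (`Cell.sym`). -/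
theorem push_subPt {L L' : PentComplex X} {φ : L.Point → L'.Point} {t : L.tile} {t' : L'.tile}
    {g : DihedralGroup 5} (h : ∀ p : Pent, φ (L.pt t p) = L'.pt t' (symP g p))
    (o : Option (ZMod 5)) (q : Pent) :
    D.push L L' φ (D.subPt L t o q) = D.subPt L' t' (cellIdx g o) (symP (cellSym g o) q) := by
  obtain ⟨p, hc⟩ := exists_cell_of_right o q
  rw [push, Function.comp_apply, Function.comp_apply, D.mapEquiv_symm_pt L t hc, h,
    D.mapEquiv_pt L' t' (q := symP (cellSym g o) q) (hc.sym g)]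

/-- Equivariance of the rule translates level n + 1 on a tile into level n on its six new tiles.
Hence pushing lowers the level by one and pulling raises it by one. -/
theorem eqv_subst {n : ℕ} {L L' : PentComplex X} {t : L.tile} {t' : L'.tile}
    {g : DihedralGroup 5} :
    D.Eqv (n + 1) (L'.deco t') (g • L.deco t) ↔ ∀ o, D.Eqv n ((D.subst L').deco (t', cellIdx g o))
      (cellSym g o • (D.subst L).deco (t, o)) := by
  constructor
  · rintro ⟨h1, h2⟩ o
    cases o with
    | none => rw [D.centre_smul] at h1; exact h1
    | some k =>
      have := h2 (symIdx g k)
      rw [D.outer_smul] at this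
      exact this
  · refine fun h => ⟨?_, fun k => ?_⟩
    · rw [D.centre_smul]
      exact h none
    · obtain ⟨k, rfl⟩ := symIdx_surjective g k
      rw [D.outer_smul]
      exact h (some k)

theorem TileMap.push {n : ℕ} {L L' : PentComplex X} {φ : L.Point → L'.Point} {t : L.tile}
    (h : D.TileMap (n + 1) L L' φ t) (o : Option (ZMod 5)) :
    D.TileMap n (D.subst L) (D.subst L') (D.push L L' φ) (t, o) := by
  obtain ⟨t', g, hd, h⟩ := h
  exact ⟨(t', cellIdx g o), cellSym g o, eqv_subst.mp hd o, fun q => push_subPt h o q⟩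

theorem push_injOn {L L' : PentComplex X} {φ : L.Point → L'.Point} {S : Set L.tile}
    (h : Set.InjOn φ (L.support S)) :
    Set.InjOn (D.push L L' φ) ((D.subst L).support (D.substSet S)) := by
  intro x hx y hy e
  obtain ⟨x, rfl⟩ := (D.mapEquiv L).surjective x
  obtain ⟨y, rfl⟩ := (D.mapEquiv L).surjective y
  rw [mapEquiv_mem_support] at hx hy
  simp only [Decoration.push, Function.comp_apply, Equiv.symm_apply_apply] at e
  rw [h hx hy ((D.mapEquiv L').injective e)]

theorem PatchMap.push {n : ℕ} {L L' : PentComplex X} {φ : L.Point → L'.Point} {S : Set L.tile}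
    (h : D.PatchMap (n + 1) L L' φ S) :
    D.PatchMap n (D.subst L) (D.subst L') (D.push L L' φ) (D.substSet S) where
  inj := push_injOn h.inj
  tile := fun ⟨t, o⟩ ht => (h.tile t ht).push o

theorem pull_injOn {L L' : PentComplex X} {ψ : (D.subst L).Point → (D.subst L').Point}
    {S : Set L.tile} (h : Set.InjOn ψ ((D.subst L).support (D.substSet S))) :
    Set.InjOn (D.pull L L' ψ) (L.support S) := by
  intro x hx y hy e
  have e' := (D.mapEquiv L').symm.injective e
  exact (D.mapEquiv L).injective
    (h (mapEquiv_mem_support.mpr hx) (mapEquiv_mem_support.mpr hy) e')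

theorem TileMap.pull {n : ℕ} {L L' : PentComplex X}
    {ψ : (D.subst L).Point → (D.subst L').Point} {t : L.tile} {t' : L'.tile} {g : DihedralGroup 5}
    (h : ∀ o, D.Eqv n ((D.subst L').deco (t', cellIdx g o))
        (cellSym g o • (D.subst L).deco (t, o)) ∧
      ∀ q, ψ (D.subPt L t o q) = D.subPt L' t' (cellIdx g o) (symP (cellSym g o) q)) :
    D.TileMap (n + 1) L L' (D.pull L L' ψ) t := by
  refine ⟨t', g, eqv_subst.mpr fun o => (h o).1, fun p => ?_⟩
  obtain ⟨o, q, hc⟩ := exists_cell_of_left p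
  rw [Decoration.pull, Function.comp_apply, Function.comp_apply, D.mapEquiv_pt L t hc, (h o).2,
    D.mapEquiv_symm_pt L' t' (p := symP g p) (hc.sym g)]

theorem IsPasting.subst {L : PentComplex X} (hL : L.IsPasting) : (D.subst L).IsPasting where
  symm h := by
    cases h with
    | centre_outer t k => exact .outer_centre t k
    | outer_centre t k => exact .centre_outer t k
    | outer_next t k => exact .outer_prev t k
    | outer_prev t k => exact .outer_next t k
    | first_half t u k l h => exact .second_half u t l k (hL.symm h)
    | second_half t u k l h => exact .first_half u t l k (hL.symm h)
  irrefl := by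
    rintro ⟨t, _ | k⟩ i h
    · exact absurd (Prod.mk.inj (subGlue_none h).1).2 (by simp)
    · fin_cases i
      · obtain ⟨u, l, -, -, h⟩ := subGlue_zero h
        exact absurd h (by decide : ¬ (0 : ZMod 5) = 4)
      · exact absurd (subGlue_one h).2 (by decide : ¬ (1 : ZMod 5) = 3)
      · exact absurd (Prod.mk.inj (subGlue_two h).1).2 (by simp)
      · exact absurd (subGlue_three h).2 (by decide : ¬ (3 : ZMod 5) = 1)
      · obtain ⟨u, l, -, -, h⟩ := subGlue_four h
        exact absurd h (by decide : ¬ (4 : ZMod 5) = 0)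
  unique := by
    rintro ⟨t, _ | k⟩ i u j u' j' h h'
    · obtain ⟨rfl, rfl⟩ := subGlue_none h
      obtain ⟨rfl, rfl⟩ := subGlue_none h'
      exact ⟨rfl, rfl⟩
    · fin_cases i
      · obtain ⟨u, l, h1, rfl, rfl⟩ := subGlue_zero h
        obtain ⟨u', l', h1', rfl, rfl⟩ := subGlue_zero h'
        obtain ⟨rfl, rfl⟩ := hL.unique h1 h1'
        exact ⟨rfl, rfl⟩
      · obtain ⟨rfl, rfl⟩ := subGlue_one h
        obtain ⟨rfl, rfl⟩ := subGlue_one h'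
        exact ⟨rfl, rfl⟩
      · obtain ⟨rfl, rfl⟩ := subGlue_two h
        obtain ⟨rfl, rfl⟩ := subGlue_two h'
        exact ⟨rfl, rfl⟩
      · obtain ⟨rfl, rfl⟩ := subGlue_three h
        obtain ⟨rfl, rfl⟩ := subGlue_three h'
        exact ⟨rfl, rfl⟩
      · obtain ⟨u, l, h1, rfl, rfl⟩ := subGlue_four h
        obtain ⟨u', l', h1', rfl, rfl⟩ := subGlue_four h'
        obtain ⟨rfl, rfl⟩ := hL.unique h1 h1'
        exact ⟨rfl, rfl⟩

/-- The patch contains all six new tiles of each tile of S, so recognition applies and one symmetry,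
that of the central tile, governs all six; their images then reassemble to one tile of L'. -/
theorem PatchMap.pull {n : ℕ} {L L' : PentComplex X} (hL : L.IsPasting) (hL' : L'.IsPasting)
    {ψ : (D.subst L).Point → (D.subst L').Point} {S : Set L.tile}
    (h : D.PatchMap n (D.subst L) (D.subst L') ψ (D.substSet S)) :
    D.PatchMap (n + 1) L L' (D.pull L L' ψ) S where
  inj := pull_injOn h.inj
  tile := by
    intro t ht
    obtain ⟨f, g, hfg⟩ := exists_tile_choice h.tile
    have hi := indexMap_of_tiles (IsPasting.subst hL) (IsPasting.subst hL') (fun a ha => (hfg a ha).2)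
      h.centre_inj
    obtain ⟨t', ht'⟩ := IndexMap.recognition hi (t := t) (fun _ => ht)
    refine TileMap.pull (t' := t') (g := g (t, none)) fun o => ?_
    obtain ⟨h1, h2⟩ := hfg (t, o) ht
    obtain ⟨e1, e2⟩ := ht' o
    rw [e1, e2] at h1 h2
    exact ⟨h1, h2⟩

/-! ### Isomorphisms -/

variable (D)

/-- An isomorphism of the underlying complexes that preserves the decorations up to `n`
substitutions. -/
def IsoMap (n : ℕ) (L L' : PentComplex X) (φ : L.Point ≃ L'.Point) : Prop :=
  ∀ t, D.TileMap n L L' φ t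

variable {D}

theorem IsoMap.refl (n : ℕ) (L : PentComplex X) : D.IsoMap n L L (Equiv.refl _) := fun t =>
  ⟨t, 1, by rw [one_smul]; exact Eqv.refl n _, fun p => by rw [symP_one]; rfl⟩

/-- The map is onto on tiles: a tile through the preimage of a centre is carried onto a tile
containing that centre, and a centre lies in only one tile. -/
theorem IsoMap.symm {n : ℕ} {L L' : PentComplex X} {φ : L.Point ≃ L'.Point}
    (h : D.IsoMap n L L' φ) : D.IsoMap n L' L φ.symm := by
  intro t'
  obtain ⟨t, p, e⟩ := exists_pt (φ.symm (L'.pt t' centreP))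
  obtain ⟨t'', g, hd, hp⟩ := h t
  have e' := hp p
  rw [e, Equiv.apply_symm_apply] at e'
  obtain ⟨rfl, -⟩ := pt_eq_centre e'
  refine ⟨t, g⁻¹, ?_, fun q => ?_⟩
  · have := hd.symm.smul g⁻¹
    rwa [inv_smul_smul] at this
  · rw [Equiv.symm_apply_eq, hp, symP_symP_inv]

theorem IsoMap.trans {n : ℕ} {L L' L'' : PentComplex X} {φ : L.Point ≃ L'.Point}
    {ψ : L'.Point ≃ L''.Point} (h : D.IsoMap n L L' φ) (h' : D.IsoMap n L' L'' ψ) :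
    D.IsoMap n L L'' (φ.trans ψ) := fun t =>
  (h t).comp (ψ := ψ) fun t' _ => h' t'

theorem IsoMap.mono {m n : ℕ} (hmn : m ≤ n) {L L' : PentComplex X} {φ : L.Point ≃ L'.Point}
    (h : D.IsoMap m L L' φ) : D.IsoMap n L L' φ := fun t => (h t).mono hmn

theorem IsoMap.patchMap {n : ℕ} {L L' : PentComplex X} {φ : L.Point ≃ L'.Point}
    (h : D.IsoMap n L L' φ) (S : Set L.tile) : D.PatchMap n L L' φ S :=
  ⟨φ.injective.injOn, fun t _ => h t⟩

theorem isoMap_zero_iff {L L' : PentComplex X} {φ : L.Point ≃ L'.Point} :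
    D.IsoMap 0 L L' φ ↔ L.IsIso L' φ := by
  constructor
  · refine fun h => ⟨fun t => ?_, fun t => ?_⟩
    · obtain ⟨t', g, hd, hp⟩ := h t
      exact ⟨t', g, hd, fun p _ => hp p⟩
    · obtain ⟨t', g, hd, hp⟩ := h.symm t
      exact ⟨t', g, hd, fun p _ => hp p⟩
  · intro h t
    obtain ⟨t', g, hd, hp⟩ := h.1 t
    exact ⟨t', g, hd, fun p => hp p trivial⟩

theorem IsoMap.push {n : ℕ} {L L' : PentComplex X} {φ : L.Point ≃ L'.Point}
    (h : D.IsoMap (n + 1) L L' φ) : D.IsoMap n (D.subst L) (D.subst L')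
      ((D.mapEquiv L).symm.trans (φ.trans (D.mapEquiv L'))) :=
  fun ⟨t, o⟩ => (h t).push o

theorem IsoMap.pull {n : ℕ} {L L' : PentComplex X} (hL : L.IsPasting) (hL' : L'.IsPasting)
    {ψ : (D.subst L).Point ≃ (D.subst L').Point}
    (h : D.IsoMap n (D.subst L) (D.subst L') ψ) : D.IsoMap (n + 1) L L'
      ((D.mapEquiv L).trans (ψ.trans (D.mapEquiv L').symm)) := fun t =>
  (PatchMap.pull hL hL' (h.patchMap (D.substSet Set.univ))).tile t trivial

/-! ### Local isomorphism -/

variable (D)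

/-- Local isomorphism with decorations that agree after `n` substitutions. -/
def LocIso (n : ℕ) (L K : PentComplex X) : Prop :=
  ∀ P : Set L.tile, P.Finite → ∃ φ, D.PatchMap n L K φ P

variable {D}

theorem LocIso.mono {m n : ℕ} (hmn : m ≤ n) {L K : PentComplex X} (h : D.LocIso m L K) :
    D.LocIso n L K := fun P hP => by
  obtain ⟨φ, h⟩ := h P hP
  exact ⟨φ, h.mono hmn subset_rfl⟩

theorem LocIso.trans {n : ℕ} {L L' L'' : PentComplex X} (h : D.LocIso n L L')
    (h' : D.LocIso n L' L'') : D.LocIso n L L'' := by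
  intro P hP
  obtain ⟨φ, hφ⟩ := h P hP
  obtain ⟨f, g, hfg⟩ := exists_tile_choice hφ.tile
  obtain ⟨ψ, hψ⟩ := h' (f '' P) (hP.image f)
  refine ⟨ψ ∘ φ, hφ.comp hψ fun t ht t' e => ⟨t, ht, ?_⟩⟩
  rw [(hfg t ht).2, symP_centreP] at e
  exact (pt_eq_centre e).1.symm

theorem IsoMap.locIso {n : ℕ} {L L' : PentComplex X} {φ : L.Point ≃ L'.Point}
    (h : D.IsoMap n L L' φ) : D.LocIso n L L' := fun P _ => ⟨φ, h.patchMap P⟩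

theorem locIso_zero_iff {L K : PentComplex X} : D.LocIso 0 L K ↔ L.LocallyIsoTo K := by
  refine forall₂_congr fun P _ => exists_congr fun φ => ⟨fun h => ⟨h.inj, fun t ht => ?_⟩,
    fun h => ⟨h.1, fun t ht => ?_⟩⟩
  · obtain ⟨t', g, hd, hp⟩ := h.tile t ht
    exact ⟨t', g, hd, fun p _ => hp p⟩
  · obtain ⟨t', g, hd, hp⟩ := h.2 t ht
    exact ⟨t', g, hd, fun p => hp p (pt_mem_support ht p)⟩

theorem LocIso.push {n : ℕ} {L K : PentComplex X} (h : D.LocIso (n + 1) L K) :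
    D.LocIso n (D.subst L) (D.subst K) := by
  intro P hP
  obtain ⟨φ, hφ⟩ := h (Prod.fst '' P) (hP.image _)
  exact ⟨_, hφ.push.mono le_rfl (by rintro a ha; exact ⟨a, ha, rfl⟩)⟩

theorem LocIso.pull {n : ℕ} {L K : PentComplex X} (hL : L.IsPasting) (hK : K.IsPasting)
    (h : D.LocIso n (D.subst L) (D.subst K)) : D.LocIso (n + 1) L K := by
  intro P hP
  have : (D.substSet P).Finite := by
    refine (hP.prod (Set.finite_univ (α := Option (ZMod 5)))).subset ?_
    rintro ⟨t, o⟩ ht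
    exact ⟨ht, trivial⟩
  obtain ⟨ψ, hψ⟩ := h _ this
  exact ⟨_, hψ.pull hL hK⟩

end Decoration

/-! ### The tiling `K` -/

namespace Decoration

open PentComplex

variable {X : Type} [MulAction (DihedralGroup 5) X] (D : Decoration X)

/-- The map of points induced by a map of tiles exists and is injective. -/
def IsPtEmbedding (L L' : PentComplex X) (f : L.tile → L'.tile) : Prop :=
  ∃ φ : L.Point → L'.Point, Function.Injective φ ∧ ∀ t p, φ (L.pt t p) = L'.pt (f t) p

variable {D}

theorem IsPtEmbedding.pt_eq_iff {L L' : PentComplex X} {f : L.tile → L'.tile}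
    (h : IsPtEmbedding L L' f) {t u : L.tile} {p q : Pent} :
    L'.pt (f t) p = L'.pt (f u) q ↔ L.pt t p = L.pt u q := by
  obtain ⟨φ, hi, hp⟩ := h
  rw [← hp, ← hp, hi.eq_iff]

theorem IsPtEmbedding.injective {L L' : PentComplex X} {f : L.tile → L'.tile}
    (h : IsPtEmbedding L L' f) : Function.Injective f := by
  intro t u e
  have := h.pt_eq_iff (t := t) (u := u) (p := centreP) (q := centreP)
  rw [e] at this
  exact (pt_eq_centre (this.mp rfl)).1.symm

theorem IsPtEmbedding.subst {L L' : PentComplex X} {f : L.tile → L'.tile}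
    (h : IsPtEmbedding L L' f) :
    IsPtEmbedding (D.subst L) (D.subst L') (fun a => (f a.1, a.2)) := by
  obtain ⟨φ, hi, hp⟩ := h
  refine ⟨D.push L L' φ, (D.mapEquiv L').injective.comp (hi.comp (D.mapEquiv L).symm.injective), ?_⟩
  rintro ⟨t, o⟩ q
  have := push_subPt (D := D) (g := 1) (fun p => by rw [hp, symP_one]) o q (t := t) (t' := f t)
    (φ := φ)
  refine this.trans ?_
  cases o with
  | none =>
    change D.subPt L' (f t) none (symP 1 q) = _
    rw [symP_one]
    rfl
  | some k =>
    change D.subPt L' (f t) (some (symIdx 1 k)) (symP 1 q) = _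
    rw [symP_one, symIdx_one]
    rfl

theorem pt_single_injective (x : X) (t : (single x).tile) : Function.Injective ((single x).pt t) := by
  intro p q h
  refine (pt_transfer (L := single x) (fun _ q => p = q) ?_ h).mp rfl
  intro _ _ _ _ _ h
  exact h.elim

/-- A single pentagon embeds as the central tile, since the substitution of points is injective. The
later embeddings are conjugates of this one. -/
theorem isPtEmbedding_embed (x y : X) (n : ℕ) :
    IsPtEmbedding (D.superTile x n) (D.superTile y (n + 1)) (D.embed x y n) := by
  induction n with
  | zero =>
    refine ⟨Quot.lift (fun a => D.subPt (single y) a.1 none a.2)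
      (fun _ _ h => by cases h with | mk _ _ _ _ _ _ _ h => exact h.elim), ?_, fun t p => rfl⟩
    intro a b
    obtain ⟨⟨⟨⟩, p⟩, rfl⟩ := Quot.exists_rep a
    obtain ⟨⟨⟨⟩, q⟩, rfl⟩ := Quot.exists_rep b
    intro h
    change D.subPt (single y) () none p = D.subPt (single y) () none q at h
    obtain ⟨p', hp⟩ := exists_cell_of_right none p
    obtain ⟨q', hq⟩ := exists_cell_of_right none q
    have h' := congrArg (D.mapEquiv (single y)).symm h
    have h'' := ((D.mapEquiv_symm_pt (single y) () hp).symm.trans h').trans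
      (D.mapEquiv_symm_pt (single y) () hq)
    obtain rfl := pt_single_injective y () h''
    exact congrArg ((single x).pt ()) (Subtype.ext (hp.right_unique hq))
  | succ n ih => exact ih.subst (D := D)

theorem glue_embed (x y : X) (n : ℕ) {t u : (D.superTile x n).tile} {i j : ZMod 5}
    (h : (D.superTile x n).glue t i u j) :
    (D.superTile y (n + 1)).glue (D.embed x y n t) i (D.embed x y n u) j := by
  induction n generalizing i j with
  | zero => exact h.elim
  | succ n ih =>
    cases h with
    | centre_outer t k => exact .centre_outer _ k
    | outer_centre t k => exact .outer_centre _ k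
    | outer_next t k => exact .outer_next _ k
    | outer_prev t k => exact .outer_prev _ k
    | first_half t u k l h => exact .first_half _ _ k l (ih h)
    | second_half t u k l h => exact .second_half _ _ k l (ih h)

theorem isPasting_superTile (x : X) (n : ℕ) : (D.superTile x n).IsPasting := by
  induction n with
  | zero => exact ⟨fun h => h.elim, fun _ _ h => h, fun h => h.elim⟩
  | succ n ih => exact IsPasting.subst ih

theorem exists_isoMap_superTile (g : DihedralGroup 5) (x : X) (n : ℕ) :
    ∃ φ, D.IsoMap 0 (D.superTile x n) (D.superTile (g • x) n) φ := by
  induction n with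
  | zero =>
    let f (x y : X) (g : DihedralGroup 5) : (single x).Point → (single y).Point :=
      Quot.lift (fun a => (single y).pt a.1 (symP g a.2))
        (fun _ _ h => by cases h with | mk _ _ _ _ _ _ _ h => exact h.elim)
    refine ⟨⟨f x (g • x) g, f (g • x) x g⁻¹, ?_, ?_⟩, fun t => ⟨t, g, rfl, fun p => rfl⟩⟩
    · intro a
      obtain ⟨⟨t, p⟩, rfl⟩ := Quot.exists_rep a
      change (single x).pt t (symP g⁻¹ (symP g p)) = (single x).pt t p
      rw [symP_inv_symP]
    · intro a
      obtain ⟨⟨t, p⟩, rfl⟩ := Quot.exists_rep a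
      change (single (g • x)).pt t (symP g (symP g⁻¹ p)) = (single (g • x)).pt t p
      rw [symP_symP_inv]
  | succ n ih =>
    obtain ⟨φ, h⟩ := ih
    exact ⟨_, (h.mono (Nat.zero_le 1)).push⟩

variable (D)

/-- The two sides start from `seedAt (n + 1)` and `seedAt n`, which differ by the symmetry `turn`;
renumbering the initial pentagon is compatible with substitution. -/
theorem exists_isoMap_supertileK (n : ℕ) :
    ∃ φ, D.IsoMap 0 (D.supertileK (n + 1)) (D.subst (D.supertileK n)) φ := by
  have h : D.seedAt n = D.turn • D.seedAt (n + 1) := by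
    rw [seedAt, seedAt, pow_succ', smul_smul, mul_inv_cancel_left]
  have := exists_isoMap_superTile (D := D) D.turn (D.seedAt (n + 1)) (n + 1)
  rwa [← h] at this

/-! ### Tiles of the direct limit and their representatives -/

/-- The tile `t` of `K_n` represents the tile `a` of `K`. -/
def Represents (n : ℕ) (t : (D.supertileK n).tile) (a : D.limitK.tile) : Prop :=
  a = Quot.mk _ ⟨n, t⟩

/-- The passage to the next supertile. -/
def nextTile (a : Σ n, (D.supertileK n).tile) : Σ n, (D.supertileK n).tile :=
  ⟨a.1 + 1, D.embedK a.1 a.2⟩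

variable {D}

theorem nextTile_injective : Function.Injective D.nextTile := by
  rintro ⟨n, t⟩ ⟨m, u⟩ h
  obtain rfl : n = m := by simpa [nextTile] using congrArg Sigma.fst h
  have := (isPtEmbedding_embed _ _ n).injective (eq_of_heq (Sigma.mk.inj h).2)
  exact congrArg _ this

theorem nextTile_iterate_fst (k : ℕ) (a : Σ n, (D.supertileK n).tile) :
    (D.nextTile^[k] a).1 = a.1 + k := by
  induction k with
  | zero => rfl
  | succ k ih => rw [Function.iterate_succ_apply', ← add_assoc, ← ih]; rfl

/-- The relation is the graph of `nextTile`, so the equivalence it generates is having a common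
iterate. -/
theorem exists_iterate_of_mk_eq {a b : Σ n, (D.supertileK n).tile}
    (h : Quot.mk D.LimitRel a = Quot.mk D.LimitRel b) :
    ∃ i j, D.nextTile^[i] a = D.nextTile^[j] b := by
  have := Quot.eqvGen_exact h
  clear h
  induction this with
  | rel a b h => obtain rfl : b = _ := h; exact ⟨1, 0, rfl⟩
  | refl a => exact ⟨0, 0, rfl⟩
  | symm a b h ih => obtain ⟨i, j, e⟩ := ih; exact ⟨j, i, e.symm⟩
  | trans a b c h h' ih ih' =>
    obtain ⟨i, j, e⟩ := ih
    obtain ⟨k, l, e'⟩ := ih'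
    refine ⟨k + i, j + l, ?_⟩
    rw [Function.iterate_add_apply, e, Function.iterate_add_apply, ← e',
      ← Function.iterate_add_apply, ← Function.iterate_add_apply, add_comm]

theorem Represents.unique {n : ℕ} {t u : (D.supertileK n).tile} {a : D.limitK.tile}
    (h : D.Represents n t a) (h' : D.Represents n u a) : t = u := by
  obtain ⟨i, j, e⟩ := exists_iterate_of_mk_eq (h.symm.trans h')
  obtain rfl : i = j := by
    have := congrArg Sigma.fst e
    rw [nextTile_iterate_fst, nextTile_iterate_fst] at this
    exact Nat.add_left_cancel this
  exact eq_of_heq (Sigma.mk.inj (nextTile_injective.iterate i e)).2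

theorem Represents.right_unique {n : ℕ} {t : (D.supertileK n).tile} {a b : D.limitK.tile}
    (h : D.Represents n t a) (h' : D.Represents n t b) : a = b := Eq.trans h (Eq.symm h')

theorem Represents.next {n : ℕ} {t : (D.supertileK n).tile} {a : D.limitK.tile}
    (h : D.Represents n t a) : D.Represents (n + 1) (D.embedK n t) a :=
  Eq.trans h (Quot.sound rfl)

theorem exists_represents (a : D.limitK.tile) : ∃ n t, D.Represents n t a := by
  obtain ⟨⟨n, t⟩, rfl⟩ := Quot.exists_rep a
  exact ⟨n, t, rfl⟩

theorem Represents.mono {n m : ℕ} (hnm : n ≤ m) {t : (D.supertileK n).tile} {a : D.limitK.tile}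
    (h : D.Represents n t a) : ∃ u, D.Represents m u a := by
  induction hnm with
  | refl => exact ⟨t, h⟩
  | step _ ih =>
    obtain ⟨u, hu⟩ := ih
    exact ⟨_, hu.next⟩

theorem Represents.pt_eq_iff {n m : ℕ} (hnm : n ≤ m) {t u : (D.supertileK n).tile}
    {t' u' : (D.supertileK m).tile} {a b : D.limitK.tile} (h : D.Represents n t a)
    (hu : D.Represents n u b) (h' : D.Represents m t' a) (hu' : D.Represents m u' b) {p q : Pent} :
    (D.supertileK m).pt t' p = (D.supertileK m).pt u' q ↔
      (D.supertileK n).pt t p = (D.supertileK n).pt u q := by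
  induction hnm with
  | refl => rw [h.unique h', hu.unique hu']
  | @step m hm ih =>
    obtain ⟨t1, h1⟩ := h.mono hm
    obtain ⟨u1, hu1⟩ := hu.mono hm
    rw [← ih h1 hu1, h'.unique h1.next, hu'.unique hu1.next]
    exact (isPtEmbedding_embed _ _ m).pt_eq_iff

theorem Represents.glue_mono {n m : ℕ} (hnm : n ≤ m) {t u : (D.supertileK n).tile}
    {t' u' : (D.supertileK m).tile} {a b : D.limitK.tile} (h : D.Represents n t a)
    (hu : D.Represents n u b) (h' : D.Represents m t' a) (hu' : D.Represents m u' b) {i j : ZMod 5}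
    (hg : (D.supertileK n).glue t i u j) : (D.supertileK m).glue t' i u' j := by
  induction hnm with
  | refl => rwa [← h.unique h', ← hu.unique hu']
  | @step m hm ih =>
    obtain ⟨t1, h1⟩ := h.mono hm
    obtain ⟨u1, hu1⟩ := hu.mono hm
    rw [h'.unique h1.next, hu'.unique hu1.next]
    exact glue_embed _ _ m (ih h1 hu1)

theorem isPasting_limitK : D.limitK.IsPasting where
  symm := by
    rintro a i b j ⟨n, t, u, ht, hu, h⟩
    exact ⟨n, u, t, hu, ht, (isPasting_superTile _ n).symm h⟩
  irrefl := by
    rintro a i ⟨n, t, u, ht, hu, h⟩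
    obtain rfl := Represents.unique ht hu
    exact (isPasting_superTile _ n).irrefl _ _ h
  unique := by
    rintro a i b j b' j' ⟨n, t, u, ht, hu, h⟩ ⟨n', t', u', ht', hu', h'⟩
    obtain ⟨t1, h1⟩ := Represents.mono (le_max_left n n') ht
    obtain ⟨u1, hu1⟩ := Represents.mono (le_max_left n n') hu
    obtain ⟨u2, hu2⟩ := Represents.mono (le_max_right n n') hu'
    have e1 := Represents.glue_mono (le_max_left n n') ht hu h1 hu1 h
    have e2 := Represents.glue_mono (le_max_right n n') ht' hu' h1 hu2 h'
    obtain ⟨rfl, rfl⟩ := (isPasting_superTile _ _).unique e1 e2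
    exact ⟨hu1.right_unique hu2, rfl⟩

/-- A pasting in K already occurs at some finite level, and going to a higher level neither creates
nor removes identifications among tiles that are already present, because the embeddings are
injective on points. -/
theorem Represents.pt_limitK_eq_iff {n : ℕ} {t u : (D.supertileK n).tile} {a b : D.limitK.tile}
    (h : D.Represents n t a) (hu : D.Represents n u b) {p q : Pent} :
    D.limitK.pt a p = D.limitK.pt b q ↔ (D.supertileK n).pt t p = (D.supertileK n).pt u q := by
  constructor
  · intro e
    let P (c : D.limitK.tile) (r : Pent) : Prop := ∃ m t' v, D.Represents m t' a ∧
      D.Represents m v c ∧ (D.supertileK m).pt t' p = (D.supertileK m).pt v r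
    have key : ∀ c i d j s, D.limitK.glue c i d j → P c (edgeP i s) → P d (edgeP j (revPar s)) := by
      rintro c i d j s ⟨l, v, w, hv, hw, hg⟩ ⟨m, t', v', h1, h2, e⟩
      obtain ⟨t3, ht3⟩ := h1.mono (le_max_left m l)
      obtain ⟨v3, hv3⟩ := h2.mono (le_max_left m l)
      obtain ⟨w3, hw3⟩ := Represents.mono (le_max_right m l) hw
      refine ⟨_, t3, w3, ht3, hw3, ?_⟩
      rw [(h1.pt_eq_iff (le_max_left m l) h2 ht3 hv3).mpr e]
      exact pt_edgeP (Represents.glue_mono (le_max_right m l) hv hw hv3 hw3 hg) s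
    have := (pt_transfer (L := D.limitK) P (fun c i d j s hg => ⟨key c i d j s hg, fun hd => by
      have := key d j c i (revPar s) (isPasting_limitK.symm hg) hd
      rwa [revPar_revPar] at this⟩) e).mp ⟨n, t, t, h, h, rfl⟩
    obtain ⟨m, t', u', h1, h2, e⟩ := this
    obtain ⟨t3, ht3⟩ := h1.mono (le_max_left m n)
    obtain ⟨u3, hu3⟩ := h2.mono (le_max_left m n)
    exact (h.pt_eq_iff (le_max_right m n) hu ht3 hu3).mp
      ((h1.pt_eq_iff (le_max_left m n) h2 ht3 hu3).mpr e)
  · intro e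
    obtain rfl := h
    obtain rfl := hu
    refine (pt_transfer (L := D.supertileK n) (fun v r => D.limitK.pt (Quot.mk _ ⟨n, t⟩) p =
      D.limitK.pt (Quot.mk _ ⟨n, v⟩) r) ?_ e).mp rfl
    intro v i w j s hg
    rw [pt_edgeP (L := D.limitK) ⟨n, v, w, rfl, rfl, hg⟩ s]

/-! ### Finite patches of K and of its substitution -/

theorem exists_patchMap_supertileK (n : ℕ) :
    ∃ φ, D.PatchMap 0 (D.supertileK n) D.limitK φ Set.univ ∧
      ∀ t p, φ ((D.supertileK n).pt t p) = D.limitK.pt (Quot.mk _ ⟨n, t⟩) p := by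
  refine ⟨Quot.lift (fun a => D.limitK.pt (Quot.mk _ ⟨n, a.1⟩) a.2) ?_, ⟨?_, ?_⟩, fun t p => rfl⟩
  · rintro ⟨t, p⟩ ⟨u, q⟩ h
    exact (Represents.pt_limitK_eq_iff (n := n) rfl rfl).mpr (Quot.sound h)
  · intro a _ b _
    obtain ⟨⟨t, p⟩, rfl⟩ := Quot.exists_rep a
    obtain ⟨⟨u, q⟩, rfl⟩ := Quot.exists_rep b
    exact (Represents.pt_limitK_eq_iff (n := n) rfl rfl).mp
  · exact fun t _ => ⟨Quot.mk _ ⟨n, t⟩, 1, by rw [one_smul]; rfl, fun p => by rw [symP_one]; rfl⟩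

/-- Finitely many tiles are all represented at one level; the inverse of the embedding of that
supertile maps the patch into it. -/
theorem exists_patchMap_limitK {P : Set D.limitK.tile} (hP : P.Finite) :
    ∃ n ψ, D.PatchMap 0 D.limitK (D.supertileK n) ψ P := by
  have : ∃ n, ∀ a ∈ P, ∃ t, D.Represents n t a := by
    induction P, hP using Set.Finite.induction_on with
    | empty => exact ⟨0, fun a ha => ha.elim⟩
    | @insert a s _ _ ih =>
      obtain ⟨n, hn⟩ := ih
      obtain ⟨m, t, ht⟩ := exists_represents a
      refine ⟨max n m, ?_⟩
      rintro b (rfl | hb)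
      · exact ht.mono (le_max_right n m)
      · obtain ⟨u, hu⟩ := hn b hb
        exact hu.mono (le_max_left n m)
  obtain ⟨n, hn⟩ := this
  obtain ⟨φ, hφ, hp⟩ := exists_patchMap_supertileK (D := D) n
  rcases P.eq_empty_or_nonempty with rfl | ⟨a, ha⟩
  -- For the empty patch any map will do, but its target has to be inhabited.
  · obtain ⟨t⟩ : Nonempty (D.supertileK n).tile := by
      clear hp hφ φ hn
      unfold supertileK
      generalize D.seedAt n = x
      induction n with
      | zero => exact ⟨()⟩
      | succ n ih => obtain ⟨t⟩ := ih; exact ⟨(t, none)⟩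
    refine ⟨n, fun _ => (D.supertileK n).pt t centreP, ?_, fun t ht => ht.elim⟩
    rintro x ⟨t, ht, -⟩
    exact ht.elim
  obtain ⟨t, ht⟩ := hn a ha
  have : Nonempty (D.supertileK n).Point := ⟨(D.supertileK n).pt t centreP⟩
  obtain ⟨ψ, hψ, -⟩ := hφ.exists_inverse
  refine ⟨n, ψ, hψ.mono le_rfl fun b hb => ?_⟩
  obtain ⟨u, rfl⟩ := hn b hb
  exact ⟨u, trivial, hp u centreP⟩

/-- A patch lies in some K_n, and K_n embeds into K_(n+1) ≅ ω(K_n), which embeds into ω(K). -/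
theorem locIso_limitK_subst : D.LocIso 0 D.limitK (D.subst D.limitK) := by
  intro P hP
  obtain ⟨n, ψ, hψ⟩ := exists_patchMap_limitK hP
  obtain ⟨φ, hφ, -⟩ := exists_patchMap_supertileK (D := D) n
  obtain ⟨θ, hθ⟩ := D.exists_isoMap_supertileK n
  obtain ⟨η, hη, -⟩ := exists_patchMap_supertileK (D := D) (n + 1)
  have h1 := (hφ.mono (Nat.zero_le 1) subset_rfl).push
  have h2 : ∃ e, D.PatchMap 0 (D.supertileK n) (D.supertileK (n + 1)) e Set.univ := by
    obtain ⟨e, he, hp⟩ := isPtEmbedding_embed (D := D) (D.seedAt n) (D.seedAt (n + 1)) n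
    refine ⟨e, he.injOn, fun t _ => ⟨D.embedK n t, 1, ?_, fun p => by rw [symP_one]; exact hp t p⟩⟩
    rw [one_smul]
    exact D.deco_embed _ _ (D.centre_seedAt n) n t
  obtain ⟨e, h2⟩ := h2
  exact ⟨_, hψ.comp (h2.comp ((hθ.patchMap Set.univ).comp h1 fun _ _ _ _ => trivial)
    fun _ _ _ _ => trivial) fun _ _ _ _ => trivial⟩

/-- The parents of the patch lie in some K_n, so the patch goes into ω(K_n) ≅ K_(n+1), which embeds
into K. -/
theorem locIso_subst_limitK : D.LocIso 0 (D.subst D.limitK) D.limitK := by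
  intro P hP
  obtain ⟨n, ψ, hψ⟩ := exists_patchMap_limitK (D := D) (hP.image Prod.fst)
  obtain ⟨θ, hθ⟩ := D.exists_isoMap_supertileK n
  obtain ⟨η, hη, -⟩ := exists_patchMap_supertileK (D := D) (n + 1)
  have h1 := (hψ.mono (Nat.zero_le 1) subset_rfl).push
  refine ⟨_, (h1.mono le_rfl (S' := P) (by rintro a ha; exact ⟨a, ha, rfl⟩)).comp
    ((hθ.symm.patchMap Set.univ).comp hη fun _ _ _ _ => trivial) fun _ _ _ _ => trivial⟩

/-! ### The substitution of tilings of the hull -/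

theorem exists_glue_subst {L : PentComplex X} (hL : ∀ t i, ∃ u j, L.glue t i u j)
    (a : (D.subst L).tile) (i : ZMod 5) : ∃ b j, (D.subst L).glue a i b j := by
  obtain ⟨t, o⟩ := a
  cases o with
  | none => exact ⟨(t, some (i - 2)), 2, SubGlue.none_some t i⟩
  | some k =>
    fin_cases i
    · obtain ⟨u, l, h⟩ := hL t k
      exact ⟨(u, some (l + 1)), 4, .first_half t u k l h⟩
    · exact ⟨(t, some (k + 1)), 3, SubGlue.outer_next t k⟩
    · exact ⟨(t, none), k + 2, SubGlue.outer_centre t k⟩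
    · exact ⟨(t, some (k - 1)), 1, SubGlue.some_pred t k⟩
    · obtain ⟨u, l, h⟩ := hL t (k - 1)
      have := SubGlue.second_half t u (k - 1) l h
      rw [sub_add_cancel] at this
      exact ⟨(u, some l), 0, this⟩

theorem isTiling_subst {L : PentComplex X} (hL : L.IsTiling) : (D.subst L).IsTiling where
  symm _ _ _ _ h := (IsPasting.subst (D := D) hL.isPasting).symm h
  irrefl := (IsPasting.subst (D := D) hL.isPasting).irrefl
  closed := by
    refine fun a i => existsUnique_of_exists_of_unique ?_ ?_
    · obtain ⟨b, j, h⟩ := exists_glue_subst (D := D) (fun t i => by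
        obtain ⟨e, he, -⟩ := hL.closed t i
        exact ⟨e.1, e.2, he⟩) a i
      exact ⟨(b, j), h⟩
    · rintro ⟨b, j⟩ ⟨b', j'⟩ h h'
      obtain ⟨rfl, rfl⟩ := (IsPasting.subst (D := D) hL.isPasting).unique h h'
      rfl
  plane := hL.plane.map fun e => (D.mapHomeo L).symm.trans e

theorem locIso_subst {n : ℕ} {L : PentComplex X} (h : D.LocIso (n + 1) L D.limitK) :
    D.LocIso n (D.subst L) D.limitK :=
  h.push.trans (locIso_subst_limitK.mono (Nat.zero_le n))

theorem inHull_iff {L : PentComplex X} :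
    D.InHull L ↔ L.IsTiling ∧ D.LocIso 0 L D.limitK :=
  ⟨fun h => ⟨h.1, locIso_zero_iff.mpr h.2⟩, fun h => ⟨h.1, locIso_zero_iff.mp h.2⟩⟩

theorem inHull_subst {L : PentComplex X} (h : D.InHull L) : D.InHull (D.subst L) :=
  inHull_iff.mpr ⟨isTiling_subst h.1,
    locIso_subst ((inHull_iff.mp h).2.mono (Nat.zero_le 1))⟩

end Decoration

/-! ### Recognition of the subdivision -/

section Typing

variable {T : Type}

/-- The rotation of an edge of a tile by `k` steps. -/
def rot (k : ZMod 5) (x : T × ZMod 5) : T × ZMod 5 := (x.1, x.2 + k)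

theorem rot_rot (k l : ZMod 5) (x : T × ZMod 5) : rot k (rot l x) = rot (l + k) x :=
  Prod.ext rfl (add_assoc _ _ _)

theorem rot_zero (x : T × ZMod 5) : rot 0 x = x := Prod.ext rfl (add_zero _)

theorem rot_injective (k : ZMod 5) : Function.Injective (rot k : T × ZMod 5 → T × ZMod 5) :=
  fun x y h => by
    have := congrArg (rot (-k)) h
    rwa [rot_rot, rot_rot, add_neg_cancel, rot_zero, rot_zero] at this

/-- The type of the edge that is pasted to an edge of a given type; the edges of central tiles have
the type `none`, the edge `i` of an outer tile has the type `some i`. -/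
def pasteType : Option (ZMod 5) → Option (ZMod 5)
  | none => some 2
  | some i => if i = 2 then none else some (-i - 1)

theorem pasteType_eq_none {o : Option (ZMod 5)} : pasteType o = none ↔ o = some 2 := by
  cases o with
  | none => simp [pasteType]
  | some i => by_cases h : i = 2 <;> simp [pasteType, h]

/-- The types `c x` of edges `x` fit to a pasting `ν` of edges at the tiles in `P`. -/
structure IsTyping (ν : T × ZMod 5 → T × ZMod 5) (c : T × ZMod 5 → Option (ZMod 5)) (P : Set T) :
    Prop where
  shift : ∀ k x, c (rot k x) = (c x).map (· + k)
  paste : ∀ x, x.1 ∈ P → c (ν x) = pasteType (c x)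
  cycle_three : ∀ x, x.1 ∈ P → c x = none →
    ν (rot 1 (ν (rot 1 (ν x)))) = rot (-1) x
  cycle_four : ∀ x, x.1 ∈ P → c x = some 0 →
    rot (-1) (ν (rot (-1) (ν (rot (-1) (ν
      (rot (-1) (ν x))))))) = x
  irrefl : ∀ x, x.1 ∈ P → c x = none →
    rot (-1) (ν (rot 3 (ν (rot 3 (ν x))))) ≠ x

theorem IsTyping.mono {ν : T × ZMod 5 → T × ZMod 5} {c : T × ZMod 5 → Option (ZMod 5)}
    {P Q : Set T} (h : IsTyping ν c P) (hQ : Q ⊆ P) : IsTyping ν c Q where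
  shift := h.shift
  paste x hx := h.paste x (hQ hx)
  cycle_three x hx := h.cycle_three x (hQ hx)
  cycle_four x hx := h.cycle_four x (hQ hx)
  irrefl x hx := h.irrefl x (hQ hx)

/-- All corners of the tile of `x` belong to cycles of three tiles. -/
def IsCentral (ν : T × ZMod 5 → T × ZMod 5) (x : T × ZMod 5) : Prop :=
  ∀ k, ν (rot 1 (ν (rot 1 (ν (rot k x))))) = rot (k - 1) x

/-- Being central is read off from `ν` alone, on the tile and two rings of neighbours: an outer tile
fails the criterion at its corner between edges 0 and 1. -/
theorem exists_finite_isCentral_iff (ν : T × ZMod 5 → T × ZMod 5) (x : T × ZMod 5) :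
    ∃ P : Set T, P.Finite ∧ x.1 ∈ P ∧ ∀ c, IsTyping ν c P → (IsCentral ν x ↔ c x = none) := by
  let A : Set T := Set.range fun k => (ν (rot k x)).1
  let B : Set T := Set.range fun k => (ν (rot 1 (ν (rot k x)))).1
  refine ⟨{x.1} ∪ A ∪ B, Set.toFinite _, Or.inl (Or.inl rfl), fun c hc => ⟨fun h => ?_, fun h k => ?_⟩⟩
  · rcases e : c x with _ | i
    · rfl
    exfalso
    -- Turning to the edge of type 1 and going round the corner, the types run 1 → 3, 4 → 0, 1 → 3,
    -- while closing up after three steps would require type 0 at the end.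
    have e0 : c (rot (1 - i) x) = some 1 := by rw [hc.shift, e]; simp
    have e1 : c (ν (rot (1 - i) x)) = some 3 := by
      rw [hc.paste (rot (1 - i) x) (Or.inl (Or.inl rfl)), e0]; decide
    have e2 : c (ν (rot 1 (ν (rot (1 - i) x)))) = some 0 := by
      rw [hc.paste (rot 1 (ν (rot (1 - i) x))) (Or.inl (Or.inr ⟨1 - i, rfl⟩)), hc.shift, e1]; decide
    have e3 : c (ν (rot 1 (ν (rot 1 (ν (rot (1 - i) x)))))) = some 3 := by
      rw [hc.paste (rot 1 (ν (rot 1 (ν (rot (1 - i) x))))) (Or.inr ⟨1 - i, rfl⟩), hc.shift, e2]; decide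
    rw [h, hc.shift, e] at e3
    have := Option.some.inj e3
    ring_nf at this
    exact absurd this (by decide)
  · rw [hc.cycle_three (rot k x) (Or.inl (Or.inl rfl)) (by rw [hc.shift, h]; rfl), rot_rot, sub_eq_add_neg]

/-- For an outer tile, the edge of type 2 is the only one pasted to a central tile, and locating it
fixes the numbering. So all typings of a large enough patch agree on x. -/
theorem exists_finite_type (ν : T × ZMod 5 → T × ZMod 5)
    (h : ∀ P : Set T, P.Finite → ∃ c, IsTyping ν c P) (x : T × ZMod 5) :
    ∃ o, ∃ P : Set T, P.Finite ∧ ∀ c, IsTyping ν c P → c x = o := by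
  choose Q hQ hx hc using exists_finite_isCentral_iff ν
  have hfin : (Q x ∪ ⋃ k, Q (ν (rot k x))).Finite :=
    (hQ x).union (Set.finite_iUnion fun k => hQ _)
  obtain ⟨c, hcP⟩ := h _ hfin
  have sub1 : Q x ⊆ Q x ∪ ⋃ k, Q (ν (rot k x)) := Set.subset_union_left
  have sub2 : ∀ k, Q (ν (rot k x)) ⊆ Q x ∪ ⋃ k, Q (ν (rot k x)) := fun k =>
    (Set.subset_iUnion (fun k => Q (ν (rot k x))) k).trans Set.subset_union_right
  refine ⟨c x, _, hfin, fun d hd => ?_⟩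
  rcases e : c x with _ | i
  · exact (hc x d (hd.mono sub1)).mp ((hc x c (hcP.mono sub1)).mpr e)
  · have h1 : c (ν (rot (2 - i) x)) = none := by
      rw [hcP.paste (rot (2 - i) x) (sub1 (hx x)), hcP.shift, e]
      simp [pasteType]
    have h2 := (hc _ d (hd.mono (sub2 _))).mp ((hc _ c (hcP.mono (sub2 _))).mpr h1)
    rw [hd.paste (rot (2 - i) x) (sub1 (hx x)), pasteType_eq_none, hd.shift, Option.map_eq_some_iff] at h2
    obtain ⟨j, hj, hji⟩ := h2
    rw [hj, show j = i by linear_combination hji]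

/-- Types that exist locally exist globally. -/
theorem exists_isTyping_univ (ν : T × ZMod 5 → T × ZMod 5)
    (h : ∀ P : Set T, P.Finite → ∃ c, IsTyping ν c P) : ∃ c, IsTyping ν c Set.univ := by
  choose C P hP hC using exists_finite_type ν h
  -- Every condition involves the types of at most two edges, and `C` agrees there with one local
  -- typing; so no compactness argument is needed.
  have two : ∀ x y, ∃ c, IsTyping ν c {x.1} ∧ c x = C x ∧ c y = C y := by
    intro x y
    obtain ⟨c, hc⟩ := h ({x.1} ∪ P x ∪ P y) (((Set.finite_singleton _).union (hP x)).union (hP y))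
    exact ⟨c, hc.mono fun _ h => Or.inl (Or.inl h), hC x c (hc.mono fun _ h => Or.inl (Or.inr h)),
      hC y c (hc.mono fun _ h => Or.inr h)⟩
  refine ⟨C, fun k x => ?_, fun x _ => ?_, fun x _ e => ?_, fun x _ e => ?_, fun x _ e => ?_⟩
  · obtain ⟨c, hc, h1, h2⟩ := two x (rot k x)
    rw [← h1, ← h2, hc.shift]
  · obtain ⟨c, hc, h1, h2⟩ := two x (ν x)
    rw [← h1, ← h2, hc.paste x rfl]
  · obtain ⟨c, hc, h1, -⟩ := two x x
    exact hc.cycle_three x rfl (h1.trans e)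
  · obtain ⟨c, hc, h1, -⟩ := two x x
    exact hc.cycle_four x rfl (h1.trans e)
  · obtain ⟨c, hc, h1, -⟩ := two x x
    exact hc.irrefl x rfl (h1.trans e)

end Typing

/-! ### Composition of subdivided tiles -/

section Composition

variable {T : Type} (ν : T × ZMod 5 → T × ZMod 5) (c : T × ZMod 5 → Option (ZMod 5))

/-- The tiles that are central tiles of a subdivision. -/
def CentralTile : Type := {t : T // c (t, 0) = none}

/-- The pasting of the tiles whose subdivisions are composed of the given tiles. -/
def composedGlue (t : CentralTile c) (k : ZMod 5) (u : CentralTile c) (l : ZMod 5) : Prop :=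
  rot (-1) (ν (rot 3 (ν (rot 3 (ν (t.1, k + 2)))))) = (u.1, l + 2)

/-- The edges of the tiles of the subdivision as edges of the given tiles. -/
def composedEdge (a : CentralTile c × Option (ZMod 5)) (i : ZMod 5) : T × ZMod 5 :=
  match a.2 with
  | none => (a.1.1, i)
  | some k => rot (i - 2) (ν (a.1.1, k + 2))

variable {ν c}

theorem composedEdge_add (a : CentralTile c × Option (ZMod 5)) (i k : ZMod 5) :
    composedEdge ν c a (i + k) = rot k (composedEdge ν c a i) := by
  obtain ⟨t, _ | l⟩ := a
  · rfl
  · change rot _ _ = rot _ (rot _ _)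
    rw [rot_rot]
    congr 1
    ring

variable (hc : IsTyping ν c Set.univ) (hν : Function.Involutive ν)

include hc

theorem IsTyping.type_central (t : CentralTile c) (i : ZMod 5) : c (t.1, i) = none := by
  have := hc.shift i (t.1, 0)
  rw [t.2] at this
  have e : rot i (t.1, 0) = (t.1, i) := Prod.ext rfl (zero_add i)
  rwa [e] at this

theorem IsTyping.type_nbr (t : CentralTile c) (i : ZMod 5) : c (ν (t.1, i)) = some 2 := by
  rw [hc.paste _ trivial, hc.type_central]
  rfl

include hν

/-- The three-cycle at a corner of the central tile, rewritten: consecutive outer tiles are pasted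
along their edges 1 and 3. -/
theorem IsTyping.next_edge (t : CentralTile c) (k : ZMod 5) :
    ν (rot (-1) (ν (t.1, k))) = rot 1 (ν (t.1, k + 1)) := by
  have h := hc.cycle_three (t.1, k + 1) trivial (hc.type_central t _)
  have e : rot (-1) (t.1, k + 1) = (t.1, k) := Prod.ext rfl (add_neg_cancel_right k 1)
  rw [e] at h
  rw [← h, hν, rot_rot, add_neg_cancel, rot_zero, hν]

/-- This is the definition of `composedGlue` read from the middle: the walk from one central tile to
the other crosses the first half of the old edge. -/
theorem IsTyping.first_edge {t u : CentralTile c} {k l : ZMod 5} (h : composedGlue ν c t k u l) :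
    ν (rot (-2) (ν (t.1, k + 2))) = rot 2 (ν (u.1, l + 1 + 2)) := by
  have h1 := congrArg (fun z => rot 2 (ν (rot 1 z))) h
  simp only [rot_rot, neg_add_cancel, rot_zero, hν _] at h1
  rw [show (3 : ZMod 5) + 2 = 0 by decide, rot_zero] at h1
  rw [show (-2 : ZMod 5) = 3 by decide, h1]
  congr 2
  refine Prod.ext rfl ?_
  change l + 2 + 1 = l + 1 + 2
  ring

/-- Four tiles meet at the midpoint of the old edge. Three of the four pastings there are known,
from `first_edge` and `next_edge` on both sides, and `cycle_four` yields the last one, across the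
second half. -/
theorem IsTyping.second_edge {t u : CentralTile c} {k l : ZMod 5} (h : composedGlue ν c t k u l) :
    ν (rot 2 (ν (t.1, k + 1 + 2))) = rot (-2) (ν (u.1, l + 2)) := by
  have h1 := hc.first_edge hν h
  have h0 : c (rot (-2) (ν (t.1, k + 2))) = some 0 := by
    rw [hc.shift, hc.type_nbr]
    rfl
  have h2 := hc.cycle_four _ trivial h0
  have n1 := hc.next_edge hν u (l + 2)
  have n2 := hc.next_edge hν t (k + 2)
  rw [show l + 2 + 1 = l + 1 + 2 by ring] at n1
  rw [show k + 2 + 1 = k + 1 + 2 by ring] at n2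
  rw [h1, rot_rot, show (2 : ZMod 5) + -1 = 1 by decide, ← n1, hν, rot_rot,
    show (-1 : ZMod 5) + -1 = -2 by decide] at h2
  have h3 := congrArg (rot 1) h2
  rw [rot_rot, neg_add_cancel, rot_zero, rot_rot, show (-2 : ZMod 5) + 1 = -1 by decide] at h3
  have h4 := congrArg ν h3
  rw [hν, n2] at h4
  have h5 := congrArg (rot 1) h4
  rw [rot_rot, neg_add_cancel, rot_zero, rot_rot, show (1 : ZMod 5) + 1 = 2 by decide] at h5
  rw [← h5, hν]

/-- The pasting of the subdivision of the composed tiles is the given one. -/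
theorem IsTyping.paste_composedEdge {a b : CentralTile c × Option (ZMod 5)} {i j : ZMod 5}
    (h : SubGlue (composedGlue ν c) a i b j) :
    ν (composedEdge ν c a i) = composedEdge ν c b j := by
  have e2 : (2 : ZMod 5) - 2 = 0 := by decide
  cases h with
  | centre_outer t k =>
    change _ = rot (2 - 2) _
    rw [e2, rot_zero]
    rfl
  | outer_centre t k =>
    change ν (rot (2 - 2) _) = _
    rw [e2, rot_zero, hν]
    rfl
  | outer_next t k =>
    have := hc.next_edge hν t (k + 2)
    rw [show k + 2 + 1 = k + 1 + 2 by ring] at this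
    exact this
  | outer_prev t k =>
    have := hc.next_edge hν t (k + 2)
    rw [show k + 2 + 1 = k + 1 + 2 by ring] at this
    have := congrArg ν this
    rw [hν] at this
    exact this.symm
  | first_half t u k l h => exact hc.first_edge hν h
  | second_half t u k l h => exact hc.second_edge hν h

theorem IsTyping.composedGlue_symm {t u : CentralTile c} {k l : ZMod 5}
    (h : composedGlue ν c t k u l) : composedGlue ν c u l t k := by
  have h1 := congrArg ν (hc.second_edge hν h)
  rw [hν] at h1
  unfold composedGlue
  rw [show (3 : ZMod 5) = -2 by decide, ← h1, rot_rot, add_neg_cancel, rot_zero, hν]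
  refine Prod.ext rfl ?_
  change k + 1 + 2 + -1 = k + 2
  ring

omit hν in
theorem IsTyping.composedGlue_irrefl (t : CentralTile c) (k : ZMod 5) :
    ¬ composedGlue ν c t k t k := hc.irrefl _ trivial (hc.type_central t _)

omit hν in
theorem IsTyping.composedGlue_closed (t : CentralTile c) (k : ZMod 5) :
    ∃! e : CentralTile c × ZMod 5, composedGlue ν c t k e.1 e.2 := by
  set y := rot (-1) (ν (rot 3 (ν (rot 3 (ν (t.1, k + 2)))))) with hy
  have h1 : c y = none := by
    have h2 : c (ν (rot 3 (ν (rot 3 (ν (t.1, k + 2)))))) = none := by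
      rw [hc.paste _ trivial, hc.shift, hc.paste _ trivial, hc.shift, hc.type_nbr]
      decide
    rw [hy, hc.shift, h2]
    rfl
  have h0 : c (y.1, 0) = none := by
    have := hc.shift (-y.2) y
    rw [h1, show rot (-y.2) y = (y.1, 0) from Prod.ext rfl (add_neg_cancel _)] at this
    exact this
  refine ⟨(⟨y.1, h0⟩, y.2 - 2), Prod.ext rfl (sub_add_cancel _ _).symm, ?_⟩
  rintro ⟨u, l⟩ h
  change y = (u.1, l + 2) at h
  refine Prod.ext (Subtype.ext ?_) ?_
  · exact (congrArg Prod.fst h).symm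
  · have := congrArg Prod.snd h
    change l = y.2 - 2
    rw [this]
    exact (add_sub_cancel_right _ _).symm

/-- Every tile is either central or has exactly one edge of type 2, whose partner belongs to a
central tile. So each tile belongs to exactly one composed tile, in one position. -/
theorem IsTyping.composedEdge_bijective :
    Function.Bijective (fun a : CentralTile c × Option (ZMod 5) => (composedEdge ν c a 0).1) := by
  have hsome : ∀ (t : CentralTile c) (k : ZMod 5), c (rot (-2) (ν (t.1, k + 2))) = some 0 := by
    intro t k
    rw [hc.shift, hc.type_nbr]
    rfl
  have htile : ∀ {x y : T × ZMod 5}, x.1 = y.1 → y = rot (y.2 - x.2) x := fun {x y} h =>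
    Prod.ext h.symm (by change y.2 = x.2 + (y.2 - x.2); ring)
  constructor
  · rintro ⟨t, _ | k⟩ ⟨u, _ | l⟩ h
    · exact Prod.ext (Subtype.ext h) rfl
    · exfalso
      have h1 := htile (x := (t.1, 0)) (y := rot (0 - 2) (ν (u.1, l + 2))) h
      have h2 := hsome u l
      rw [zero_sub] at h1
      rw [h1, hc.shift, t.2] at h2
      exact absurd h2 (by simp)
    · exfalso
      have h1 := htile (x := (u.1, 0)) (y := rot (0 - 2) (ν (t.1, k + 2))) h.symm
      have h2 := hsome t k
      rw [zero_sub] at h1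
      rw [h1, hc.shift, u.2] at h2
      exact absurd h2 (by simp)
    · have h1 := htile (x := rot (0 - 2) (ν (t.1, k + 2))) (y := rot (0 - 2) (ν (u.1, l + 2))) h
      have h2 := hsome u l
      rw [zero_sub] at h1
      set d := (rot (-2) (ν (u.1, l + 2))).2 - (rot (-2) (ν (t.1, k + 2))).2
      have h3 := h2
      rw [h1, hc.shift, hsome t k] at h3
      have hd : d = 0 := by simpa using h3
      rw [hd, rot_zero] at h1
      have h4 := hν.injective (rot_injective _ h1)
      obtain ⟨h5, h6⟩ := Prod.mk.inj h4
      refine Prod.ext (Subtype.ext h5.symm) ?_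
      rw [add_right_cancel h6]
  · intro m
    rcases e : c (m, 0) with _ | i
    · exact ⟨(⟨m, e⟩, none), rfl⟩
    · have h1 : c (m, 2 - i) = some 2 := by
        have := hc.shift (2 - i) (m, 0)
        rw [e, show rot (2 - i) (m, (0 : ZMod 5)) = (m, 2 - i) from Prod.ext rfl (zero_add _)] at this
        rw [this]
        simp
      have h2 : c (ν (m, 2 - i)) = none := by
        rw [hc.paste _ trivial, h1]
        decide
      have h0 : c ((ν (m, 2 - i)).1, 0) = none := by
        have := hc.shift (-(ν (m, 2 - i)).2) (ν (m, 2 - i))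
        rw [h2, show rot (-(ν (m, 2 - i)).2) (ν (m, 2 - i)) = ((ν (m, 2 - i)).1, 0) from
          Prod.ext rfl (add_neg_cancel _)] at this
        exact this
      refine ⟨(⟨(ν (m, 2 - i)).1, h0⟩, some ((ν (m, 2 - i)).2 - 2)), ?_⟩
      change (ν ((ν (m, 2 - i)).1, (ν (m, 2 - i)).2 - 2 + 2)).1 = m
      rw [sub_add_cancel]
      exact congrArg Prod.fst (hν (m, 2 - i))

end Composition

/-! ### Local types of edges -/

section Charts

variable {T : Type}

/-- The type of an edge of a subdivided complex. -/
def edgeType (x : (T × Option (ZMod 5)) × ZMod 5) : Option (ZMod 5) := x.1.2.map fun _ => x.2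

theorem edgeType_rot (k : ZMod 5) (x : (T × Option (ZMod 5)) × ZMod 5) :
    edgeType (rot k x) = (edgeType x).map (· + k) := by
  obtain ⟨⟨t, _ | l⟩, i⟩ := x <;> rfl

theorem edgeType_eq_none {x : (T × Option (ZMod 5)) × ZMod 5} (h : edgeType x = none) :
    ∃ t i, x = ((t, none), i) := by
  obtain ⟨⟨t, _ | l⟩, i⟩ := x
  · exact ⟨t, i, rfl⟩
  · exact absurd h (by simp [edgeType])

theorem edgeType_eq_some {x : (T × Option (ZMod 5)) × ZMod 5} {i : ZMod 5}
    (h : edgeType x = some i) : ∃ t k, x = ((t, some k), i) := by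
  obtain ⟨⟨t, _ | l⟩, j⟩ := x
  · exact absurd h (by simp [edgeType])
  · obtain rfl : j = i := by simpa [edgeType] using h
    exact ⟨t, l, rfl⟩

variable {G : T → ZMod 5 → T → ZMod 5 → Prop}

/-- The pasting of the edges of a subdivided complex. -/
def EdgeGlue (G : T → ZMod 5 → T → ZMod 5 → Prop) (x y : (T × Option (ZMod 5)) × ZMod 5) : Prop :=
  SubGlue G x.1 x.2 y.1 y.2

theorem EdgeGlue.edgeType_eq {x y : (T × Option (ZMod 5)) × ZMod 5} (h : EdgeGlue G x y) :
    edgeType y = pasteType (edgeType x) := by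
  obtain ⟨a, i⟩ := x
  obtain ⟨b, j⟩ := y
  cases h with
  | centre_outer => rfl
  | outer_centre => rfl
  | outer_next => exact (by decide : some (3 : ZMod 5) = pasteType (some 1))
  | outer_prev => exact (by decide : some (1 : ZMod 5) = pasteType (some 3))
  | first_half => exact (by decide : some (4 : ZMod 5) = pasteType (some 0))
  | second_half => exact (by decide : some (0 : ZMod 5) = pasteType (some 4))

theorem EdgeGlue.cycle_three {x y₁ y₂ y₃ : (T × Option (ZMod 5)) × ZMod 5}
    (hx : edgeType x = none) (h₁ : EdgeGlue G x y₁) (h₂ : EdgeGlue G (rot 1 y₁) y₂)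
    (h₃ : EdgeGlue G (rot 1 y₂) y₃) : y₃ = rot (-1) x := by
  obtain ⟨t, i, rfl⟩ := edgeType_eq_none hx
  obtain ⟨b₁, j₁⟩ := y₁
  obtain ⟨b₂, j₂⟩ := y₂
  obtain ⟨b₃, j₃⟩ := y₃
  obtain ⟨e₁, e₁'⟩ := subGlue_none h₁
  change b₁ = _ at e₁
  change j₁ = _ at e₁'
  subst e₁ e₁'
  obtain ⟨e₂, e₂'⟩ := subGlue_three h₂
  change b₂ = _ at e₂
  change j₂ = _ at e₂'
  subst e₂ e₂'
  obtain ⟨e₃, e₃'⟩ := subGlue_two h₃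
  refine Prod.ext e₃ (e₃'.trans ?_)
  change i - 2 - 1 + 2 = i + -1
  ring

/-- Going round the midpoint of an old edge crosses that edge twice, in opposite directions;
symmetry and uniqueness of the old pasting bring the walk back to its start. -/
theorem EdgeGlue.cycle_four (symm : ∀ {t i u j}, G t i u j → G u j t i)
    (unique : ∀ {t i u j u' j'}, G t i u j → G t i u' j' → u = u' ∧ j = j')
    {x y₁ y₂ y₃ y₄ : (T × Option (ZMod 5)) × ZMod 5} (hx : edgeType x = some 0)
    (h₁ : EdgeGlue G x y₁) (h₂ : EdgeGlue G (rot (-1) y₁) y₂)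
    (h₃ : EdgeGlue G (rot (-1) y₂) y₃) (h₄ : EdgeGlue G (rot (-1) y₃) y₄) : rot (-1) y₄ = x := by
  obtain ⟨t, k, rfl⟩ := edgeType_eq_some hx
  obtain ⟨b₁, j₁⟩ := y₁
  obtain ⟨b₂, j₂⟩ := y₂
  obtain ⟨b₃, j₃⟩ := y₃
  obtain ⟨b₄, j₄⟩ := y₄
  obtain ⟨u, l, g₁, e₁, e₁'⟩ := subGlue_zero h₁
  change b₁ = _ at e₁
  change j₁ = _ at e₁'
  subst e₁ e₁'
  obtain ⟨e₂, e₂'⟩ := subGlue_three h₂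
  change b₂ = _ at e₂
  change j₂ = _ at e₂'
  subst e₂ e₂'
  obtain ⟨v, m, g₂, e₃, e₃'⟩ := subGlue_zero h₃
  change b₃ = _ at e₃
  change j₃ = _ at e₃'
  subst e₃ e₃'
  rw [add_sub_cancel_right] at g₂
  obtain ⟨rfl, rfl⟩ := unique g₂ (symm g₁)
  obtain ⟨e₄, e₄'⟩ := subGlue_three h₄
  change b₄ = _ at e₄
  change j₄ = _ at e₄'
  subst e₄ e₄'
  rw [add_sub_cancel_right]
  rfl

theorem EdgeGlue.ne (irrefl : ∀ t i, ¬ G t i t i)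
    {x y₁ y₂ y₃ : (T × Option (ZMod 5)) × ZMod 5} (hx : edgeType x = none)
    (h₁ : EdgeGlue G x y₁) (h₂ : EdgeGlue G (rot 3 y₁) y₂) (h₃ : EdgeGlue G (rot 3 y₂) y₃) :
    rot (-1) y₃ ≠ x := by
  obtain ⟨t, i, rfl⟩ := edgeType_eq_none hx
  obtain ⟨b₁, j₁⟩ := y₁
  obtain ⟨b₂, j₂⟩ := y₂
  obtain ⟨b₃, j₃⟩ := y₃
  obtain ⟨e₁, e₁'⟩ := subGlue_none h₁
  change b₁ = _ at e₁
  change j₁ = _ at e₁'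
  subst e₁ e₁'
  obtain ⟨u, l, g₁, e₂, e₂'⟩ := subGlue_zero h₂
  change b₂ = _ at e₂
  change j₂ = _ at e₂'
  subst e₂ e₂'
  obtain ⟨e₃, e₃'⟩ := subGlue_two h₃
  change b₃ = _ at e₃
  change j₃ = _ at e₃'
  subst e₃ e₃'
  intro h
  obtain ⟨h1, h2⟩ := Prod.mk.inj h
  obtain ⟨rfl, -⟩ := Prod.mk.inj h1
  change l + 1 + 2 + -1 = i at h2
  refine irrefl u (i - 2) ?_
  rwa [show l = i - 2 by linear_combination h2] at g₁

/-- The reflection of the tiles of a subdivision. -/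
def flip (a : T × Option (ZMod 5)) : T × Option (ZMod 5) := (a.1, a.2.map fun k => -k)

theorem flip_injective : Function.Injective (flip : T × Option (ZMod 5) → _) := by
  rintro ⟨t, o⟩ ⟨u, o'⟩ h
  obtain ⟨rfl, h⟩ := Prod.mk.inj h
  exact Prod.ext rfl (Option.map_injective neg_injective h)

/-- Reversing the numbering in every tile exchanges edge i with edge −1 − i, and the subdivision of
the mirror image is the mirror image of the subdivision. This reduces orientation-reversing charts
to orientation-preserving ones. -/
theorem SubGlue.flip {a b : T × Option (ZMod 5)} {i j : ZMod 5} (h : SubGlue G a i b j) :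
    SubGlue (fun t i u j => G t (-1 - i) u (-1 - j)) (PentHull.flip a) (-1 - i)
      (PentHull.flip b) (-1 - j) := by
  cases h with
  | centre_outer t k =>
    have := SubGlue.centre_outer (G := fun t i u j => G t (-1 - i) u (-1 - j)) t (-k)
    rwa [show -k + 2 = -1 - (k + 2) by linear_combination zmod5_eqs.2.2] at this
  | outer_centre t k =>
    have := SubGlue.outer_centre (G := fun t i u j => G t (-1 - i) u (-1 - j)) t (-k)
    rwa [show -k + 2 = -1 - (k + 2) by linear_combination zmod5_eqs.2.2] at this
  | outer_next t k =>
    have := SubGlue.some_pred (G := fun t i u j => G t (-1 - i) u (-1 - j)) t (-k)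
    rwa [show -k - 1 = -(k + 1) by ring] at this
  | outer_prev t k =>
    have := SubGlue.pred_some (G := fun t i u j => G t (-1 - i) u (-1 - j)) t (-k)
    rwa [show -k - 1 = -(k + 1) by ring] at this
  | first_half t u k l h =>
    have := SubGlue.second_half (G := fun t i u j => G t (-1 - i) u (-1 - j)) t u (-1 - k) (-1 - l)
      (by simpa using h)
    rwa [show -1 - k + 1 = -k by ring, show -1 - l = -(l + 1) by ring] at this
  | second_half t u k l h =>
    have := SubGlue.first_half (G := fun t i u j => G t (-1 - i) u (-1 - j)) t u (-1 - k) (-1 - l)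
      (by simpa using h)
    rwa [show -1 - k = -(k + 1) by ring, show -1 - l + 1 = -l by ring] at this

/-- A map of edges that commutes with the pasting on increasing sets `S n` of tiles. -/
structure EdgeChart {T' : Type} (ν : T' × ZMod 5 → T' × ZMod 5)
    (G : T → ZMod 5 → T → ZMod 5 → Prop)
    (F : T' × ZMod 5 → (T × Option (ZMod 5)) × ZMod 5) (S : ℕ → Set T') : Prop where
  rot : ∀ k x, F (rot k x) = PentHull.rot k (F x)
  mem : ∀ n < 4, ∀ x : T' × ZMod 5, x.1 ∈ S n → (ν x).1 ∈ S (n + 1)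
  glue : ∀ n < 4, ∀ x : T' × ZMod 5, x.1 ∈ S n → EdgeGlue G (F x) (F (ν x))
  inj : ∀ n ≤ 4, ∀ x y : T' × ZMod 5, x.1 ∈ S 0 → y.1 ∈ S n → F y = F x → y = x

variable {T' : Type} {ν : T' × ZMod 5 → T' × ZMod 5}
    {F : T' × ZMod 5 → (T × Option (ZMod 5)) × ZMod 5} {S : ℕ → Set T'}

/-- The conditions hold in the subdivided complex and are transported back. An identity of edges
pulls back because F is injective on tiles reached in at most four steps, the length of the longest
cycle. -/
theorem EdgeChart.isTyping (h : EdgeChart ν G F S) (symm : ∀ {t i u j}, G t i u j → G u j t i)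
    (irrefl : ∀ t i, ¬ G t i t i)
    (unique : ∀ {t i u j u' j'}, G t i u j → G t i u' j' → u = u' ∧ j = j') :
    IsTyping ν (fun x => edgeType (F x)) (S 0) where
  shift k x := by rw [h.rot, edgeType_rot]
  paste x hx := (h.glue 0 (by norm_num) x hx).edgeType_eq
  cycle_three x hx e := by
    have m1 := h.mem 0 (by norm_num) x hx
    have m2 := h.mem 1 (by norm_num) (PentHull.rot 1 (ν x)) m1
    have m3 := h.mem 2 (by norm_num) (PentHull.rot 1 (ν (PentHull.rot 1 (ν x)))) m2
    refine h.inj 3 (by norm_num) (PentHull.rot (-1) x) _ hx m3 ?_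
    have g1 := h.glue 0 (by norm_num) x hx
    have g2 := h.glue 1 (by norm_num) (PentHull.rot 1 (ν x)) m1
    have g3 := h.glue 2 (by norm_num) (PentHull.rot 1 (ν (PentHull.rot 1 (ν x)))) m2
    rw [h.rot] at g2 g3
    rw [h.rot (-1)]
    exact EdgeGlue.cycle_three e g1 g2 g3
  cycle_four x hx e := by
    have m1 := h.mem 0 (by norm_num) x hx
    have m2 := h.mem 1 (by norm_num) (PentHull.rot (-1) (ν x)) m1
    have m3 := h.mem 2 (by norm_num) (PentHull.rot (-1) (ν (PentHull.rot (-1) (ν x)))) m2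
    have m4 := h.mem 3 (by norm_num)
      (PentHull.rot (-1) (ν (PentHull.rot (-1) (ν (PentHull.rot (-1) (ν x)))))) m3
    refine h.inj 4 (by norm_num) x _ hx m4 ?_
    have g1 := h.glue 0 (by norm_num) x hx
    have g2 := h.glue 1 (by norm_num) (PentHull.rot (-1) (ν x)) m1
    have g3 := h.glue 2 (by norm_num) (PentHull.rot (-1) (ν (PentHull.rot (-1) (ν x)))) m2
    have g4 := h.glue 3 (by norm_num)
      (PentHull.rot (-1) (ν (PentHull.rot (-1) (ν (PentHull.rot (-1) (ν x)))))) m3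
    rw [h.rot] at g2 g3 g4
    rw [h.rot (-1)]
    exact EdgeGlue.cycle_four symm unique e g1 g2 g3 g4
  irrefl x hx e hne := by
    have m1 := h.mem 0 (by norm_num) x hx
    have m2 := h.mem 1 (by norm_num) (PentHull.rot 3 (ν x)) m1
    have g1 := h.glue 0 (by norm_num) x hx
    have g2 := h.glue 1 (by norm_num) (PentHull.rot 3 (ν x)) m1
    have g3 := h.glue 2 (by norm_num) (PentHull.rot 3 (ν (PentHull.rot 3 (ν x)))) m2
    rw [h.rot] at g2 g3
    have := congrArg F hne
    rw [h.rot (-1)] at this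
    exact EdgeGlue.ne irrefl e g1 g2 g3 this

/-- The offset of the numbers of edges under a symmetry, up to a reflection. -/
def edgeShift : DihedralGroup 5 → ZMod 5
  | .r a => a
  | .sr a => a

/-- Pasted tiles are both reflected or both not, but P need not be connected. So the tiles split
into two families, each of which carries an edge chart, one into the complex and one into its mirror
image. -/
theorem exists_isTyping_of_indexMap {ν : T' × ZMod 5 → T' × ZMod 5}
    (symm : ∀ {t i u j}, G t i u j → G u j t i) (irrefl : ∀ t i, ¬ G t i t i)
    (unique : ∀ {t i u j u' j'}, G t i u j → G t i u' j' → u = u' ∧ j = j')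
    (h : ∀ P : Set T', P.Finite → ∃ f g,
      IndexMap (fun t i u j => ν (t, i) = (u, j)) (SubGlue G) P f g)
    (P : Set T') (hP : P.Finite) : ∃ c, IsTyping ν c P := by
  classical
  let step (S : Set T') : Set T' := S ∪ ⋃ k : ZMod 5, (fun t => (ν (t, k)).1) '' S
  have step_fin : ∀ S : Set T', S.Finite → (step S).Finite := fun S hS =>
    hS.union (Set.finite_iUnion fun k => hS.image _)
  -- The tiles at most n steps away from P; the cycles to be checked cross at most four edges.
  let B (n : ℕ) : Set T' := step^[n] P
  have hB : ∀ n, (B n).Finite := by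
    intro n
    induction n with
    | zero => exact hP
    | succ n ih => change (step^[n + 1] P).Finite; rw [Function.iterate_succ_apply']; exact step_fin _ ih
  have mono : ∀ n, B n ⊆ B (n + 1) := by
    intro n
    change _ ⊆ step^[n + 1] P
    rw [Function.iterate_succ_apply']
    exact Set.subset_union_left
  have nbr : ∀ n (x : T' × ZMod 5), x.1 ∈ B n → (ν x).1 ∈ B (n + 1) := by
    intro n x hx
    change _ ∈ step^[n + 1] P
    rw [Function.iterate_succ_apply']
    exact Or.inr (Set.mem_iUnion.mpr ⟨x.2, x.1, hx, rfl⟩)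
  have le : ∀ n ≤ 4, B n ⊆ B 4 := fun n hn => monotone_nat_of_le_succ (f := B) mono hn
  obtain ⟨f, g, hfg⟩ := h (B 4) (hB 4)
  have hstep : ∀ n < 4, ∀ x : T' × ZMod 5, x.1 ∈ B n →
      SubGlue G (f x.1) (edgeIdx (g x.1) x.2) (f (ν x).1) (edgeIdx (g (ν x).1) (ν x).2) ∧
        (isRefl (g x.1) ↔ isRefl (g (ν x).1)) := by
    intro n hn x hx
    have h1 := le n hn.le hx
    have h2 := le (n + 1) hn (nbr n x hx)
    exact ⟨hfg.glue h1 h2 rfl, hfg.isRefl_iff h1 h2 rfl⟩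
  let F₁ (x : T' × ZMod 5) : (T × Option (ZMod 5)) × ZMod 5 := (f x.1, edgeShift (g x.1) + x.2)
  let F₂ (x : T' × ZMod 5) : (T × Option (ZMod 5)) × ZMod 5 :=
    (flip (f x.1), edgeShift (g x.1) + x.2)
  have c₁ : EdgeChart ν G F₁ (fun n => {t ∈ B n | ¬ isRefl (g t)}) := by
    refine ⟨fun k x => ?_, fun n hn x hx => ⟨nbr n x hx.1, ?_⟩, fun n hn x hx => ?_,
      fun n hn x y hx hy e => ?_⟩
    · exact Prod.ext rfl (add_assoc _ _ _).symm
    · rw [← (hstep n hn x hx.1).2]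
      exact hx.2
    · obtain ⟨h1, h2⟩ := hstep n hn x hx.1
      have h3 := hx.2
      have h4 := h3
      rw [h2] at h4
      change SubGlue G (f x.1) (edgeShift (g x.1) + x.2) (f (ν x).1) (edgeShift (g (ν x).1) + (ν x).2)
      rcases hg : g x.1 with a | a
      · rcases hg' : g (ν x).1 with b | b
        · rw [hg, hg'] at h1
          exact h1
        · rw [hg'] at h4
          exact absurd trivial h4
      · rw [hg] at h3
        exact absurd trivial h3
    · obtain ⟨e1, e2⟩ := Prod.mk.inj e
      have e3 := hfg.inj (le n hn hy.1) (le 0 (Nat.zero_le _) hx.1) e1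
      rw [e3] at e2
      exact Prod.ext e3 (add_left_cancel e2)
  have c₂ : EdgeChart ν (fun t i u j => G t (-1 - i) u (-1 - j)) F₂
      (fun n => {t ∈ B n | isRefl (g t)}) := by
    refine ⟨fun k x => ?_, fun n hn x hx => ⟨nbr n x hx.1, ?_⟩, fun n hn x hx => ?_,
      fun n hn x y hx hy e => ?_⟩
    · exact Prod.ext rfl (add_assoc _ _ _).symm
    · rw [← (hstep n hn x hx.1).2]
      exact hx.2
    · obtain ⟨h1, h2⟩ := hstep n hn x hx.1
      have h3 := hx.2
      have h4 := h3
      rw [h2] at h4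
      change SubGlue _ (flip (f x.1)) (edgeShift (g x.1) + x.2) (flip (f (ν x).1))
        (edgeShift (g (ν x).1) + (ν x).2)
      rcases hg : g x.1 with a | a
      · rw [hg] at h3
        exact absurd h3 id
      · rcases hg' : g (ν x).1 with b | b
        · rw [hg'] at h4
          exact absurd h4 id
        · rw [hg, hg'] at h1
          have := h1.flip
          simp only [edgeIdx] at this
          rwa [show -1 - (-a - x.2 - 1) = a + x.2 by ring,
            show -1 - (-b - (ν x).2 - 1) = b + (ν x).2 by ring] at this
    · obtain ⟨e1, e2⟩ := Prod.mk.inj e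
      have e3 := hfg.inj (le n hn hy.1) (le 0 (Nat.zero_le _) hx.1) (flip_injective e1)
      rw [e3] at e2
      exact Prod.ext e3 (add_left_cancel e2)
  have t₁ := c₁.isTyping symm irrefl unique
  have t₂ := c₂.isTyping (fun h => symm h) (fun t i => irrefl t _) (fun h h' => by
    obtain ⟨h1, h2⟩ := unique h h'
    exact ⟨h1, sub_right_injective h2⟩)
  -- Flipping does not change the type, so the typings from the two charts are restrictions of a
  -- single one.
  have hF : ∀ x, edgeType (F₂ x) = (edgeType (F₁ x)) := by
    intro x
    change Option.map _ (Option.map _ (f x.1).2) = Option.map _ (f x.1).2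
    rw [Option.map_map]
    rfl
  simp only [hF] at t₂
  refine ⟨fun x => edgeType (F₁ x), t₁.shift, fun x hx => ?_, fun x hx => ?_, fun x hx => ?_,
    fun x hx => ?_⟩
  all_goals by_cases hr : isRefl (g x.1)
  · exact t₂.paste x ⟨hx, hr⟩
  · exact t₁.paste x ⟨hx, hr⟩
  · exact t₂.cycle_three x ⟨hx, hr⟩
  · exact t₁.cycle_three x ⟨hx, hr⟩
  · exact t₂.cycle_four x ⟨hx, hr⟩
  · exact t₁.cycle_four x ⟨hx, hr⟩
  · exact t₂.irrefl x ⟨hx, hr⟩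
  · exact t₁.irrefl x ⟨hx, hr⟩

end Charts

/-! ### Desubstitution of tilings -/

theorem edgeIdx_mul (g h : DihedralGroup 5) (k : ZMod 5) :
    edgeIdx (g * h) k = edgeIdx g (edgeIdx h k) := by
  rcases g with i | i <;> rcases h with j | j <;>
    simp only [DihedralGroup.r_mul_r, DihedralGroup.r_mul_sr, DihedralGroup.sr_mul_r,
      DihedralGroup.sr_mul_sr, edgeIdx] <;> ring

theorem isRefl_mul_r (g : DihedralGroup 5) (a : ZMod 5) : isRefl (g * .r a) ↔ isRefl g := by
  rcases g with i | i
  · rw [DihedralGroup.r_mul_r]; exact Iff.rfl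
  · rw [DihedralGroup.sr_mul_r]; exact Iff.rfl

namespace PentComplex

variable {X : Type}

/-- A bijection of the tiles that preserves the pasting induces a bijection of the points. -/
theorem exists_equiv_of_glue {L M : PentComplex X} {f : L.tile → M.tile}
    (hf : Function.Bijective f) (a : L.tile → ZMod 5)
    (h : ∀ t i u j, L.glue t i u j ↔ M.glue (f t) (a t + i) (f u) (a u + j)) :
    ∃ φ : L.Point ≃ M.Point, ∀ t p, φ (L.pt t p) = M.pt (f t) (symP (.r (a t)) p) := by
  let F : (Σ _ : L.tile, Pent) → (Σ _ : M.tile, Pent) := fun x => ⟨f x.1, symP (.r (a x.1)) x.2⟩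
  have hF : Function.Bijective F := by
    constructor
    · rintro ⟨t, p⟩ ⟨u, q⟩ e
      obtain ⟨e1, e2⟩ := Sigma.mk.inj e
      obtain rfl := hf.1 e1
      exact congrArg (Sigma.mk t) (symP_injective _ (eq_of_heq e2))
    · rintro ⟨t', q⟩
      obtain ⟨t, rfl⟩ := hf.2 t'
      exact ⟨⟨t, symP (.r (a t))⁻¹ q⟩, by simp only [F, symP_symP_inv]⟩
  have hedge : ∀ (b k : ZMod 5) s, symP (.r b) (edgeP k s) = edgeP (b + k) s := fun b k s =>
    Subtype.ext (sym_edgePt (.r b) k s)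
  have hrel : ∀ x y, L.PointGlue x y ↔ M.PointGlue (F x) (F y) := by
    rintro ⟨t, p⟩ ⟨u, q⟩
    rw [pointGlue_iff, pointGlue_iff]
    constructor
    · rintro ⟨i, j, s, hg, hp, hq⟩
      change p = _ at hp
      change q = _ at hq
      subst hp hq
      exact ⟨_, _, s, (h _ _ _ _).mp hg, hedge _ _ _, hedge _ _ _⟩
    · rintro ⟨i, j, s, hg, hp, hq⟩
      refine ⟨i - a t, j - a u, s, (h _ _ _ _).mpr ?_, ?_, ?_⟩
      · rw [add_sub_cancel, add_sub_cancel]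
        exact hg
      · refine symP_injective (.r (a t)) ?_
        rw [hedge, add_sub_cancel]
        exact hp
      · refine symP_injective (.r (a u)) ?_
        rw [hedge, add_sub_cancel]
        exact hq
  exact ⟨Quot.congr (Equiv.ofBijective F hF) hrel, fun t p => rfl⟩

/-- The edge that is pasted to a given edge of a tiling. -/
theorem IsTiling.exists_paste {M : PentComplex X} (hM : M.IsTiling) :
    ∃ ν : M.tile × ZMod 5 → M.tile × ZMod 5, Function.Involutive ν ∧
      ∀ t i u j, ν (t, i) = (u, j) ↔ M.glue t i u j := by
  choose ν hν huniq using fun x : M.tile × ZMod 5 => hM.closed x.1 x.2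
  have key : ∀ t i u j, ν (t, i) = (u, j) ↔ M.glue t i u j := by
    intro t i u j
    refine ⟨fun e => ?_, fun h => (huniq (t, i) (u, j) h).symm⟩
    have := hν (t, i)
    rw [e] at this
    exact this
  refine ⟨ν, fun x => ?_, key⟩
  exact (key _ _ _ _).mpr (hM.symm _ _ _ _ (hν x))

end PentComplex

namespace Decoration

open PentComplex

variable {X : Type} [MulAction (DihedralGroup 5) X] (D : Decoration X)

/-- The decorations of the tiles of the subdivision of a tile. -/
def cellDeco (x : X) : Option (ZMod 5) → X
  | none => D.centre x
  | some k => D.outer x k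

variable {D}

theorem deco_subst (L : PentComplex X) (t : L.tile) (o : Option (ZMod 5)) :
    (D.subst L).deco (t, o) = D.cellDeco (L.deco t) o := by cases o <;> rfl

theorem cellDeco_smul (g : DihedralGroup 5) (x : X) (o : Option (ZMod 5)) :
    D.cellDeco (g • x) (cellIdx g o) = cellSym g o • D.cellDeco x o := by
  cases o with
  | none => exact D.centre_smul g x
  | some k => exact D.outer_smul g x k

theorem IsoMap.continuous {n : ℕ} {L L' : PentComplex X} {φ : L.Point ≃ L'.Point}
    (h : D.IsoMap n L L' φ) : Continuous φ := by
  rw [continuous_iff_isClosed]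
  intro C hC
  rw [isClosed_iff] at hC ⊢
  intro t
  obtain ⟨t', g, -, hp⟩ := h t
  have := (hC t').preimage (continuous_symP g)
  rw [Set.preimage_ofPred_eq] at this
  simp only [← hp] at this
  exact this

/-- An isomorphism of complexes is a homeomorphism. -/
def IsoMap.toHomeomorph {n : ℕ} {L L' : PentComplex X} {φ : L.Point ≃ L'.Point}
    (h : D.IsoMap n L L' φ) : L.Point ≃ₜ L'.Point where
  toEquiv := φ
  continuous_toFun := h.continuous
  continuous_invFun := h.symm.continuous

/-- A tiling that is locally isomorphic to `K` is the subdivision of a tiling that is locally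
isomorphic to `K`, up to decorations that agree after some substitutions. -/
theorem exists_desubstitution {n : ℕ} {M : PentComplex X} (hM : M.IsTiling)
    (hK : D.LocIso n M D.limitK) : ∃ L : PentComplex X, L.IsTiling ∧ D.LocIso (n + 1) L D.limitK ∧
      ∃ φ, D.IsoMap n (D.subst L) M φ := by
  -- Patches are charted in ω(K) instead of K, since there the subdivided tiles are given.
  have hωK : D.LocIso n M (D.subst D.limitK) :=
    hK.trans (locIso_limitK_subst.mono (Nat.zero_le n))
  have hP := isPasting_limitK (D := D)
  have hωP := IsPasting.subst (D := D) hP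
  obtain ⟨ν, hν, hglue⟩ := hM.exists_paste
  have charts : ∀ P : Set M.tile, P.Finite → ∃ f g,
      IndexMap (fun t i u j => ν (t, i) = (u, j)) (SubGlue D.limitK.glue) P f g ∧
        ∀ t ∈ P, D.Eqv n ((D.subst D.limitK).deco (f t)) (g t • M.deco t) := by
    intro P hP
    obtain ⟨φ, hφ⟩ := hωK P hP
    obtain ⟨f, g, hfg⟩ := exists_tile_choice hφ.tile
    have := indexMap_of_tiles hM.isPasting hωP (fun a ha => (hfg a ha).2) hφ.centre_inj
    exact ⟨f, g, ⟨this.inj, fun ht hu e => this.glue ht hu ((hglue _ _ _ _).mp e),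
      fun ht hu e => this.isRefl_iff ht hu ((hglue _ _ _ _).mp e)⟩, fun t ht => (hfg t ht).1⟩
  obtain ⟨c, hc⟩ := exists_isTyping_univ ν (exists_isTyping_of_indexMap (ν := ν)
    (G := D.limitK.glue) (fun h => hP.symm h) hP.irrefl (fun h h' => hP.unique h h')
    fun P hP => by
      obtain ⟨f, g, h, -⟩ := charts P hP
      exact ⟨f, g, h⟩)
  let Ψ (a : CentralTile c × Option (ZMod 5)) : M.tile := (composedEdge ν c a 0).1
  let off (a : CentralTile c × Option (ZMod 5)) : ZMod 5 := (composedEdge ν c a 0).2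
  have hΨ : Function.Bijective Ψ := hc.composedEdge_bijective hν
  have hedge : ∀ a i, composedEdge ν c a i = (Ψ a, off a + i) := by
    intro a i
    have := composedEdge_add (ν := ν) a 0 i
    rwa [zero_add] at this
  have hpaste : ∀ {a b i j}, SubGlue (composedGlue ν c) a i b j →
      ν (Ψ a, off a + i) = (Ψ b, off b + j) := by
    intro a b i j h
    rw [← hedge, ← hedge]
    exact hc.paste_composedEdge hν h
  -- A chart on the six tiles of one composed tile carries them, by recognition, onto the
  -- subdivision of a tile t' of K. The decoration of t', moved back by the symmetry of the central
  -- tile, is the one sought; it is correct only up to level n on the six tiles.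
  have hdeco : ∀ t : CentralTile c, ∃ x : X, ∀ o,
      D.Eqv n (M.deco (Ψ (t, o))) (DihedralGroup.r (off (t, o)) • D.cellDeco x o) := by
    intro t
    obtain ⟨f, g, hfg, hd⟩ := charts (Set.range fun o => Ψ (t, o)) (Set.finite_range _)
    have hi : IndexMap (SubGlue (composedGlue ν c)) (SubGlue D.limitK.glue) {a | a.1 = t}
        (fun a => f (Ψ a)) (fun a => g (Ψ a) * .r (off a)) := by
      have mem : ∀ a : CentralTile c × Option (ZMod 5), a.1 = t →
          Ψ a ∈ Set.range fun o => Ψ (t, o) := by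
        rintro ⟨u, o⟩ rfl
        exact ⟨o, rfl⟩
      refine ⟨?_, fun ha hb h => ?_, fun ha hb h => ?_⟩
      · intro a ha b hb e
        exact hΨ.1 (hfg.inj (mem a ha) (mem b hb) e)
      · have := hfg.glue (mem _ ha) (mem _ hb) (hpaste h)
        rw [edgeIdx_mul, edgeIdx_mul]
        exact this
      · rw [isRefl_mul_r, isRefl_mul_r]
        exact hfg.isRefl_iff (mem _ ha) (mem _ hb) (hpaste h)
    obtain ⟨t', ht'⟩ := hi.recognition (t := t) fun _ => rfl
    set G := g (Ψ (t, none)) * .r (off (t, none)) with hG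
    refine ⟨G⁻¹ • D.limitK.deco t', fun o => ?_⟩
    obtain ⟨e1, e2⟩ := ht' o
    have h1 := hd _ ⟨o, rfl⟩
    change D.Eqv n ((D.subst D.limitK).deco (f (Ψ (t, o)))) _ at h1
    change f (Ψ (t, o)) = _ at e1
    change g (Ψ (t, o)) * _ = _ at e2
    rw [e1, deco_subst] at h1
    have h2 := cellDeco_smul (D := D) G (G⁻¹ • D.limitK.deco t') o
    rw [smul_inv_smul] at h2
    rw [h2, ← e2, mul_smul] at h1
    have h3 := h1.symm.smul (g (Ψ (t, o)))⁻¹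
    rwa [inv_smul_smul, inv_smul_smul] at h3
  choose x hx using hdeco
  let L : PentComplex X := ⟨CentralTile c, composedGlue ν c, x⟩
  have hL : L.IsPasting := by
    refine ⟨hc.composedGlue_symm hν, hc.composedGlue_irrefl, fun h h' => ?_⟩
    have := (hc.composedGlue_closed _ _).unique (y₁ := (_, _)) (y₂ := (_, _)) h h'
    exact Prod.mk.inj this
  have hiff : ∀ a i b j, (D.subst L).glue a i b j ↔ M.glue (Ψ a) (off a + i) (Ψ b) (off b + j) := by
    intro a i b j
    rw [← hglue]
    refine ⟨hpaste, fun h => ?_⟩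
    -- For the converse, the edge has some partner in the subdivision, and uniqueness of partners in
    -- M identifies it with (b, j).
    obtain ⟨b', j', h'⟩ := exists_glue_subst (D := D) (L := L) (fun t k => by
      obtain ⟨e, he, -⟩ := hc.composedGlue_closed t k
      exact ⟨e.1, e.2, he⟩) a i
    obtain ⟨e1, e2⟩ := Prod.mk.inj ((hpaste h').symm.trans h)
    obtain rfl := hΨ.1 e1
    obtain rfl := add_left_cancel e2
    exact h'
  obtain ⟨φ, hφ⟩ := exists_equiv_of_glue (L := D.subst L) (M := M) hΨ off hiff
  have hiso : D.IsoMap n (D.subst L) M φ := by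
    rintro ⟨t, o⟩
    refine ⟨Ψ (t, o), .r (off (t, o)), ?_, hφ (t, o)⟩
    rw [deco_subst]
    exact hx t o
  refine ⟨L, ⟨fun _ _ _ _ => hL.symm, hL.irrefl, hc.composedGlue_closed, ?_⟩,
    LocIso.pull hL hP (hiso.locIso.trans hωK), φ, hiso⟩
  exact hM.plane.map fun e => (D.mapHomeo L).trans (hiso.toHomeomorph.trans e)

end Decoration

/-! ### Iterated substitution -/

namespace Decoration

open PentComplex

variable {X : Type} [MulAction (DihedralGroup 5) X] (D : Decoration X)

/-- The `n`-fold subdivision. -/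
def iter : ℕ → PentComplex X → PentComplex X
  | 0, L => L
  | n + 1, L => iter n (D.subst L)

theorem subst_iter (n : ℕ) (L : PentComplex X) : D.subst (D.iter n L) = D.iter (n + 1) L := by
  induction n generalizing L with
  | zero => rfl
  | succ n ih => exact ih (D.subst L)

/-- The `n`-fold substitution of points. -/
def iterPt : (n : ℕ) → (L : PentComplex X) → L.Point ≃ (D.iter n L).Point
  | 0, _ => Equiv.refl _
  | n + 1, L => (D.mapEquiv L).trans (iterPt n (D.subst L))

/-- The complexes with a point are isomorphic up to decorations that agree after `n`
substitutions. -/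
def Sim (n : ℕ) (L : PentComplex X) (x : L.Point) (L' : PentComplex X) (x' : L'.Point) : Prop :=
  ∃ φ, D.IsoMap n L L' φ ∧ φ x = x'

variable {D}

theorem Sim.symm {n : ℕ} {L : PentComplex X} {x : L.Point} {L' : PentComplex X} {x' : L'.Point}
    (h : D.Sim n L x L' x') : D.Sim n L' x' L x := by
  obtain ⟨φ, h, rfl⟩ := h
  exact ⟨φ.symm, h.symm, φ.symm_apply_apply x⟩

theorem Sim.trans {n : ℕ} {L : PentComplex X} {x : L.Point} {L' : PentComplex X} {x' : L'.Point}
    {L'' : PentComplex X} {x'' : L''.Point} (h : D.Sim n L x L' x') (h' : D.Sim n L' x' L'' x'') :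
    D.Sim n L x L'' x'' := by
  obtain ⟨φ, h, rfl⟩ := h
  obtain ⟨ψ, h', rfl⟩ := h'
  exact ⟨_, h.trans h', rfl⟩

theorem Sim.mono {m n : ℕ} (hmn : m ≤ n) {L : PentComplex X} {x : L.Point} {L' : PentComplex X}
    {x' : L'.Point} (h : D.Sim m L x L' x') : D.Sim n L x L' x' := by
  obtain ⟨φ, h, rfl⟩ := h
  exact ⟨φ, h.mono hmn, rfl⟩

theorem Sim.push {n : ℕ} {L : PentComplex X} {x : L.Point} {L' : PentComplex X} {x' : L'.Point}
    (h : D.Sim (n + 1) L x L' x') :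
    D.Sim n (D.subst L) (D.mapEquiv L x) (D.subst L') (D.mapEquiv L' x') := by
  obtain ⟨φ, h, rfl⟩ := h
  refine ⟨_, h.push, ?_⟩
  simp

theorem Sim.pull {n : ℕ} {L : PentComplex X} {x : L.Point} {L' : PentComplex X} {x' : L'.Point}
    (hL : L.IsPasting) (hL' : L'.IsPasting)
    (h : D.Sim n (D.subst L) (D.mapEquiv L x) (D.subst L') (D.mapEquiv L' x')) :
    D.Sim (n + 1) L x L' x' := by
  obtain ⟨φ, h, hx⟩ := h
  refine ⟨_, h.pull hL hL', ?_⟩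
  simp [hx]

theorem Sim.push_iter {n : ℕ} {L : PentComplex X} {x : L.Point} {L' : PentComplex X}
    {x' : L'.Point} (h : D.Sim n L x L' x') :
    D.Sim 0 (D.iter n L) (D.iterPt n L x) (D.iter n L') (D.iterPt n L' x') := by
  induction n generalizing L L' with
  | zero => exact h
  | succ n ih => exact ih h.push

theorem Sim.pull_iter {n k : ℕ} {L : PentComplex X} {x : L.Point} {L' : PentComplex X}
    {x' : L'.Point} (hL : L.IsPasting) (hL' : L'.IsPasting)
    (h : D.Sim k (D.iter n L) (D.iterPt n L x) (D.iter n L') (D.iterPt n L' x')) :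
    D.Sim (k + n) L x L' x' := by
  induction n generalizing L L' with
  | zero => exact h
  | succ n ih => exact (ih (IsPasting.subst hL) (IsPasting.subst hL') h).pull hL hL'

theorem isTiling_iter {L : PentComplex X} (hL : L.IsTiling) (n : ℕ) : (D.iter n L).IsTiling := by
  induction n generalizing L with
  | zero => exact hL
  | succ n ih => exact ih (isTiling_subst hL)

theorem locIso_iter {n : ℕ} {L : PentComplex X} (h : D.LocIso n L D.limitK) :
    D.LocIso 0 (D.iter n L) D.limitK := by
  induction n generalizing L with
  | zero => exact h
  | succ n ih => exact ih (locIso_subst h)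

theorem inHull_iter {n : ℕ} {L : PentComplex X} (hL : L.IsTiling) (h : D.LocIso n L D.limitK) :
    D.InHull (D.iter n L) := inHull_iff.mpr ⟨isTiling_iter hL n, locIso_iter h⟩

/-- Each desubstitution recovers decorations only to the current level n. The resulting isomorphism
of level n becomes exact after n substitutions, which are applied anyway. -/
theorem exists_iter_desubstitution {M : PentComplex X} (hM : D.InHull M) (n : ℕ) :
    ∃ L : PentComplex X, L.IsTiling ∧ D.LocIso n L D.limitK ∧ ∃ φ, D.IsoMap 0 (D.iter n L) M φ := by
  induction n with
  | zero => exact ⟨M, hM.1, (inHull_iff.mp hM).2, _, IsoMap.refl 0 M⟩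
  | succ n ih =>
    obtain ⟨L, hL, hK, φ, hφ⟩ := ih
    obtain ⟨L', hL', hK', ψ, hψ⟩ := exists_desubstitution hL hK
    have push : ∀ (n : ℕ) {A B : PentComplex X} {θ : A.Point ≃ B.Point}, D.IsoMap n A B θ →
        ∃ η, D.IsoMap 0 (D.iter n A) (D.iter n B) η := by
      intro n
      induction n with
      | zero => exact fun h => ⟨_, h⟩
      | succ n ih => exact fun h => ih h.push
    obtain ⟨η, hη⟩ := push n hψ
    exact ⟨L', hL', hK', _, hη.trans hφ⟩

theorem exists_sim_iter {M : PentComplex X} (hM : D.InHull M) (y : M.Point) (n : ℕ) :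
    ∃ (L : PentComplex X) (x : L.Point), L.IsTiling ∧ D.InHull (D.iter n L) ∧
      D.Sim 0 (D.iter n L) (D.iterPt n L x) M y := by
  obtain ⟨L, hL, hK, φ, hφ⟩ := exists_iter_desubstitution hM n
  exact ⟨L, (D.iterPt n L).symm (φ.symm y), hL, inHull_iter hL hK, φ, hφ, by simp⟩

/-- Whether decorations agree after some substitutions depends only on a bounded number of
substitutions. -/
theorem eqv_of_stable {N : ℕ} (hN : ∀ x y, D.Eqv (N + 1) x y → D.Eqv N x y) {L L' : PentComplex X}
    {φ : L.Point → L'.Point} {S : Set L.tile} (h : D.PatchMap (N + 1) L L' φ S) :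
    D.PatchMap N L L' φ S := by
  refine ⟨h.inj, fun t ht => ?_⟩
  obtain ⟨t', g, hd, hp⟩ := h.tile t ht
  exact ⟨t', g, hN _ _ hd, hp⟩

theorem Sim.of_stable {N : ℕ} (hN : ∀ x y, D.Eqv (N + 1) x y → D.Eqv N x y) {L : PentComplex X}
    {x : L.Point} {L' : PentComplex X} {x' : L'.Point} (h : D.Sim (N + 1) L x L' x') :
    D.Sim N L x L' x' := by
  obtain ⟨φ, h, hx⟩ := h
  exact ⟨φ, fun t => (eqv_of_stable hN (h.patchMap Set.univ)).tile t trivial, hx⟩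

/-! ### The substitution on the hull -/

theorem toHull_eq_iff {L : PentComplex X} {hL : D.InHull L} {x : L.Point} {L' : PentComplex X}
    {hL' : D.InHull L'} {x' : L'.Point} :
    D.toHull L hL x = D.toHull L' hL' x' ↔ D.Sim 0 L x L' x' := by
  refine Quotient.eq.trans ⟨?_, ?_⟩
  · rintro ⟨φ, h, hx⟩
    exact ⟨φ, isoMap_zero_iff.mpr h, hx⟩
  · rintro ⟨φ, h, hx⟩
    exact ⟨φ, isoMap_zero_iff.mp h, hx⟩

theorem exists_toHull (a : D.Hull) : ∃ L hL x, D.toHull L hL x = a := by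
  obtain ⟨u, rfl⟩ := Quotient.exists_rep a
  exact ⟨u.L, u.inHull, u.x, rfl⟩

variable (D)

/-- The substitution map of the continuous hull. -/
def hullMap : D.Hull → D.Hull :=
  Quotient.lift (fun u => D.toHull (D.subst u.L) (inHull_subst u.inHull) (D.mapEquiv u.L u.x)) (by
    rintro u v ⟨φ, h, hx⟩
    have h0 : D.Sim 0 u.L u.x v.L v.x := ⟨φ, isoMap_zero_iff.mpr h, hx⟩
    exact toHull_eq_iff.mpr (h0.mono (Nat.zero_le 1)).push)

theorem hullMap_toHull (L : PentComplex X) (hL : D.InHull L) (x : L.Point) :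
    D.hullMap (D.toHull L hL x) = D.toHull (D.subst L) (inHull_subst hL) (D.mapEquiv L x) := rfl

/-- Write both tilings as ω^N of tilings A and A'. An isomorphism of the images, pulled back N + 1
times, has level N + 1; stability lowers this to N, and N pushes make it exact again. -/
theorem hullMap_injective [Finite X] : Function.Injective D.hullMap := by
  obtain ⟨N, hN⟩ := D.exists_eqv_stable
  intro a b h
  obtain ⟨L, hL, x, rfl⟩ := exists_toHull a
  obtain ⟨L', hL', x', rfl⟩ := exists_toHull b
  rw [hullMap_toHull, hullMap_toHull, toHull_eq_iff] at h
  obtain ⟨A, a, hA, -, h1⟩ := exists_sim_iter hL x N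
  obtain ⟨A', a', hA', -, h2⟩ := exists_sim_iter hL' x' N
  have h4 := (h1.mono (Nat.zero_le 1)).push.trans (h.trans (h2.symm.mono (Nat.zero_le 1)).push)
  have h5 := h4.pull (isTiling_iter hA N).isPasting (isTiling_iter hA' N).isPasting
  have h6 := h5.pull_iter hA.isPasting hA'.isPasting
  rw [zero_add, add_comm] at h6
  rw [toHull_eq_iff]
  exact h1.symm.trans ((h6.of_stable hN).push_iter.trans h2)

/-- After N + 1 desubstitutions local isomorphism to K is known at level N + 1. Stability improves
this to N, so N substitutions already lead into the hull, and one more returns to the given tiling.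
-/
theorem hullMap_surjective [Finite X] : Function.Surjective D.hullMap := by
  obtain ⟨N, hN⟩ := D.exists_eqv_stable
  intro a
  obtain ⟨M, hM, y, rfl⟩ := exists_toHull a
  obtain ⟨L, hL, hK, h⟩ := exists_iter_desubstitution hM (N + 1)
  have hK' : D.LocIso N L D.limitK := fun P hP => by
    obtain ⟨φ, hφ⟩ := hK P hP
    exact ⟨φ, eqv_of_stable hN hφ⟩
  rw [← subst_iter] at h
  obtain ⟨φ, hφ⟩ := h
  refine ⟨D.toHull (D.iter N L) (inHull_iter hL hK') ((D.mapEquiv _).symm (φ.symm y)), ?_⟩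
  rw [hullMap_toHull, toHull_eq_iff]
  exact ⟨φ, hφ, by simp⟩

end Decoration

/-! ### Nearness in the hull -/

namespace Decoration

open PentComplex

variable {X : Type} [MulAction (DihedralGroup 5) X] {D : Decoration X}

/-- The tiles that meet the closed ball of radius `R` about `x`. -/
def tilesNear (L : PentComplex X) (x : L.Point) (R : ℝ) : Set L.tile :=
  {t | ∃ p, L.pathDist x (L.pt t p) ≤ R}

omit [MulAction (DihedralGroup 5) X] in
theorem tilesNear_mono {L : PentComplex X} {x : L.Point} {R R' : ℝ} (h : R ≤ R') :
    tilesNear L x R ⊆ tilesNear L x R' := fun _ ⟨p, hp⟩ => ⟨p, hp.trans h⟩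

omit [MulAction (DihedralGroup 5) X] in
theorem pathDist_pt_le (L : PentComplex X) (t : L.tile) (p q : Pent) :
    L.pathDist (L.pt t p) (L.pt t q) ≤ 2 * circumradius :=
  (pathDist_le (PathLength.single L t p q)).trans (dist_pent_le p q)

/-- The image of a path under a map of tiles. -/
theorem PathLength.map {n : ℕ} {L L' : PentComplex X} {φ : L.Point → L'.Point} {y z : L.Point}
    {l : ℝ} (h : L.PathLength y z l) (hφ : ∀ t p, L.pathDist y (L.pt t p) ≤ l →
      D.TileMap n L L' φ t) (hL : L.IsJoined) : L'.PathLength (φ y) (φ z) l := by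
  induction h with
  | nil => exact .nil _
  | cons t p q z l h ih =>
    obtain ⟨t', g, -, e⟩ := hφ t p (by
      rw [pathDist_self]
      have := h.nonneg
      positivity)
    rw [e p, ← dist_symP g p q]
    refine .cons t' _ _ _ _ ?_
    rw [← e q]
    refine ih fun u r hu => hφ u r ?_
    have h1 := hL.pathDist_triangle (L.pt t p) (L.pt t q) (L.pt u r)
    have h2 := pathDist_le (PathLength.single L t p q)
    linarith

theorem IsoMap.pathDist_le {n : ℕ} {L L' : PentComplex X} {φ : L.Point ≃ L'.Point}
    (h : D.IsoMap n L L' φ) (hL : L.IsJoined) (y z : L.Point) :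
    L'.pathDist (φ y) (φ z) ≤ L.pathDist y z := by
  refine le_of_forall_pos_lt_add fun ε hε => ?_
  obtain ⟨l, hl, hp⟩ := hL.exists_path (lt_add_of_pos_right (L.pathDist y z) hε)
  exact (PentComplex.pathDist_le (PathLength.map (φ := φ) hp (fun t _ _ => h t) hL)).trans_lt hl

theorem IsoMap.pathDist_eq {n : ℕ} {L L' : PentComplex X} {φ : L.Point ≃ L'.Point}
    (h : D.IsoMap n L L' φ) (hL : L.IsJoined) (hL' : L'.IsJoined) (y z : L.Point) :
    L'.pathDist (φ y) (φ z) = L.pathDist y z := by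
  refine le_antisymm (h.pathDist_le hL y z) ?_
  have := h.symm.pathDist_le hL' (φ y) (φ z)
  rwa [Equiv.symm_apply_apply, Equiv.symm_apply_apply] at this

/-- All tiles at the image of a point come from tiles at the point. -/
theorem exists_lift {L L' : PentComplex X} (hL : L.IsTiling) (hL' : L'.IsPasting)
    {φ : L.Point → L'.Point} {S : Set L.tile} {f : L.tile → L'.tile}
    {g : L.tile → DihedralGroup 5} (hf : ∀ t ∈ S, ∀ p, φ (L.pt t p) = L'.pt (f t) (symP (g t) p))
    (hinj : ∀ t ∈ S, ∀ u ∈ S, φ (L.pt t centreP) = φ (L.pt u centreP) → t = u) {y : L.Point}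
    (hy : ∀ t p, L.pt t p = y → t ∈ S) {w : L'.tile} {q : Pent} (h : φ y = L'.pt w q) :
    ∃ t p, L.pt t p = y ∧ f t = w ∧ symP (g t) p = q := by
  have hi := indexMap_of_tiles hL.isPasting hL' hf hinj
  let P (w : L'.tile) (q : Pent) : Prop := ∃ t p, L.pt t p = y ∧ f t = w ∧ symP (g t) p = q
  have key : ∀ v i w j s, L'.glue v i w j → P v (edgeP i s) → P w (edgeP j (revPar s)) := by
    rintro v i w j s hg ⟨t, p, hp, rfl, e⟩
    obtain ⟨k, rfl⟩ := edgeIdx_surjective (g t) i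
    have hs : ∃ r, symP (g t) (edgeP k r) = edgeP (edgeIdx (g t) k) s := by
      rcases hgt : g t with a | a
      · exact ⟨s, Subtype.ext (sym_edgePt (.r a) k s)⟩
      · refine ⟨revPar s, Subtype.ext ((sym_edgePt (.sr a) k (revPar s)).trans ?_)⟩
        exact congrArg (fun r => (edgeP (edgeIdx (.sr a) k) r : ℂ)) (revPar_revPar s)
    obtain ⟨r, hr⟩ := hs
    obtain rfl : p = edgeP k r := symP_injective (g t) (e.trans hr.symm)
    obtain ⟨⟨u, l⟩, hu, -⟩ := hL.closed t k
    change L.glue t k u l at hu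
    have e1 := pt_edgeP hu r
    rw [hp] at e1
    have htS := hy t _ hp
    have huS := hy u _ e1.symm
    obtain ⟨rfl, rfl⟩ := hL'.unique (hi.glue htS huS hu) hg
    refine ⟨u, edgeP l (revPar r), e1.symm, rfl, ?_⟩
    have hk := hi.isRefl_iff htS huS hu
    rcases hgt : g t with a | a <;> rcases hgu : g u with b | b <;> rw [hgt, hgu] at hk <;>
      rw [hgt] at hr
    · have h1 := hr.symm.trans (Subtype.ext (sym_edgePt (.r a) k r) :
        symP (.r a) (edgeP k r) = edgeP (edgeIdx (.r a) k) r)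
      have h2 : s = r := Subtype.ext (edgePt_inj_param (congrArg Subtype.val h1))
      rw [h2]
      exact Subtype.ext (sym_edgePt (.r b) l (revPar r))
    · exact absurd (hk.mpr trivial) id
    · exact absurd (hk.mp trivial) id
    · have h1 := hr.symm.trans (Subtype.ext (sym_edgePt (.sr a) k r) :
        symP (.sr a) (edgeP k r) = edgeP (edgeIdx (.sr a) k) (revPar r))
      have h2 : s = revPar r := Subtype.ext (edgePt_inj_param (congrArg Subtype.val h1))
      rw [h2]
      exact Subtype.ext (sym_edgePt (.sr b) l (revPar r))
  obtain ⟨t, p, rfl⟩ := exists_pt y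
  have h' := h
  rw [hf t (hy t p rfl)] at h'
  exact (pt_transfer P (fun v i w j s hg => ⟨key v i w j s hg, fun hP => by
    have := key w j v i (revPar s) (hL'.symm hg) hP
    rwa [revPar_revPar] at this⟩) h').mp ⟨t, p, rfl, rfl, rfl⟩

/-- Paths in the image lift. -/
theorem exists_path_lift {L L' : PentComplex X} (hL : L.IsTiling) (hL' : L'.IsPasting)
    {φ : L.Point → L'.Point} {S : Set L.tile} {f : L.tile → L'.tile}
    {g : L.tile → DihedralGroup 5} (hf : ∀ t ∈ S, ∀ p, φ (L.pt t p) = L'.pt (f t) (symP (g t) p))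
    (hinj : ∀ t ∈ S, ∀ u ∈ S, φ (L.pt t centreP) = φ (L.pt u centreP) → t = u) {y' z' : L'.Point}
    {l : ℝ} (h : L'.PathLength y' z' l) (y : L.Point) (hy : φ y = y')
    (hS : ∀ t p, L.pathDist y (L.pt t p) ≤ l → t ∈ S) :
    ∃ z, φ z = z' ∧ L.PathLength y z l := by
  induction h generalizing y with
  | nil => exact ⟨y, hy, .nil y⟩
  | cons w p q z' l h ih =>
    have hl := h.nonneg
    obtain ⟨t, p₀, rfl, rfl, rfl⟩ := exists_lift hL hL' hf hinj (y := y) (fun t r e => hS t r (by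
      rw [e, pathDist_self]
      positivity)) hy
    have ht : t ∈ S := hS t p₀ (by rw [pathDist_self]; positivity)
    have hd : dist (symP (g t) p₀) q = dist p₀ (symP (g t)⁻¹ q) := by
      rw [← dist_symP (g t) p₀, symP_symP_inv]
    rw [hd] at hS ⊢
    obtain ⟨z, hz, hp⟩ := ih (L.pt t (symP (g t)⁻¹ q)) (by rw [hf t ht, symP_symP_inv])
      fun u r hu => hS u r (by
        have h1 := hL.isJoined.pathDist_triangle (L.pt t p₀) (L.pt t (symP (g t)⁻¹ q)) (L.pt u r)
        have h2 := PentComplex.pathDist_le (PathLength.single L t p₀ (symP (g t)⁻¹ q))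
        linarith)
    exact ⟨z, hz, .cons t _ _ _ _ hp⟩

variable (D)

/-- There is a map of patches from the tiles near `x` to `L'` that moves `x` to within `r`
of `x'`. -/
def PatchNear (n : ℕ) (L : PentComplex X) (x : L.Point) (L' : PentComplex X) (x' : L'.Point)
    (R r : ℝ) : Prop :=
  ∃ φ, D.PatchMap n L L' φ (tilesNear L x R) ∧ L'.pathDist (φ x) x' ≤ r

variable {D}

theorem PatchNear.mono {m n : ℕ} (hmn : m ≤ n) {L : PentComplex X} {x : L.Point}
    {L' : PentComplex X} {x' : L'.Point} {R r R' r' : ℝ} (h : D.PatchNear m L x L' x' R r)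
    (hR : R' ≤ R) (hr : r ≤ r') : D.PatchNear n L x L' x' R' r' := by
  obtain ⟨φ, h, hx⟩ := h
  exact ⟨φ, h.mono hmn (tilesNear_mono hR), hx.trans hr⟩

theorem PatchNear.push {n : ℕ} {L : PentComplex X} {x : L.Point} {L' : PentComplex X}
    {x' : L'.Point} (hL : L.IsJoined) (hL' : L'.IsJoined) {R r : ℝ}
    (h : D.PatchNear (n + 1) L x L' x' R r) :
    D.PatchNear n (D.subst L) (D.mapEquiv L x) (D.subst L') (D.mapEquiv L' x')
      (R / lipConst) (lipConst * r) := by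
  obtain ⟨φ, h, hx⟩ := h
  refine ⟨D.push L L' φ, h.push.mono le_rfl ?_, ?_⟩
  · rintro ⟨t, o⟩ ⟨q, hq⟩
    obtain ⟨p, hc⟩ := exists_cell_of_right o q
    refine ⟨p, ?_⟩
    have h1 := D.pathDist_le_map hL x (L.pt t p)
    rw [D.mapEquiv_pt L t hc] at h1
    have h2 := (le_div_iff₀' lipConst_pos).mp hq
    exact h1.trans h2
  · rw [Decoration.push, Function.comp_apply, Function.comp_apply, Equiv.symm_apply_apply]
    exact (D.pathDist_map_le hL' _ _).trans (mul_le_mul_of_nonneg_left hx lipConst_pos.le)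

/-- All six new tiles of a tile are needed for recognition, also those further from the point; this
costs one tile diameter in the radius. -/
theorem PatchNear.pull {n : ℕ} {L : PentComplex X} {x : L.Point} {L' : PentComplex X}
    {x' : L'.Point} (hL : L.IsTiling) (hL' : L'.IsTiling) {R r : ℝ}
    (h : D.PatchNear n (D.subst L) (D.mapEquiv L x) (D.subst L') (D.mapEquiv L' x') R r) :
    D.PatchNear (n + 1) L x L' x' (R / lipConst - 2 * circumradius) (lipConst * r) := by
  obtain ⟨ψ, h, hx⟩ := h
  refine ⟨D.pull L L' ψ, PatchMap.pull hL.isPasting hL'.isPasting (h.mono le_rfl ?_), ?_⟩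
  · rintro ⟨t, o⟩ ⟨p, hp⟩
    obtain ⟨p', hc⟩ := exists_cell_of_right o centreP
    refine ⟨centreP, ?_⟩
    have h1 := D.pathDist_map_le hL.isJoined x (L.pt t p')
    rw [D.mapEquiv_pt L t hc] at h1
    refine h1.trans ?_
    rw [← le_div_iff₀' lipConst_pos]
    have h2 := hL.isJoined.pathDist_triangle x (L.pt t p) (L.pt t p')
    have h3 := pathDist_pt_le L t p p'
    linarith
  · have h1 := D.pathDist_le_map hL'.isJoined (D.pull L L' ψ x) x'
    refine h1.trans (mul_le_mul_of_nonneg_left ?_ lipConst_pos.le)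
    rw [Decoration.pull, Function.comp_apply, Function.comp_apply, Equiv.apply_symm_apply]
    exact hx

/-- Isomorphisms preserve path distances, so they carry the tiles near y to tiles near x. -/
theorem PatchNear.congr {n : ℕ} {L : PentComplex X} {x : L.Point} {L' : PentComplex X}
    {x' : L'.Point} {M : PentComplex X} {y : M.Point} {M' : PentComplex X} {y' : M'.Point}
    (hL : L.IsJoined) (hM : M.IsJoined) (hL' : L'.IsJoined) {R r : ℝ}
    (h : D.PatchNear n L x L' x' R r) (hs : D.Sim n M y L x) (hs' : D.Sim n L' x' M' y') :
    D.PatchNear n M y M' y' R r := by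
  obtain ⟨φ, h, hx⟩ := h
  obtain ⟨α, hα, rfl⟩ := hs
  obtain ⟨β, hβ, rfl⟩ := hs'
  refine ⟨β ∘ φ ∘ α, ?_, ?_⟩
  · have h1 : D.PatchMap n M L α (tilesNear M y R) := hα.patchMap _
    have h2 : D.PatchMap n M L' (φ ∘ α) (tilesNear M y R) := h1.comp h (by
      rintro t ⟨p, hp⟩ t' e
      obtain ⟨t'', g, -, e'⟩ := hα t
      rw [e', symP_centreP] at e
      obtain ⟨rfl, -⟩ := pt_eq_centre e
      refine ⟨symP g p, ?_⟩
      rw [← e', hα.pathDist_eq hM hL]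
      exact hp)
    exact h2.comp (hβ.patchMap Set.univ) fun _ _ _ _ => trivial
  · exact (hβ.pathDist_le hL' _ _).trans hx

/-- Near points of the hull have isomorphic patches. -/
theorem Near.patchNear {u v : D.PointedTiling} {ε : ℝ} (h : D.Near u v ε) :
    D.PatchNear 0 u.L u.x v.L v.x (1 / ε - 2 * (2 * circumradius)) ε := by
  obtain ⟨φ, hφ, hx⟩ := h
  have hJ := u.inHull.tiling.isJoined
  -- On these tiles φ is given everywhere by one symmetry; a tile only partly in the ball is not
  -- controlled outside it.
  let S : Set u.L.tile := {t | ∀ p, u.L.pt t p ∈ u.L.ball u.x (1 / ε)}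
  have htile : ∀ t ∈ S, D.TileMap 0 u.L v.L φ t := by
    intro t ht
    obtain ⟨t', g, hd, e⟩ := hφ.cells t ⟨centreP, ht _⟩
    exact ⟨t', g, hd, fun p => e p (ht p)⟩
  obtain ⟨f, g, hfg⟩ := exists_tile_choice htile
  have hinj : ∀ t ∈ S, ∀ w ∈ S, φ (u.L.pt t centreP) = φ (u.L.pt w centreP) → t = w := by
    intro t ht w hw e
    refine hJ.tile_eq_of_pathDist ?_
    rw [← hφ.isometry _ (ht _) _ (hw _), e, pathDist_self]
  have hS : tilesNear u.L u.x (1 / ε - 2 * (2 * circumradius)) ⊆ S := by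
    rintro t ⟨p, hp⟩ q
    have h1 := hJ.pathDist_triangle u.x (u.L.pt t p) (u.L.pt t q)
    have h2 := pathDist_pt_le u.L t p q
    have h3 := circumradius_pos
    change u.L.pathDist _ _ ≤ _
    linarith
  refine ⟨φ, ⟨?_, fun t ht => htile t (hS ht)⟩, hx⟩
  rintro y hy _ ⟨w, hw, q, rfl⟩ e
  -- The second diameter is spent here: a point of a tile near u.x is at distance at most 1/ε minus
  -- one diameter, so every tile through it lies in the ball. Lifting tiles at the image point then
  -- gives injectivity, and the path metric has to separate only centres.
  have hyS : ∀ t p, u.L.pt t p = y → t ∈ S := by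
    rintro t p rfl q
    obtain ⟨w', ⟨q', hq'⟩, p', e'⟩ := hy
    have h1 := hJ.pathDist_triangle u.x (u.L.pt w' q') (u.L.pt w' p')
    have h2 := pathDist_pt_le u.L w' q' p'
    rw [← e'] at h1 h2
    have h3 := hJ.pathDist_triangle u.x (u.L.pt t p) (u.L.pt t q)
    have h4 := pathDist_pt_le u.L t p q
    change u.L.pathDist _ _ ≤ _
    linarith
  rw [(hfg w (hS hw)).2] at e
  obtain ⟨t, p, rfl, e1, e2⟩ := exists_lift u.inHull.tiling v.inHull.tiling.isPasting
    (fun t ht => (hfg t ht).2) hinj hyS e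
  have htw : t = w := by
    refine hinj t (hyS t p rfl) w (hS hw) ?_
    rw [(hfg t (hyS t p rfl)).2, (hfg w (hS hw)).2, e1, symP_centreP, symP_centreP]
  subst htw
  rw [symP_injective _ e2]

/-- Points of the hull with isomorphic patches are near. -/
theorem PatchNear.near {u v : D.PointedTiling} {δ R r : ℝ} (hδ : 0 < δ)
    (h : D.PatchNear 0 u.L u.x v.L v.x R r) (hR : 3 / δ + 1 ≤ R) (hr : r ≤ δ) : D.Near u v δ := by
  obtain ⟨φ, hφ, hx⟩ := h
  have hT := u.inHull.tiling
  have hJ := hT.isJoined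
  have hJ' := v.inHull.tiling.isJoined
  have hδ' : 0 < 1 / δ := by positivity
  have h3 : 3 / δ = 3 * (1 / δ) := by ring
  obtain ⟨f, g, hfg⟩ := exists_tile_choice hφ.tile
  have hf := fun t ht => (hfg t ht).2
  -- Two points of the ball are at distance at most 2/δ, so nearly shortest paths between them have
  -- length below 2/δ + 1 and stay within 3/δ + 1 of the centre of the ball.
  have hnear : ∀ y ∈ u.L.ball u.x (1 / δ), ∀ l < 2 * (1 / δ) + 1, ∀ t p,
      u.L.pathDist y (u.L.pt t p) ≤ l → t ∈ tilesNear u.L u.x R := by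
    intro y hy l hl t p hp
    refine ⟨p, ?_⟩
    have h1 := hJ.pathDist_triangle u.x y (u.L.pt t p)
    change u.L.pathDist _ _ ≤ _ at hy
    linarith
  have hmem : ∀ y ∈ u.L.ball u.x (1 / δ), ∀ t p, u.L.pt t p = y → t ∈ tilesNear u.L u.x R := by
    rintro y hy t p rfl
    exact hnear _ hy 0 (by linarith) t p (by rw [pathDist_self])
  have hle : ∀ y ∈ u.L.ball u.x (1 / δ), ∀ z ∈ u.L.ball u.x (1 / δ),
      u.L.pathDist y z ≤ 2 * (1 / δ) := by
    intro y hy z hz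
    have h1 := hJ.pathDist_triangle y u.x z
    rw [pathDist_comm u.L y u.x] at h1
    change u.L.pathDist _ _ ≤ _ at hy hz
    linarith
  have hmap : ∀ y ∈ u.L.ball u.x (1 / δ), ∀ z ∈ u.L.ball u.x (1 / δ),
      v.L.pathDist (φ y) (φ z) ≤ u.L.pathDist y z := by
    intro y hy z hz
    refine le_of_forall_pos_lt_add fun η hη => ?_
    obtain ⟨l, hl, hp⟩ := hJ.exists_path
      (lt_add_of_pos_right (u.L.pathDist y z) (lt_min hη one_pos))
    have hl2 : l < 2 * (1 / δ) + 1 := by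
      have := hle y hy z hz
      have := min_le_right η 1
      linarith
    have := pathDist_le (PathLength.map hp
      (fun t p ht => hφ.tile t (hnear y hy l hl2 t p ht)) hJ)
    have := min_le_left η 1
    linarith
  refine ⟨φ, ⟨fun y hy z hz => le_antisymm (hmap y hy z hz) ?_, fun t ht => ?_,
    fun t k ht => ?_⟩, hx.trans hr⟩
  · refine le_of_forall_pos_lt_add fun η hη => ?_
    obtain ⟨l, hl, hp⟩ := hJ'.exists_path
      (lt_add_of_pos_right (v.L.pathDist (φ y) (φ z)) (lt_min hη one_pos))
    have hl2 : l < 2 * (1 / δ) + 1 := by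
      have := hmap y hy z hz
      have := hle y hy z hz
      have := min_le_right η 1
      linarith
    obtain ⟨z', hz', hp'⟩ := exists_path_lift hT v.inHull.tiling.isPasting hf hφ.centre_inj hp y rfl
      (hnear y hy l hl2)
    -- The lifted path ends at a point with the same image as z, and φ is injective on the patch.
    have hzz : z' = z := by
      obtain ⟨t, p, rfl⟩ := exists_pt z
      obtain ⟨t', p', rfl⟩ := exists_pt z'
      refine hφ.inj (pt_mem_support ?_ p') (pt_mem_support (hmem _ hz t p rfl) p) hz'
      exact hnear y hy l hl2 t' p' (pathDist_le hp')
    rw [hzz] at hp'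
    have := pathDist_le hp'
    have := min_le_left η 1
    linarith
  · obtain ⟨p, hp⟩ := ht
    obtain ⟨t', g, hd, e⟩ := hφ.tile t (hmem _ hp t p rfl)
    exact ⟨t', g, hd, fun p _ => e p⟩
  -- The corners at y correspond bijectively to the corners at φ y: injectivity is the separation of
  -- centres, surjectivity is `exists_lift`.
  · set y := u.L.pt t (vertP k) with hy
    refine (Nat.card_congr (Equiv.ofBijective (fun c : {c : u.L.tile × ZMod 5 //
      u.L.pt c.1 (vertP c.2) = y} => (⟨(f c.1.1, symIdx (g c.1.1) c.1.2), ?_⟩ :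
        {c : v.L.tile × ZMod 5 // v.L.pt c.1 (vertP c.2) = φ y})) ⟨?_, ?_⟩)).symm
    · have h1 := hmem y ht c.1.1 _ c.2
      change v.L.pt (f c.1.1) (vertP (symIdx (g c.1.1) c.1.2)) = _
      rw [← symP_vertP, ← hf _ h1, c.2]
    · rintro ⟨⟨t₁, k₁⟩, h1⟩ ⟨⟨t₂, k₂⟩, h2⟩ e
      have e' := congrArg Subtype.val e
      obtain ⟨e1, e2⟩ := Prod.mk.inj e'
      have m1 := hmem y ht t₁ _ h1
      have m2 := hmem y ht t₂ _ h2
      obtain rfl : t₁ = t₂ := by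
        refine hφ.centre_inj t₁ m1 t₂ m2 ?_
        rw [hf _ m1, hf _ m2, e1, symP_centreP, symP_centreP]
      obtain rfl := symIdx_injective _ e2
      rfl
    · rintro ⟨⟨w, j⟩, h1⟩
      obtain ⟨s, p, hp, rfl, e⟩ := exists_lift hT v.inHull.tiling.isPasting hf hφ.centre_inj
        (hmem y ht) h1.symm
      obtain ⟨i, rfl⟩ := symIdx_surjective (g s) j
      rw [← symP_vertP] at e
      obtain rfl := symP_injective _ e
      exact ⟨⟨(s, i), hp⟩, rfl⟩

end Decoration

/-! ### Continuity of the substitution and of its inverse -/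

namespace Decoration

open PentComplex

variable {X : Type} [MulAction (DihedralGroup 5) X] {D : Decoration X}

theorem exists_patchNear_of_near {R r : ℝ} (hr : 0 < r) :
    ∃ ε > 0, ∀ (u v : D.PointedTiling) (δ : ℝ), 0 < δ → δ < ε → D.Near u v δ →
      D.PatchNear 0 u.L u.x v.L v.x R r := by
  have hc := circumradius_pos
  have hA : 0 < |R| + 2 * (2 * circumradius) := by positivity
  refine ⟨min r (1 / (|R| + 2 * (2 * circumradius))), lt_min hr (by positivity),
    fun u v δ h0 hδ h => h.patchNear.mono le_rfl ?_ (hδ.le.trans (min_le_left _ _))⟩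
  have h1 := one_div_le_one_div_of_le h0 (hδ.le.trans (min_le_right _ _))
  rw [one_div_one_div] at h1
  have := le_abs_self R
  linarith

/-- The demands R and r on the image determine demands on the source that do not depend on the
tilings or the level; this makes the continuity below uniform. -/
theorem exists_push (R : ℝ) {r : ℝ} (hr : 0 < r) : ∃ R₀ r₀ : ℝ, 0 < r₀ ∧
    ∀ (n : ℕ) (L : PentComplex X) (x : L.Point) (L' : PentComplex X) (x' : L'.Point),
      L.IsTiling → L'.IsTiling → D.PatchNear (n + 1) L x L' x' R₀ r₀ →
        D.PatchNear n (D.subst L) (D.mapEquiv L x) (D.subst L') (D.mapEquiv L' x') R r := by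
  have hC := lipConst_pos
  refine ⟨R * lipConst, r / lipConst, by positivity, fun n L x L' x' hL hL' h => ?_⟩
  refine (h.push hL.isJoined hL'.isJoined).mono le_rfl ?_ ?_
  · rw [mul_div_cancel_right₀ _ hC.ne']
  · rw [mul_div_cancel₀ _ hC.ne']

theorem exists_pull (R : ℝ) {r : ℝ} (hr : 0 < r) : ∃ R₀ r₀ : ℝ, 0 < r₀ ∧
    ∀ (n : ℕ) (L : PentComplex X) (x : L.Point) (L' : PentComplex X) (x' : L'.Point),
      L.IsTiling → L'.IsTiling →
        D.PatchNear n (D.subst L) (D.mapEquiv L x) (D.subst L') (D.mapEquiv L' x') R₀ r₀ →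
          D.PatchNear (n + 1) L x L' x' R r := by
  have hC := lipConst_pos
  refine ⟨(R + 2 * circumradius) * lipConst, r / lipConst, by positivity,
    fun n L x L' x' hL hL' h => ?_⟩
  refine (h.pull hL hL').mono le_rfl ?_ ?_
  · rw [mul_div_cancel_right₀ _ hC.ne', add_sub_cancel_right]
  · rw [mul_div_cancel₀ _ hC.ne']

theorem exists_push_iter (n : ℕ) (R : ℝ) {r : ℝ} (hr : 0 < r) : ∃ R₀ r₀ : ℝ, 0 < r₀ ∧
    ∀ (L : PentComplex X) (x : L.Point) (L' : PentComplex X) (x' : L'.Point),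
      L.IsTiling → L'.IsTiling → D.PatchNear n L x L' x' R₀ r₀ →
        D.PatchNear 0 (D.iter n L) (D.iterPt n L x) (D.iter n L') (D.iterPt n L' x') R r := by
  induction n with
  | zero => exact ⟨R, r, hr, fun _ _ _ _ _ _ h => h⟩
  | succ n ih =>
    obtain ⟨R₁, r₁, hr₁, h₁⟩ := ih
    obtain ⟨R₀, r₀, hr₀, h₀⟩ := exists_push (D := D) R₁ hr₁
    exact ⟨R₀, r₀, hr₀, fun L x L' x' hL hL' h =>
      h₁ _ _ _ _ (isTiling_subst hL) (isTiling_subst hL') (h₀ n L x L' x' hL hL' h)⟩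

theorem exists_pull_iter (n k : ℕ) (R : ℝ) {r : ℝ} (hr : 0 < r) : ∃ R₀ r₀ : ℝ, 0 < r₀ ∧
    ∀ (L : PentComplex X) (x : L.Point) (L' : PentComplex X) (x' : L'.Point),
      L.IsTiling → L'.IsTiling →
        D.PatchNear k (D.iter n L) (D.iterPt n L x) (D.iter n L') (D.iterPt n L' x') R₀ r₀ →
          D.PatchNear (k + n) L x L' x' R r := by
  induction n generalizing R r with
  | zero => exact ⟨R, r, hr, fun _ _ _ _ _ _ h => h⟩
  | succ n ih =>
    obtain ⟨R₁, r₁, hr₁, h₁⟩ := exists_pull (D := D) R hr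
    obtain ⟨R₀, r₀, hr₀, h₀⟩ := ih R₁ hr₁
    exact ⟨R₀, r₀, hr₀, fun L x L' x' hL hL' h => h₁ _ _ _ _ _ hL hL'
      (h₀ _ _ _ _ (isTiling_subst hL) (isTiling_subst hL') h)⟩

/-! ### Uniform continuity in both directions -/

theorem exists_near_of_hullDist_lt {a b : D.Hull} {δ : ℝ} (hδ : δ ≤ 1 / √2)
    (h : D.hullDist a b < δ) : ∃ ε, 0 < ε ∧ ε < δ ∧ ∃ u v : D.PointedTiling,
      D.toHull u.L u.inHull u.x = a ∧ D.toHull v.L v.inHull v.x = b ∧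
        D.Near u v ε ∧ D.Near v u ε := by
  obtain ⟨ε, hε, hlt⟩ := exists_lt_of_csInf_lt (Set.insert_nonempty _ _) h
  -- The inserted number 1/√2 is not below δ, so a genuine ε witnesses the infimum.
  rcases hε with rfl | ⟨h0, u, v, hu, hv, h1, h2⟩
  · exact absurd hlt (not_lt.mpr hδ)
  · exact ⟨ε, h0, hlt, u, v, hu, hv, h1, h2⟩

theorem hullDist_le_of_near {u v : D.PointedTiling} {δ : ℝ} (hδ : 0 < δ) (h : D.Near u v δ)
    (h' : D.Near v u δ) :
    D.hullDist (D.toHull u.L u.inHull u.x) (D.toHull v.L v.inHull v.x) ≤ δ := by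
  refine csInf_le ⟨0, ?_⟩ (Or.inr ⟨hδ, u, v, rfl, rfl, h, h'⟩)
  rintro ε (rfl | ⟨h0, -⟩)
  · positivity
  · exact h0.le

theorem exists_hullDist_hullMap_lt {ε : ℝ} (hε : 0 < ε) : ∃ δ > 0, ∀ a b : D.Hull,
    D.hullDist a b < δ → D.hullDist (D.hullMap a) (D.hullMap b) < ε := by
  -- The radius is what `PatchNear.near` demands for δ = ε/2; half of ε leaves room for a strict
  -- inequality.
  obtain ⟨R₀, r₀, hr₀, h₀⟩ := exists_push (D := D) (3 / (ε / 2) + 1) (half_pos hε)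
  obtain ⟨η, hη, h₁⟩ := exists_patchNear_of_near (D := D) (R := R₀) hr₀
  refine ⟨min η (1 / √2), lt_min hη (by positivity), fun a b h => ?_⟩
  obtain ⟨θ, hθ, hlt, u, v, rfl, rfl, n₁, n₂⟩ := exists_near_of_hullDist_lt (min_le_right _ _) h
  have hlt' := hlt.trans_le (min_le_left _ _)
  rw [hullMap_toHull, hullMap_toHull]
  have key : ∀ u v : D.PointedTiling, D.Near u v θ →
      D.Near ⟨D.subst u.L, inHull_subst u.inHull, D.mapEquiv u.L u.x⟩
        ⟨D.subst v.L, inHull_subst v.inHull, D.mapEquiv v.L v.x⟩ (ε / 2) := by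
    intro u v h
    have h2 := h₀ 0 _ _ _ _ u.inHull.tiling v.inHull.tiling
      ((h₁ u v θ hθ hlt' h).mono (Nat.zero_le 1) le_rfl le_rfl)
    exact PatchNear.near (u := ⟨D.subst u.L, inHull_subst u.inHull, D.mapEquiv u.L u.x⟩)
      (v := ⟨D.subst v.L, inHull_subst v.inHull, D.mapEquiv v.L v.x⟩) (half_pos hε) h2 le_rfl le_rfl
  exact (hullDist_le_of_near (half_pos hε) (key u v n₁) (key v u n₂)).trans_lt (half_lt_self hε)

/-- The argument for injectivity with patches in place of tilings: pull back N + 1 times to A and B,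
lower the level from N + 1 to N by stability, and push N times, tracking radius and displacement. -/
theorem exists_hullDist_lt_of_hullMap [Finite X] {ε : ℝ} (hε : 0 < ε) : ∃ δ > 0, ∀ a b : D.Hull,
    D.hullDist (D.hullMap a) (D.hullMap b) < δ → D.hullDist a b < ε := by
  obtain ⟨N, hN⟩ := D.exists_eqv_stable
  obtain ⟨R₁, r₁, hr₁, h₁⟩ := exists_push_iter (D := D) N (3 / (ε / 2) + 1) (half_pos hε)
  obtain ⟨R₂, r₂, hr₂, h₂⟩ := exists_pull_iter (D := D) N 1 R₁ hr₁
  obtain ⟨R₃, r₃, hr₃, h₃⟩ := exists_pull (D := D) R₂ hr₂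
  obtain ⟨η, hη, h₄⟩ := exists_patchNear_of_near (D := D) (R := R₃) hr₃
  refine ⟨min η (1 / √2), lt_min hη (by positivity), fun a b h => ?_⟩
  obtain ⟨θ, hθ, hlt, u, v, hu, hv, n₁, n₂⟩ := exists_near_of_hullDist_lt (min_le_right _ _) h
  have hlt' := hlt.trans_le (min_le_left _ _)
  obtain ⟨L, hL, x, rfl⟩ := exists_toHull a
  obtain ⟨L', hL', x', rfl⟩ := exists_toHull b
  rw [hullMap_toHull, toHull_eq_iff] at hu hv
  obtain ⟨A, p, hA, hA', s⟩ := exists_sim_iter hL x N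
  obtain ⟨B, q, hB, hB', s'⟩ := exists_sim_iter hL' x' N
  have key : ∀ (A B : PentComplex X) (p : A.Point) (q : B.Point) (hA : A.IsTiling)
      (hB : B.IsTiling) (hA' : D.InHull (D.iter N A)) (hB' : D.InHull (D.iter N B))
      (u v : D.PointedTiling), D.Near u v θ →
      D.Sim 0 (D.subst (D.iter N A)) (D.mapEquiv _ (D.iterPt N A p)) u.L u.x →
      D.Sim 0 (D.subst (D.iter N B)) (D.mapEquiv _ (D.iterPt N B q)) v.L v.x →
      D.Near ⟨D.iter N A, hA', D.iterPt N A p⟩ ⟨D.iter N B, hB', D.iterPt N B q⟩ (ε / 2) := by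
    intro A B p q hA hB hA' hB' u v h s s'
    have g₁ := (h₄ u v θ hθ hlt' h).congr u.inHull.tiling.isJoined
      (inHull_subst hA').tiling.isJoined v.inHull.tiling.isJoined s s'.symm
    have g₂ := h₂ _ _ _ _ hA hB (h₃ 0 _ _ _ _ hA'.tiling hB'.tiling g₁)
    rw [add_comm] at g₂
    obtain ⟨φ, hφ, hx⟩ := g₂
    have g₃ := h₁ _ _ _ _ hA hB ⟨φ, eqv_of_stable hN hφ, hx⟩
    exact PatchNear.near (u := ⟨D.iter N A, hA', D.iterPt N A p⟩)
      (v := ⟨D.iter N B, hB', D.iterPt N B q⟩) (half_pos hε) g₃ le_rfl le_rfl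
  have t := (s.mono (Nat.zero_le 1)).push.trans hu.symm
  have t' := (s'.mono (Nat.zero_le 1)).push.trans hv.symm
  have e := hullDist_le_of_near (half_pos hε) (key A B p q hA hB hA' hB' u v n₁ t t')
    (key B A q p hB hA hB' hA' v u n₂ t' t)
  rw [← toHull_eq_iff.mpr s, ← toHull_eq_iff.mpr s']
  exact e.trans_lt (half_lt_self hε)

variable (D)

/-- The substitution map is a homeomorphism of the continuous hull. -/
theorem isHomeomorph_hullMap [Finite X] : IsHomeomorph D.hullMap where
  continuous := by
    -- Open sets are defined through balls of `hullDist`, so the two uniform estimates suffice and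
    -- the triangle inequality for `hullDist` is not needed.
    refine ⟨fun U hU a ha => ?_⟩
    obtain ⟨ε, hε, h⟩ := hU _ ha
    obtain ⟨δ, hδ, h'⟩ := exists_hullDist_hullMap_lt (D := D) hε
    exact ⟨δ, hδ, fun b hb => h _ (h' a b hb)⟩
  isOpenMap := by
    rintro U hU _ ⟨a, ha, rfl⟩
    obtain ⟨ε, hε, h⟩ := hU a ha
    obtain ⟨δ, hδ, h'⟩ := exists_hullDist_lt_of_hullMap (D := D) hε
    refine ⟨δ, hδ, fun b hb => ?_⟩
    obtain ⟨b, rfl⟩ := D.hullMap_surjective b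
    exact ⟨b, h b (h' a b hb), rfl⟩
  bijective := ⟨D.hullMap_injective, D.hullMap_surjective⟩

end Decoration

end PentHull

end

theorem theoremt {X : Type} [Finite X] [MulAction (DihedralGroup 5) X]
    (D : PentHull.Decoration X) :
    (∀ L : PentHull.PentComplex X, D.InHull L →
      D.InHull (D.subst L) ∧ ∀ x : L.Point, ∃! y : (D.subst L).Point, D.SubstGraph L x y) ∧
    ∃ ω : D.Hull → D.Hull,
      (∀ (L : PentHull.PentComplex X) (hL : D.InHull L) (hL' : D.InHull (D.subst L))
        (x : L.Point) (y : (D.subst L).Point), D.SubstGraph L x y →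
          ω (D.toHull L hL x) = D.toHull (D.subst L) hL' y) ∧
      IsHomeomorph ω := by
  refine ⟨fun L hL => ⟨PentHull.Decoration.inHull_subst hL, D.existsUnique_substGraph L⟩,
    D.hullMap, fun L hL hL' x y h => ?_, D.isHomeomorph_hullMap⟩
  obtain rfl := D.mapEquiv_eq_iff.mpr h
  exact D.hullMap_toHull L hL x
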